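/- **Setting.** Let $m\ge 1$ and $J=\begin{pmatrix}0&-I_m\\ I_m&0\end{pmatrix}$. Let $E,F$ be continuous and bounded functions on $(0,\infty)$ whose values are real symmetric $2m\times 2m$ matrices. With the bilinear form $\langle z,w\rangle=\sum_{j=1}^{2m} z_jw_j$, a solution $\Psi_\lambda$ of the Hamiltonian system $J\Psi_\lambda'(x)=(\lambda E(x)+F(x))\Psi_\lambda(x)$ $(x>0)$ has the kernel $$K_\lambda(x,y)=\frac{\langle J\Psi_\lambda(x),\Psi_\lambda(y)\rangle}{x-y}\quad(x\ne y),\qquad K_\lambda(x,x)=\langle\Psi_\lambda(x),(\lambda E(x)+F(x))\Psi_\lambda(x)\rangle ,$$ which also denotes the integral operator on $H=L^2((0,\infty);\mathbb C)$. Let $S_tf(x)=f(x-t)$ for $x>t$ and $S_tf(x)=0$ for $0<x\le t$, and let $K_{t,\lambda}=S_t^\dagger K_\lambda S_t$ $(t\ge 0)$. For a continuous $L:(0,\infty)^2\to M_{2m}(\mathbb C)$ write $L\succeq 0$ if $L(x,y)=\sum_{j=1}^\infty E_j(y)^\dagger E_j(x)$ for continuous $E_j:(0,\infty)\to M_{2m}(\mathbb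 C)$ with $\sup_x\|\sum_jE_j(x)^\dagger E_j(x)\|<\infty$; for a divided difference, $L$ is its continuous extension to the diagonal. **Proposition 3.3.** Let $\varepsilon\in\{1,-1\}$ and suppose that $$\varepsilon\,\frac{E(x)-E(y)}{x-y}\succeq0,\qquad \varepsilon\,\frac{F(x)-F(y)}{x-y}\succeq0\qquad(x,y>0).$$ **(A)** Suppose that for some $\lambda>0$ there is a bounded continuous solution $\Psi_\lambda\in L^2((0,\infty);\mathbb R^{2m})$. Then $K_\lambda$ is a bounded operator on $H$, $K_{t,\lambda}$ has kernel $K_\lambda(x+t,y+t)$, and: (i) The operators $S_s^\dagger=e^{-sA}$ form a bounded $C_0$ semigroup, and $\frac{\partial}{\partial t}K_{t,\lambda}=-AK_{t,\lambda}-K_{t,\lambda}A^\dagger$ for $t>0$ as sesquilinear forms on $D(A^\dagger)\times D(A^\dagger)$. Further $-\varepsilon K_{t,\lambda}\ge0$ for all $t\ge 0$; $-\varepsilon K_{t,\lambda}\le I$ for all sufficiently large $t$; $t\mapsto-\varepsilon K_{t,\lambda}$ is decreasing and converges strongly to $0$ as $t\to\infty$. (So for $\varepsilon=-1$, that is for $(E(x)-E(y))/(x-y)\preceq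 0$ and $(F(x)-F(y))/(x-y)\preceq0$, the operators $K_{t,\lambda}$ themselves are positive and decrease to $0$.) For all $t\ge0$, $K_{t,\lambda}$ is self-adjoint, Hilbert–Schmidt and integrable, i.e. off the diagonal its kernel is $\sum_{j=1}^N\psi_j(x)\xi_j(y)/(x-y)$ for some finite $N$ with measurable, locally bounded $\psi_j,\xi_j$ and $\sum_j\psi_j(x)\xi_j(x)=0$. (ii) For all $t\ge 0$, $K_{t,\lambda}$ is of trace class, and $\operatorname{trace}K_{t,\lambda}=\int_t^\infty\langle\Psi_\lambda(x),(\lambda E(x)+F(x))\Psi_\lambda(x)\rangle\,dx$, where the integral converges absolutely. (iii) If the decompositions of $\varepsilon(E(x)-E(y))/(x-y)$ and $\varepsilon(F(x)-F(y))/(x-y)$ can be taken to be finite sums, then for every $t>0$ the kernel $\frac{\partial}{\partial t}K_\lambda(x+t,y+t)$ exists for all $x,y>0$ and is the kernel of a bounded operator of finite rank on $H$. **(B)** Let $D\subseteq\mathbb C$ be a domain that is symmetric about the real axis and contains $(0,\infty)$, and let $\Psi_\lambda\in L^2((0,\infty);\mathbb C^{2m})$ $(\lambda\in D)$ be bounded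 solutions that depend analytically on $\lambda$, as elements of $L^2((0,\infty);\mathbb C^{2m})$, and are real-valued for $\lambda>0$. Then for all $t\ge0$ and $\lambda\in D$ the kernel $K_\lambda(x+t,y+t)$ defines the bounded operator $K_{t,\lambda}$ on $H$, which is Hilbert–Schmidt and integrable; $\lambda\mapsto K_{t,\lambda}$ is analytic on $D$ in operator norm; and $K_{t,\bar\lambda}=K_{t,\lambda}^\dagger$. -/

import Mathlib

open MeasureTheory Set Filter Topology
open scoped Matrix Matrix.Norms.L2Operator ComplexConjugate

noncomputable section

namespace HamKernel

/-! ### The Hilbert space `L²(0,∞)` and the shift -/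

/-- Lebesgue measure on `(0,∞)`. -/
abbrev halfLine : Measure ℝ := volume.restrict (Ioi (0 : ℝ))

/-- The complex Hilbert space `L²(0,∞)`. -/
abbrev L2 : Type := Lp ℂ 2 halfLine

/-- The function `x ↦ f (x - t)`, where `f` is extended by `0` from `(0,∞)` to `ℝ`. -/
def shiftFun (t : ℝ) (f : ℝ → ℂ) : ℝ → ℂ := fun x => (Ioi (0 : ℝ)).indicator f (x - t)

lemma memLp_indicator {f : ℝ → ℂ} (hf : MemLp f 2 halfLine) :
    MemLp ((Ioi (0 : ℝ)).indicator f) 2 volume :=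
  (memLp_indicator_iff_restrict measurableSet_Ioi).2 hf

lemma memLp_shiftFun (t : ℝ) {f : ℝ → ℂ} (hf : MemLp f 2 halfLine) :
    MemLp (shiftFun t f) 2 halfLine :=
  ((memLp_indicator hf).comp_measurePreserving
    (measurePreserving_sub_right volume t)).restrict _

lemma eLpNorm_shiftFun_le (t : ℝ) {f : ℝ → ℂ} (hf : MemLp f 2 halfLine) :
    eLpNorm (shiftFun t f) 2 halfLine ≤ eLpNorm f 2 halfLine := by
  have h1 : eLpNorm (shiftFun t f) 2 volume = eLpNorm ((Ioi (0 : ℝ)).indicator f) 2 volume :=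
    eLpNorm_comp_measurePreserving (memLp_indicator hf).1 (measurePreserving_sub_right volume t)
  rw [eLpNorm_indicator_eq_eLpNorm_restrict measurableSet_Ioi] at h1
  exact h1 ▸ eLpNorm_mono_measure _ Measure.restrict_le_self

lemma shiftFun_congr (t : ℝ) {f g : ℝ → ℂ} (h : f =ᵐ[halfLine] g) :
    shiftFun t f =ᵐ[halfLine] shiftFun t g := by
  have h1 : (Ioi (0 : ℝ)).indicator f =ᵐ[volume] (Ioi (0 : ℝ)).indicator g := by
    have h2 := (ae_restrict_iff' measurableSet_Ioi).1 h
    filter_upwards [h2] with x hx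
    by_cases hx0 : x ∈ Ioi (0 : ℝ)
    · simp [indicator_of_mem hx0, hx hx0]
    · simp [indicator_of_notMem hx0]
  exact ae_restrict_of_ae
    ((measurePreserving_sub_right volume t).quasiMeasurePreserving.ae_eq_comp h1)

/-- The shift `S_t f (x) = f (x - t)` on `L²(0,∞)` (with `f = 0` on `(-∞, 0]`). It is used for
`t ≥ 0` only. -/
def shift (t : ℝ) : L2 →L[ℂ] L2 :=
  LinearMap.mkContinuous
    { toFun := fun f => (memLp_shiftFun t (Lp.memLp f)).toLp (shiftFun t f)
      map_add' := by
        intro f g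
        rw [← MemLp.toLp_add]
        apply MemLp.toLp_congr
        refine (shiftFun_congr t (Lp.coeFn_add f g)).trans (Eventually.of_forall fun x => ?_)
        by_cases hx : t < x <;> simp [shiftFun, indicator, hx]
      map_smul' := by
        intro c f
        rw [RingHom.id_apply, ← MemLp.toLp_const_smul]
        apply MemLp.toLp_congr
        refine (shiftFun_congr t (Lp.coeFn_smul c f)).trans (Eventually.of_forall fun x => ?_)
        by_cases hx : t < x <;> simp [shiftFun, indicator, hx] }
    1
    (by
      intro f
      simp only [LinearMap.coe_mk, AddHom.coe_mk, one_mul, Lp.norm_toLp]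
      rw [Lp.norm_def]
      exact ENNReal.toReal_mono (Lp.memLp f).2.ne (eLpNorm_shiftFun_le t (Lp.memLp f)))

/-- `K_t = S_t† K S_t`. -/
def shifted (K : L2 →L[ℂ] L2) (t : ℝ) : L2 →L[ℂ] L2 :=
  (ContinuousLinearMap.adjoint (shift t)).comp (K.comp (shift t))

/-! ### Integral operators, Hilbert-Schmidt and trace class operators on `L²(0,∞)` -/

/-- `T` is the integral operator `T f (x) = ∫₀^∞ k(x,y) f(y) dy`. -/
def HasKernel (T : L2 →L[ℂ] L2) (k : ℝ → ℝ → ℂ) : Prop :=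
  ∀ f : L2, ∀ᵐ x ∂halfLine,
    Integrable (fun y => k x y * f y) halfLine ∧ T f x = ∫ y, k x y * f y ∂halfLine

section Operators

variable {H : Type} [NormedAddCommGroup H] [InnerProductSpace ℂ H] [CompleteSpace H]

/-- Hilbert-Schmidt operators: `∑ ‖T e_i‖² < ∞` for every orthonormal basis. (Every Hilbert space
in `Type` has an orthonormal basis indexed by a type in `Type`.) -/
def IsHilbertSchmidt (T : H →L[ℂ] H) : Prop :=
  ∀ (ι : Type) (b : HilbertBasis ι ℂ H), Summable fun i => ‖T (b i)‖ ^ 2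

/-- Trace class operators: `∑ ⟨|T| e_i, e_i⟩ < ∞` for every orthonormal basis, where
`|T| = (T†T)^{1/2}`. -/
def IsTraceClass (T : H →L[ℂ] H) : Prop :=
  ∀ (ι : Type) (b : HilbertBasis ι ℂ H), Summable fun i => (inner ℂ (b i) (CFC.abs T (b i))).re

/-- `T` is of trace class with trace `τ = ∑ ⟨T e_i, e_i⟩` (in every orthonormal basis). -/
def HasTrace (T : H →L[ℂ] H) (τ : ℂ) : Prop :=
  IsTraceClass T ∧
    ∀ (ι : Type) (b : HilbertBasis ι ℂ H), HasSum (fun i => inner ℂ (b i) (T (b i))) τ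

end Operators

/-- Integrable kernels on `(0,∞)`: `k(x,y) = ∑ ψ_j(x) ξ_j(y) / (x - y)` with finitely many measurable
and locally bounded `ψ_j`, `ξ_j` such that `∑ ψ_j(x) ξ_j(x) = 0`. -/
def IsIntegrableKernel (k : ℝ → ℝ → ℂ) : Prop :=
  ∃ (N : ℕ) (ψ ξ : Fin N → ℝ → ℂ),
    (∀ j, Measurable (ψ j) ∧ Measurable (ξ j)) ∧
    (∀ C ⊆ Ioi (0 : ℝ), IsCompact C → ∃ B : ℝ, ∀ j, ∀ x ∈ C, ‖ψ j x‖ ≤ B ∧ ‖ξ j x‖ ≤ B) ∧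
    (∀ x > 0, ∀ y > 0, x ≠ y → k x y = (∑ j, ψ j x * ξ j y) / ((x : ℂ) - y)) ∧
    (∀ x > 0, ∑ j, ψ j x * ξ j x = 0)

/-! ### Semigroups and generators -/

/-- `(T_s)_{s ≥ 0}` is a bounded `C₀` semigroup. -/
structure IsBoundedC0Semigroup (T : ℝ → L2 →L[ℂ] L2) : Prop where
  zero : T 0 = 1
  add : ∀ s ≥ 0, ∀ t ≥ 0, T (s + t) = (T s).comp (T t)
  tendsto : ∀ f, Tendsto (fun t => T t f) (𝓝[>] 0) (𝓝 f)
  bounded : ∃ M : ℝ, ∀ t ≥ 0, ‖T t‖ ≤ M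

/-- The infinitesimal generator of `(T_t)`, as an unbounded operator: its domain consists of
the `f` for which `h = lim_{t↓0} (T_t f - f)/t` exists, and it sends `f` to `h`. -/
def generator (T : ℝ → L2 →L[ℂ] L2) : L2 →ₗ.[ℂ] L2 where
  domain :=
    { carrier := {f | ∃ h, Tendsto (fun t : ℝ => ((t : ℂ)⁻¹) • (T t f - f)) (𝓝[>] 0) (𝓝 h)}
      zero_mem' := ⟨0, by simp⟩
      add_mem' := by
        rintro f g ⟨h, hf⟩ ⟨k, hg⟩
        refine ⟨h + k, (hf.add hg).congr fun t => ?_⟩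
        rw [map_add, ← smul_add]
        congr 1
        abel
      smul_mem' := by
        rintro c f ⟨h, hf⟩
        refine ⟨c • h, (hf.const_smul c).congr fun t => ?_⟩
        rw [map_smul, smul_comm, smul_sub] }
  toFun :=
    { toFun := fun f => f.2.choose
      map_add' := by
        intro f g
        refine tendsto_nhds_unique (f + g).2.choose_spec
          ((f.2.choose_spec.add g.2.choose_spec).congr fun t => ?_)
        rw [Submodule.coe_add, map_add, ← smul_add]
        congr 1
        abel
      map_smul' := by
        intro c f
        refine tendsto_nhds_unique (c • f).2.choose_spec
          ((f.2.choose_spec.const_smul c).congr fun t => ?_)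
        rw [Submodule.coe_smul, map_smul, smul_comm, smul_sub] }

/-- The operator `A` with `e^{-sA} = S_s†`, i.e. `-A` generates the semigroup `(S_s†)`. -/
def opA : L2 →ₗ.[ℂ] L2 := -generator fun s => ContinuousLinearMap.adjoint (shift s)

/-- The Lyapunov equation `dK_s/ds = - A K_s - K_s A†` for `s > 0`, as sesquilinear forms on
`D(A†) × D(A†)`, so `⟨A K_s f, g⟩` is read as `⟨K_s f, A† g⟩`. (Mathlib's inner product is linear
in its second argument.) -/
def SatisfiesLyapunov (A : L2 →ₗ.[ℂ] L2) (K : ℝ → L2 →L[ℂ] L2) : Prop :=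
  ∀ f g : A.adjoint.domain, ∀ t > 0,
    HasDerivAt (fun s => inner ℂ (g : L2) (K s f))
      (-inner ℂ (A.adjoint g) (K t f) - inner ℂ (g : L2) (K t (A.adjoint f))) t

/-! ### Positive matrix kernels -/

section Matrices

variable {ι : Type} [Fintype ι] [DecidableEq ι]

/-- `L(x,y) = ∑_j G_j(y)† G_j(x)` on `(0,∞)²`, with continuous `G_j` such that
`sup_x ‖∑_j G_j(x)† G_j(x)‖ < ∞`. -/
structure IsDecomposition (L : ℝ → ℝ → Matrix ι ι ℂ) (G : ℕ → ℝ → Matrix ι ι ℂ) : Prop where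
  continuousOn : ∀ j, ContinuousOn (G j) (Ioi 0)
  hasSum : ∀ x > 0, ∀ y > 0, HasSum (fun j => (G j y)ᴴ * G j x) (L x y)
  bounded : ∃ C : ℝ, ∀ x > 0, ‖∑' j, (G j x)ᴴ * G j x‖ ≤ C

/-- `L ⪰ 0` on `(0,∞)`. -/
def PosKernel (L : ℝ → ℝ → Matrix ι ι ℂ) : Prop :=
  ContinuousOn (Function.uncurry L) (Ioi 0 ×ˢ Ioi 0) ∧ ∃ G, IsDecomposition L G

/-- `L ⪰ 0` on `(0,∞)`, with a finite sum. -/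
def FinitePosKernel (L : ℝ → ℝ → Matrix ι ι ℂ) : Prop :=
  ContinuousOn (Function.uncurry L) (Ioi 0 ×ˢ Ioi 0) ∧
    ∃ G, IsDecomposition L G ∧ ∃ N : ℕ, ∀ j ≥ N, G j = 0

/-- Off the diagonal, `L(x,y) = ε (E(x) - E(y)) / (x - y)`. A continuous `L` is then determined on the
diagonal too. -/
def IsDividedDifference (ε : ℝ) (E : ℝ → Matrix ι ι ℝ) (L : ℝ → ℝ → Matrix ι ι ℂ) : Prop :=
  ∀ x > 0, ∀ y > 0, x ≠ y → L x y = ((ε / (x - y)) • (E x - E y)).map Complex.ofReal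

/-- `ε (E(x) - E(y)) / (x - y) ⪰ 0` on `(0,∞)`. -/
def DividedDifferencePos (ε : ℝ) (E : ℝ → Matrix ι ι ℝ) : Prop :=
  ∃ L, IsDividedDifference ε E L ∧ PosKernel L

/-- `ε (E(x) - E(y)) / (x - y) ⪰ 0` on `(0,∞)`, with a finite sum. -/
def DividedDifferenceFinitePos (ε : ℝ) (E : ℝ → Matrix ι ι ℝ) : Prop :=
  ∃ L, IsDividedDifference ε E L ∧ FinitePosKernel L

/-- Real symmetric matrices, continuous and bounded on `(0,∞)`. -/
structure IsCoefficient (E : ℝ → Matrix ι ι ℝ) : Prop where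
  continuousOn : ContinuousOn E (Ioi 0)
  isSymm : ∀ x > 0, (E x).IsSymm
  bounded : ∃ C : ℝ, ∀ x > 0, ‖E x‖ ≤ C

end Matrices

/-! ### Hamiltonian systems -/

section Hamiltonian

variable {m : ℕ}

/-- `λ E(x) + F(x)` as a complex matrix. -/
def potential (E F : ℝ → Matrix (Fin m ⊕ Fin m) (Fin m ⊕ Fin m) ℝ) (lam : ℂ) (x : ℝ) :
    Matrix (Fin m ⊕ Fin m) (Fin m ⊕ Fin m) ℂ :=
  lam • (E x).map Complex.ofReal + (F x).map Complex.ofReal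

/-- `Ψ` is a bounded solution in `L²((0,∞); ℂ^{2m})` of the symmetric Hamiltonian system
`J Ψ' = (λ E + F) Ψ` on `(0,∞)`. Here `Matrix.J` is `J = [0, -I; I, 0]`. -/
structure IsBoundedL2Solution (E F : ℝ → Matrix (Fin m ⊕ Fin m) (Fin m ⊕ Fin m) ℝ) (lam : ℂ)
    (Ψ : ℝ → Fin m ⊕ Fin m → ℂ) : Prop where
  differentiableAt : ∀ x > 0, DifferentiableAt ℝ Ψ x
  equation : ∀ x > 0, Matrix.J (Fin m) ℂ *ᵥ deriv Ψ x = potential E F lam x *ᵥ Ψ x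
  bounded : ∃ C : ℝ, ∀ x > 0, ‖Ψ x‖ ≤ C
  memLp : MemLp Ψ 2 halfLine

/-- `Ψ` takes values in `ℝ^{2m}` on `(0,∞)`. -/
def IsRealValued (Ψ : ℝ → Fin m ⊕ Fin m → ℂ) : Prop := ∀ x > 0, ∀ i, (Ψ x i).im = 0

/-- `⟨Ψ(x), (λ E(x) + F(x)) Ψ(x)⟩`, with the bilinear form `⟨z, w⟩ = ∑ z_j w_j`. -/
def diagonal (E F : ℝ → Matrix (Fin m ⊕ Fin m) (Fin m ⊕ Fin m) ℝ) (lam : ℂ)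
    (Ψ : ℝ → Fin m ⊕ Fin m → ℂ) (x : ℝ) : ℂ :=
  Ψ x ⬝ᵥ (potential E F lam x *ᵥ Ψ x)

open Classical in
/-- `K_λ(x,y) = ⟨J Ψ(x), Ψ(y)⟩ / (x - y)`, with the bilinear form `⟨z, w⟩ = ∑ z_j w_j`, and
`K_λ(x,x) = ⟨Ψ(x), (λ E(x) + F(x)) Ψ(x)⟩`. -/
def kernel (E F : ℝ → Matrix (Fin m ⊕ Fin m) (Fin m ⊕ Fin m) ℝ) (lam : ℂ)
    (Ψ : ℝ → Fin m ⊕ Fin m → ℂ) (x y : ℝ) : ℂ :=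
  if x = y then diagonal E F lam Ψ x
  else ((Matrix.J (Fin m) ℂ *ᵥ Ψ x) ⬝ᵥ Ψ y) / ((x : ℂ) - y)

/-- `λ ↦ Ψ_λ` is analytic on the open set `D` as a map into `L²((0,∞); ℂ^{2m})`. -/
def IsAnalyticFamily (D : Set ℂ) (Ψ : ℂ → ℝ → Fin m ⊕ Fin m → ℂ) : Prop :=
  ∃ G : ℂ → Lp (Fin m ⊕ Fin m → ℂ) 2 halfLine,
    DifferentiableOn ℂ G D ∧ ∀ lam ∈ D, G lam =ᵐ[halfLine] Ψ lam

end Hamiltonian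

end HamKernel

end

noncomputable section

namespace HamKernel

/-! ### Integral operators between `L²` spaces -/

section IntegralOperators

set_option linter.unusedSectionVars false

open scoped ENNReal

variable {X Y : Type*} [MeasurableSpace X] [MeasurableSpace Y] {μ : Measure X} {ν : Measure Y}

/-! Write P = λE + F. Along the diagonal direction x - y is constant, and JΨ' = PΨ with J skew and P
symmetric gives ∂ₜ K(x+t, y+t) = ⟨Ψ(y+t), (P(x+t) - P(y+t))/(x - y) Ψ(x+t)⟩
(`hasDerivAt_wronskian`). For real Ψ and λ > 0 the hypotheses turn this into ε ℓ(x+t, y+t) with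
ℓ(x,y) = ∑ aᵢ(x) conj aᵢ(y), where the aᵢ are components of the G_j Ψ, suitably scaled
(`hasSum_potentialFactor`). Bounded coefficients give ‖Ψ'‖ ≤ C‖Ψ‖, so a square integrable Ψ tends to
0 (`IsTame.norm_sq_le`), and K(x+t, y+t) tends to 0 with it. Integrating in t over (0,∞) yields -ε
K(x,y) = ∫ ∑ aᵢ(x+s) conj aᵢ(y+s) ds, that is -ε K = Γ†Γ, where Γ has the kernel conj aᵢ(x+s) in the
variables (s,i) and x (`integral_factorKernel`, `exists_factor`).

Replacing x by x+t gives Γ_t with -ε K_t = Γ_t†Γ_t. The squared Hilbert-Schmidt norm of Γ_t is ∫_t^∞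
|K(x,x)| dx, which is finite because |K(x,x)| ≤ c‖Ψ(x)‖². This gives positivity, the trace formula
and the decay of ‖K_t‖ to 0. The kernel of Γ depends on x and s only through x+s, so Γ_t f is the
part of Γ f over s > t; hence the monotonicity in t. If only finitely many aᵢ are nonzero, ε ℓ(x+t,
y+t) is the kernel of an operator of finite rank.

The Hilbert-Schmidt property and the analyticity in λ do not use positivity. Since ⟨JΨ(x), Ψ(x)⟩ =
0, the kernel is bounded near the diagonal by a multiple of ‖Ψ(x)‖, so the strip |x - y| ≤ δ
contributes O(√δ) to the Hilbert-Schmidt norm. What remains is a bounded function times a finite sum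
of tensor products and is bilinear in Ψ. Thus K_λ is a locally uniform limit of analytic operator
functions (`differentiableOn_of_hasKernel`), and the adjoint relation spreads from the positive
reals by the identity theorem. The Lyapunov equation holds for S_t† K S_t with any bounded K. -/

lemma eLpNorm_two_sq {E : Type*} [NormedAddCommGroup E] (f : X → E) :
    eLpNorm f 2 μ ^ 2 = ∫⁻ x, ‖f x‖ₑ ^ 2 ∂μ := by
  have h := eLpNorm_nnreal_pow_eq_lintegral (f := f) (μ := μ) (p := 2) (by norm_num)
  simpa using h

lemma enorm_sq_eq_lintegral (f : Lp ℂ 2 μ) : ‖f‖ₑ ^ 2 = ∫⁻ x, ‖f x‖ₑ ^ 2 ∂μ := by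
  rw [← eLpNorm_two_sq, Lp.enorm_def]

lemma memLp_two_of_lintegral_lt_top {E : Type*} [NormedAddCommGroup E] {f : X → E}
    (hf : AEStronglyMeasurable f μ) (h : ∫⁻ x, ‖f x‖ₑ ^ 2 ∂μ < ∞) : MemLp f 2 μ := by
  refine ⟨hf, ?_⟩
  rw [← eLpNorm_two_sq] at h
  by_contra h1
  rw [not_lt, top_le_iff] at h1
  simp [h1] at h

lemma enorm_integral_mul_sq_le {f g : X → ℂ} (hf : AEStronglyMeasurable f μ)
    (hg : AEStronglyMeasurable g μ) :
    ‖∫ x, f x * g x ∂μ‖ₑ ^ 2 ≤ (∫⁻ x, ‖f x‖ₑ ^ 2 ∂μ) * ∫⁻ x, ‖g x‖ₑ ^ 2 ∂μ := by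
  rw [← eLpNorm_two_sq, ← eLpNorm_two_sq, ← mul_pow]
  gcongr
  refine (enorm_integral_le_lintegral_enorm _).trans ?_
  rw [← eLpNorm_one_eq_lintegral_enorm]
  have h : eLpNorm (f • g) 1 μ ≤ eLpNorm f 2 μ * eLpNorm g 2 μ :=
    eLpNorm_smul_le_mul_eLpNorm hg hf
  exact h

/-- `T f (y) = ∫ k(y,x) f(x) dμ(x)`. -/
def IsIntegralOperator (T : Lp ℂ 2 μ →L[ℂ] Lp ℂ 2 ν) (k : Y → X → ℂ) : Prop :=
  ∀ f : Lp ℂ 2 μ, ∀ᵐ y ∂ν, Integrable (fun x => k y x * f x) μ ∧ T f y = ∫ x, k y x * f x ∂μ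

/-- Operator identities below (bilinearity, self-adjointness, the factorization Γ†Γ) are read off
from kernels through this lemma; null sets of kernels are immaterial. -/
lemma IsIntegralOperator.ext {T T' : Lp ℂ 2 μ →L[ℂ] Lp ℂ 2 ν} {k k' : Y → X → ℂ}
    (h : IsIntegralOperator T k) (h' : IsIntegralOperator T' k')
    (hk : ∀ᵐ y ∂ν, ∀ᵐ x ∂μ, k y x = k' y x) : T = T' := by
  ext1 f
  refine Lp.ext ?_
  filter_upwards [h f, h' f, hk] with y h1 h2 h3
  rw [h1.2, h2.2]
  refine integral_congr_ae ?_
  filter_upwards [h3] with x hx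
  rw [hx]

lemma IsIntegralOperator.congr {T : Lp ℂ 2 μ →L[ℂ] Lp ℂ 2 ν} {k k' : Y → X → ℂ}
    (h : IsIntegralOperator T k)
    (hk : ∀ᵐ y ∂ν, ∀ᵐ x ∂μ, k y x = k' y x) : IsIntegralOperator T k' := by
  intro f
  filter_upwards [h f, hk] with y h1 h3
  have h4 : (fun x => k y x * f x) =ᵐ[μ] fun x => k' y x * f x := by
    filter_upwards [h3] with x hx
    rw [hx]
  exact ⟨h1.1.congr h4, h1.2.trans (integral_congr_ae h4)⟩

lemma IsIntegralOperator.add {T T' : Lp ℂ 2 μ →L[ℂ] Lp ℂ 2 ν} {k k' : Y → X → ℂ}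
    (h : IsIntegralOperator T k) (h' : IsIntegralOperator T' k') :
    IsIntegralOperator (T + T') (fun y x => k y x + k' y x) := by
  intro f
  filter_upwards [h f, h' f, Lp.coeFn_add (T f) (T' f)] with y h1 h2 h3
  simp only [add_mul]
  refine ⟨h1.1.add h2.1, ?_⟩
  rw [integral_add h1.1 h2.1, _root_.add_apply, h3, Pi.add_apply, h1.2, h2.2]

lemma IsIntegralOperator.const_smul {T : Lp ℂ 2 μ →L[ℂ] Lp ℂ 2 ν} {k : Y → X → ℂ}
    (h : IsIntegralOperator T k) (c : ℂ) :
    IsIntegralOperator (c • T) (fun y x => c * k y x) := by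
  intro f
  filter_upwards [h f, Lp.coeFn_smul c (T f)] with y h1 h3
  simp only [mul_assoc]
  refine ⟨h1.1.const_mul c, ?_⟩
  rw [integral_const_mul, _root_.smul_apply, h3, Pi.smul_apply, h1.2, smul_eq_mul]

variable [SFinite μ]

lemma lintegral_prod_enorm_sq {k : Y → X → ℂ}
    (hk : AEStronglyMeasurable (Function.uncurry k) (ν.prod μ)) :
    ∫⁻ z, ‖Function.uncurry k z‖ₑ ^ 2 ∂(ν.prod μ) = ∫⁻ y, ∫⁻ x, ‖k y x‖ₑ ^ 2 ∂μ ∂ν := by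
  rw [lintegral_prod]
  · rfl
  · exact hk.enorm.pow_const 2

lemma ae_memLp_section {k : Y → X → ℂ} (hk : MemLp (Function.uncurry k) 2 (ν.prod μ)) :
    ∀ᵐ y ∂ν, MemLp (k y) 2 μ := by
  have h1 : ∫⁻ y, ∫⁻ x, ‖k y x‖ₑ ^ 2 ∂μ ∂ν < ∞ := by
    rw [← lintegral_prod_enorm_sq hk.1, ← eLpNorm_two_sq]
    exact ENNReal.pow_lt_top hk.2
  have h2 := ae_lt_top' (hk.1.enorm.pow_const 2).lintegral_prod_right' h1.ne
  filter_upwards [hk.1.prodMk_left, h2] with y hy1 hy2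
  exact memLp_two_of_lintegral_lt_top hy1 hy2

lemma memLp_prod_mul {f : X → ℂ} {g : Y → ℂ} (hg : MemLp g 2 ν) (hf : MemLp f 2 μ) :
    MemLp (fun z : Y × X => g z.1 * f z.2) 2 (ν.prod μ) := by
  refine memLp_two_of_lintegral_lt_top (hg.1.comp_fst.mul hf.1.comp_snd) ?_
  simp only [enorm_mul, mul_pow]
  rw [lintegral_prod_mul (hg.1.enorm.pow_const 2) (hf.1.enorm.pow_const 2), ← eLpNorm_two_sq,
    ← eLpNorm_two_sq]
  exact ENNReal.mul_lt_top (ENNReal.pow_lt_top hg.2) (ENNReal.pow_lt_top hf.2)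

variable [SFinite ν]

/-- Cauchy-Schwarz in x for almost every y, then integration in y: the Hilbert-Schmidt norm
dominates the operator norm. -/
lemma lintegral_enorm_integral_sq_le {k : Y → X → ℂ}
    (hk : MemLp (Function.uncurry k) 2 (ν.prod μ)) (f : Lp ℂ 2 μ) :
    ∫⁻ y, ‖∫ x, k y x * f x ∂μ‖ₑ ^ 2 ∂ν ≤
      eLpNorm (Function.uncurry k) 2 (ν.prod μ) ^ 2 * ‖f‖ₑ ^ 2 := by
  rw [eLpNorm_two_sq, lintegral_prod_enorm_sq hk.1, enorm_sq_eq_lintegral,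
    ← lintegral_mul_const'']
  · refine lintegral_mono_ae ?_
    filter_upwards [ae_memLp_section hk] with y hy
    exact enorm_integral_mul_sq_le hy.1 (Lp.aestronglyMeasurable f)
  · exact (hk.1.enorm.pow_const 2).lintegral_prod_right'

lemma memLp_integral_mul {k : Y → X → ℂ}
    (hk : MemLp (Function.uncurry k) 2 (ν.prod μ)) (f : Lp ℂ 2 μ) :
    MemLp (fun y => ∫ x, k y x * f x ∂μ) 2 ν := by
  refine memLp_two_of_lintegral_lt_top ?_ ((lintegral_enorm_integral_sq_le hk f).trans_lt ?_)
  · have h := hk.1.mul ((Lp.aestronglyMeasurable f).comp_snd (μ := ν))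
    exact h.integral_prod_right'
  · exact ENNReal.mul_lt_top (ENNReal.pow_lt_top hk.2) (ENNReal.pow_lt_top enorm_lt_top)

/-- The exceptional set of y must not depend on f; it does not, because integrability comes from
square integrability of the section alone. -/
lemma ae_integrable_section_mul {k : Y → X → ℂ}
    (hk : MemLp (Function.uncurry k) 2 (ν.prod μ)) :
    ∀ᵐ y ∂ν, ∀ f : Lp ℂ 2 μ, Integrable (fun x => k y x * f x) μ := by
  filter_upwards [ae_memLp_section hk] with y hy f
  exact hy.integrable_mul (Lp.memLp f)

lemma exists_isIntegralOperator {k : Y → X → ℂ}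
    (hk : MemLp (Function.uncurry k) 2 (ν.prod μ)) :
    ∃ T : Lp ℂ 2 μ →L[ℂ] Lp ℂ 2 ν, IsIntegralOperator T k := by
  let L : Lp ℂ 2 μ →ₗ[ℂ] Lp ℂ 2 ν :=
    { toFun := fun f => (memLp_integral_mul hk f).toLp _
      map_add' := by
        intro f g
        rw [← MemLp.toLp_add]
        apply MemLp.toLp_congr
        filter_upwards [ae_integrable_section_mul hk] with y hy
        rw [Pi.add_apply, ← integral_add (hy f) (hy g)]
        refine integral_congr_ae ?_
        filter_upwards [Lp.coeFn_add f g] with x hx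
        rw [hx, Pi.add_apply, mul_add]
      map_smul' := by
        intro c f
        rw [RingHom.id_apply, ← MemLp.toLp_const_smul]
        apply MemLp.toLp_congr
        filter_upwards [] with y
        rw [Pi.smul_apply, ← integral_smul]
        refine integral_congr_ae ?_
        filter_upwards [Lp.coeFn_smul c f] with x hx
        rw [hx, Pi.smul_apply, smul_eq_mul, smul_eq_mul]
        ring }
  refine ⟨L.mkContinuous (eLpNorm (Function.uncurry k) 2 (ν.prod μ)).toReal ?_, ?_⟩
  · intro f
    simp only [L, LinearMap.coe_mk, AddHom.coe_mk, Lp.norm_toLp]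
    have h := lintegral_enorm_integral_sq_le hk f
    rw [← eLpNorm_two_sq, ← mul_pow] at h
    have h2 := (ENNReal.pow_le_pow_left_iff (by norm_num)).1 h
    have h3 := ENNReal.toReal_mono (ENNReal.mul_lt_top hk.2 enorm_lt_top).ne h2
    rwa [ENNReal.toReal_mul, toReal_enorm] at h3
  · intro f
    filter_upwards [ae_integrable_section_mul hk, (memLp_integral_mul hk f).coeFn_toLp]
      with y hy h2
    exact ⟨hy f, h2⟩

lemma IsIntegralOperator.norm_le {T : Lp ℂ 2 μ →L[ℂ] Lp ℂ 2 ν} {k : Y → X → ℂ}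
    (h : IsIntegralOperator T k) (hk : MemLp (Function.uncurry k) 2 (ν.prod μ)) {B : ℝ}
    (hB : 0 ≤ B) (hkB : ∫⁻ z, ‖Function.uncurry k z‖ₑ ^ 2 ∂(ν.prod μ) ≤ ENNReal.ofReal (B ^ 2)) :
    ‖T‖ ≤ B := by
  refine T.opNorm_le_bound hB fun f => ?_
  have h1 : ‖T f‖ₑ ^ 2 ≤ ENNReal.ofReal (B ^ 2) * ‖f‖ₑ ^ 2 := by
    rw [enorm_sq_eq_lintegral]
    calc ∫⁻ y, ‖T f y‖ₑ ^ 2 ∂ν = ∫⁻ y, ‖∫ x, k y x * f x ∂μ‖ₑ ^ 2 ∂ν := by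
          refine lintegral_congr_ae ?_
          filter_upwards [h f] with y hy
          rw [hy.2]
      _ ≤ _ := lintegral_enorm_integral_sq_le hk f
      _ ≤ _ := by
          rw [eLpNorm_two_sq]
          gcongr
  rw [ENNReal.ofReal_pow hB, ← mul_pow] at h1
  have h2 := (ENNReal.pow_le_pow_left_iff (by norm_num)).1 h1
  have h3 := ENNReal.toReal_mono (by finiteness) h2
  rwa [ENNReal.toReal_mul, toReal_enorm, toReal_enorm, ENNReal.toReal_ofReal hB] at h3

/-- Parseval's identity with values in `ENNReal`, so that the sum can be exchanged with an integral
without any summability proof. -/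
lemma tsum_enorm_inner_sq {H ι : Type*} [NormedAddCommGroup H] [InnerProductSpace ℂ H]
    (b : HilbertBasis ι ℂ H) (x : H) : ∑' i, ‖inner ℂ x (b i)‖ₑ ^ 2 = ‖x‖ₑ ^ 2 := by
  have h := b.hasSum_inner_mul_inner x x
  have h1 : HasSum (fun i => ‖inner ℂ x (b i)‖ ^ 2) (‖x‖ ^ 2) := by
    have h2 := Complex.hasSum_re h
    rw [show (inner ℂ x x).re = ‖x‖ ^ 2 from inner_self_eq_norm_sq (𝕜 := ℂ) x] at h2
    refine h2.congr_fun fun i => ?_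
    rw [← inner_conj_symm (b i) x, RCLike.mul_conj]
    norm_cast
  have h4 := ENNReal.ofReal_tsum_of_nonneg (fun i => by positivity) h1.summable
  rw [h1.tsum_eq] at h4
  simpa [ENNReal.ofReal_pow] using h4.symm

/-- The Hilbert-Schmidt norm of an integral operator. -/
lemma IsIntegralOperator.tsum_enorm_sq {T : Lp ℂ 2 μ →L[ℂ] Lp ℂ 2 ν} {k : Y → X → ℂ}
    (h : IsIntegralOperator T k) (hk : MemLp (Function.uncurry k) 2 (ν.prod μ))
    {ι : Type*} [Countable ι] (b : HilbertBasis ι ℂ (Lp ℂ 2 μ)) :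
    ∑' i, ‖T (b i)‖ₑ ^ 2 = ∫⁻ z, ‖Function.uncurry k z‖ₑ ^ 2 ∂(ν.prod μ) := by
  simp only [enorm_sq_eq_lintegral]
  rw [lintegral_prod_enorm_sq hk.1, ← lintegral_tsum]
  · refine lintegral_congr_ae ?_
    filter_upwards [ae_all_iff.2 fun i => h (b i), ae_memLp_section hk] with y hy hky
    -- At fixed y, T eᵢ(y) is the inner product of the conjugated section with eᵢ, so Parseval sums
    -- the squares to ∫ |k(y,x)|² dx.
    have h1 : MemLp (fun x => conj (k y x)) 2 μ := hky.star
    have h2 : ∀ i, T (b i) y = inner ℂ (h1.toLp _) (b i) := by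
      intro i
      rw [(hy i).2, L2.inner_def]
      refine integral_congr_ae ?_
      filter_upwards [h1.coeFn_toLp] with x hx
      rw [hx, RCLike.inner_apply, Complex.conj_conj, mul_comm]
    simp only [h2]
    rw [tsum_enorm_inner_sq, enorm_sq_eq_lintegral]
    refine lintegral_congr_ae ?_
    filter_upwards [h1.coeFn_toLp] with x hx
    rw [hx, RCLike.enorm_conj]
  · intro i
    exact (Lp.aestronglyMeasurable _).enorm.pow_const 2

lemma integrable_kernel_mul_mul {k : Y → X → ℂ}
    (hk : MemLp (Function.uncurry k) 2 (ν.prod μ)) {f : X → ℂ} {g : Y → ℂ} (hf : MemLp f 2 μ)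
    (hg : MemLp g 2 ν) :
    Integrable (fun z : Y × X => k z.1 z.2 * (g z.1 * f z.2)) (ν.prod μ) :=
  hk.integrable_mul (memLp_prod_mul hg hf)

lemma memLp_conj_swap {k : Y → X → ℂ} (hk : MemLp (Function.uncurry k) 2 (ν.prod μ)) :
    MemLp (Function.uncurry fun x y => conj (k y x)) 2 (μ.prod ν) :=
  (hk.comp_measurePreserving Measure.measurePreserving_swap).star

/-- Fubini applies because both the kernel and the tensor product of f and conj g are square
integrable on the product space. -/
lemma IsIntegralOperator.adjoint {T : Lp ℂ 2 μ →L[ℂ] Lp ℂ 2 ν} {k : Y → X → ℂ}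
    (h : IsIntegralOperator T k) (hk : MemLp (Function.uncurry k) 2 (ν.prod μ)) :
    IsIntegralOperator (ContinuousLinearMap.adjoint T) (fun x y => conj (k y x)) := by
  obtain ⟨T', hT'⟩ := exists_isIntegralOperator (memLp_conj_swap hk)
  convert hT'
  symm
  rw [ContinuousLinearMap.eq_adjoint_iff]
  intro g f
  rw [L2.inner_def, L2.inner_def]
  have hi := integrable_kernel_mul_mul hk (Lp.memLp f) (Lp.memLp g).star
  calc ∫ x, inner ℂ (T' g x) (f x) ∂μ = ∫ x, ∫ y, k y x * (conj (g y) * f x) ∂ν ∂μ := by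
        refine integral_congr_ae ?_
        filter_upwards [hT' g] with x hx
        rw [hx.2, RCLike.inner_apply, ← integral_conj, ← integral_const_mul]
        refine integral_congr_ae (Eventually.of_forall fun y => ?_)
        simp only [map_mul, Complex.conj_conj]
        ring
    _ = ∫ y, ∫ x, k y x * (conj (g y) * f x) ∂μ ∂ν :=
        (integral_integral_swap (f := fun y x => k y x * (conj (g y) * f x)) hi).symm
    _ = ∫ y, inner ℂ (g y) (T f y) ∂ν := by
        refine integral_congr_ae ?_
        filter_upwards [h f] with y hy
        rw [hy.2, RCLike.inner_apply, ← integral_mul_const]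
        refine integral_congr_ae (Eventually.of_forall fun x => ?_)
        simp only
        ring

/-- The kernel of `Γ†Γ`. -/
lemma IsIntegralOperator.adjoint_comp_self {Γ : Lp ℂ 2 μ →L[ℂ] Lp ℂ 2 ν} {c : Y → X → ℂ}
    (h : IsIntegralOperator Γ c) (hc : MemLp (Function.uncurry c) 2 (ν.prod μ)) :
    IsIntegralOperator ((ContinuousLinearMap.adjoint Γ).comp Γ)
      (fun x y => ∫ σ, conj (c σ x) * c σ y ∂ν) := by
  intro f
  filter_upwards [h.adjoint hc (Γ f), ae_memLp_section (memLp_conj_swap hc)] with x hx hcx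
  -- For almost every x the column σ ↦ c(σ,x) is square integrable, which makes the double integrand
  -- in (σ,y) absolutely integrable.
  have hi := integrable_kernel_mul_mul hc (Lp.memLp f) hcx
  have hi' : Integrable (Function.uncurry fun σ y => conj (c σ x) * c σ y * f y) (ν.prod μ) := by
    refine hi.congr (Eventually.of_forall fun z => ?_)
    simp only [Function.uncurry]
    ring
  have e : ∀ y, ∫ σ, conj (c σ x) * c σ y * f y ∂ν = (∫ σ, conj (c σ x) * c σ y ∂ν) * f y :=
    fun y => integral_mul_const _ _
  refine ⟨?_, ?_⟩
  · refine hi'.swap.integral_prod_left.congr (Eventually.of_forall fun y => ?_)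
    exact e y
  · rw [ContinuousLinearMap.comp_apply, hx.2]
    calc ∫ σ, conj (c σ x) * Γ f σ ∂ν = ∫ σ, ∫ y, conj (c σ x) * c σ y * f y ∂μ ∂ν := by
          refine integral_congr_ae ?_
          filter_upwards [h f] with σ hσ
          rw [hσ.2, ← integral_const_mul]
          simp only [mul_assoc]
      _ = ∫ y, ∫ σ, conj (c σ x) * c σ y * f y ∂ν ∂μ := integral_integral_swap hi'
      _ = _ := by simp only [e]

end IntegralOperators

end HamKernel

namespace HamKernel

/-! ### The shift -/

lemma coeFn_shift (t : ℝ) (f : L2) : shift t f =ᵐ[halfLine] shiftFun t f :=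
  MemLp.coeFn_toLp (memLp_shiftFun t (Lp.memLp f))

lemma norm_shift_le (t : ℝ) : ‖shift t‖ ≤ 1 :=
  LinearMap.mkContinuous_norm_le _ zero_le_one _

lemma integral_halfLine_shiftFun (t : ℝ) (f g : ℝ → ℂ) :
    ∫ x, conj (shiftFun t f x) * g x ∂halfLine =
      ∫ x, conj (f x) * shiftFun (-t) g x ∂halfLine := by
  have h1 : ∫ x, conj (shiftFun t f x) * g x ∂halfLine =
      ∫ x, conj ((Ioi (0 : ℝ)).indicator f (x - t)) * (Ioi (0 : ℝ)).indicator g x := by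
    rw [← integral_indicator measurableSet_Ioi]
    congr 1 with x
    by_cases hx : x ∈ Ioi (0 : ℝ) <;> simp [hx, shiftFun]
  have h2 : ∫ x, conj (f x) * shiftFun (-t) g x ∂halfLine =
      ∫ x, conj ((Ioi (0 : ℝ)).indicator f x) * (Ioi (0 : ℝ)).indicator g (x + t) := by
    rw [← integral_indicator measurableSet_Ioi]
    congr 1 with x
    by_cases hx : x ∈ Ioi (0 : ℝ)
    · simp only [indicator_of_mem hx, shiftFun, sub_neg_eq_add]
    · simp only [indicator_of_notMem hx, map_zero, zero_mul]
  rw [h1, h2, ← integral_add_right_eq_self _ t]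
  simp

/-- For negative parameter `shift` is translation to the left, so the adjoint semigroup is again
given by `shift` and needs no separate construction. The proof is translation invariance of Lebesgue
measure after extension by 0. -/
lemma adjoint_shift (t : ℝ) : ContinuousLinearMap.adjoint (shift t) = shift (-t) := by
  symm
  rw [ContinuousLinearMap.eq_adjoint_iff]
  intro g f
  rw [← inner_conj_symm, ← inner_conj_symm g]
  congr 1
  rw [L2.inner_def, L2.inner_def]
  simp only [RCLike.inner_apply']
  calc ∫ x, conj (f x) * shift (-t) g x ∂halfLine
      = ∫ x, conj (f x) * shiftFun (-t) g x ∂halfLine := by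
        refine integral_congr_ae ?_
        filter_upwards [coeFn_shift (-t) g] with x hx
        rw [hx]
    _ = ∫ x, conj (shiftFun t f x) * g x ∂halfLine := (integral_halfLine_shiftFun t f g).symm
    _ = ∫ x, conj (shift t f x) * g x ∂halfLine := by
        refine integral_congr_ae ?_
        filter_upwards [coeFn_shift t f] with x hx
        rw [hx]

lemma shift_zero : shift 0 = 1 := by
  ext1 f
  refine Lp.ext ?_
  filter_upwards [coeFn_shift 0 f, ae_restrict_mem measurableSet_Ioi] with x hx hx0
  rw [hx, shiftFun, sub_zero, indicator_of_mem hx0]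
  rfl

lemma quasiMeasurePreserving_add {t : ℝ} (ht : 0 ≤ t) :
    Measure.QuasiMeasurePreserving (fun x : ℝ => x + t) halfLine halfLine := by
  refine ⟨measurable_add_const t, ?_⟩
  refine Measure.AbsolutelyContinuous.mk fun s hs h => ?_
  rw [Measure.map_apply (measurable_add_const t) hs,
    Measure.restrict_apply ((measurable_add_const t) hs)]
  rw [Measure.restrict_apply hs] at h
  refine measure_mono_null (t := (fun x => x + t) ⁻¹' (s ∩ Ioi 0)) ?_ ?_
  · rintro x ⟨hx1, hx2⟩
    exact ⟨hx1, by simp only [mem_Ioi] at hx2 ⊢; linarith⟩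
  · rw [measure_preimage_add_right, h]

lemma coeFn_shift_neg {t : ℝ} (ht : 0 ≤ t) (f : L2) :
    shift (-t) f =ᵐ[halfLine] fun x => f (x + t) := by
  filter_upwards [coeFn_shift (-t) f, ae_restrict_mem measurableSet_Ioi] with x hx hx0
  rw [hx, shiftFun, sub_neg_eq_add, indicator_of_mem]
  simp only [mem_Ioi] at hx0 ⊢
  linarith

lemma shift_neg_add {s t : ℝ} (hs : 0 ≤ s) (ht : 0 ≤ t) :
    shift (-(s + t)) = (shift (-s)).comp (shift (-t)) := by
  ext1 f
  refine Lp.ext ?_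
  rw [ContinuousLinearMap.comp_apply]
  filter_upwards [coeFn_shift_neg (add_nonneg hs ht) f, coeFn_shift_neg hs (shift (-t) f),
    (quasiMeasurePreserving_add hs).ae (coeFn_shift_neg ht f)] with x h1 h2 h3
  rw [h1, h2, h3, add_assoc]

/-- Translations act continuously on L²(ℝ), and restricting to the half line does not increase the
norm. -/
lemma continuous_shift (f : L2) : Continuous fun t => shift t f := by
  let F : Lp ℂ 2 (volume : Measure ℝ) := (memLp_indicator (Lp.memLp f)).toLp _
  have h2 : Fact ((2 : ENNReal) ≠ ⊤) := ⟨by norm_num⟩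
  have hF : Continuous fun t : ℝ => DomAddAct.mk (-t) +ᵥ F := by
    have h3 : Continuous fun t : ℝ => DomAddAct.mk (-t) :=
      DomAddAct.continuous_mk.comp continuous_neg
    exact h3.vadd continuous_const
  rw [Metric.continuous_iff'] at hF ⊢
  intro t δ hδ
  filter_upwards [hF t δ hδ] with s hs
  refine lt_of_le_of_lt ?_ hs
  rw [dist_eq_norm, dist_eq_norm, Lp.norm_def, Lp.norm_def]
  refine ENNReal.toReal_mono (Lp.memLp _).2.ne ?_
  have key : ∀ r : ℝ, shift r f =ᵐ[halfLine] (DomAddAct.mk (-r) +ᵥ F : Lp ℂ 2 volume) := by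
    intro r
    refine (coeFn_shift r f).trans (ae_restrict_of_ae ?_)
    have e1 := DomAddAct.vadd_Lp_ae_eq (DomAddAct.mk (-r)) F
    have e2 := (measurePreserving_sub_right volume r).quasiMeasurePreserving.ae
      (memLp_indicator (Lp.memLp f)).coeFn_toLp
    filter_upwards [e1, e2] with x hx1 hx2
    rw [hx1, shiftFun, ← hx2]
    congr 1
    simp [vadd_eq_add]
    ring
  calc eLpNorm (shift s f - shift t f : L2) 2 halfLine
      = eLpNorm ((DomAddAct.mk (-s) +ᵥ F : Lp ℂ 2 volume) -
          (DomAddAct.mk (-t) +ᵥ F) : Lp ℂ 2 (volume : Measure ℝ)) 2 halfLine := by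
        refine eLpNorm_congr_ae ?_
        filter_upwards [Lp.coeFn_sub (shift s f) (shift t f), key s, key t, ae_restrict_of_ae
          (Lp.coeFn_sub (DomAddAct.mk (-s) +ᵥ F : Lp ℂ 2 volume) (DomAddAct.mk (-t) +ᵥ F))]
          with x h1 h2 h3 h4
        rw [h1, h4, Pi.sub_apply, Pi.sub_apply, h2, h3]
    _ ≤ _ := eLpNorm_mono_measure _ Measure.restrict_le_self

lemma isBoundedC0Semigroup_adjoint_shift :
    IsBoundedC0Semigroup fun s => ContinuousLinearMap.adjoint (shift s) where
  zero := by rw [adjoint_shift, neg_zero, shift_zero]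
  add s hs t ht := by
    simp only [adjoint_shift]
    exact shift_neg_add hs ht
  tendsto f := by
    simp only [adjoint_shift]
    have h := ((continuous_shift f).comp continuous_neg).tendsto 0
    simp only [Function.comp_apply, neg_zero, shift_zero] at h
    exact h.mono_left nhdsWithin_le_nhds
  bounded := ⟨1, fun t _ => by rw [adjoint_shift]; exact norm_shift_le _⟩

/-! ### Compression of an integral operator by the shift. -/

lemma integrable_mul_shiftFun_iff {t : ℝ} (ht : 0 ≤ t) (k f : ℝ → ℂ) :
    Integrable (fun y => k y * shiftFun t f y) halfLine ↔
      Integrable (fun y => k (y + t) * f y) halfLine := by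
  rw [← IntegrableOn, ← IntegrableOn, ← integrable_indicator_iff measurableSet_Ioi,
    ← integrable_indicator_iff measurableSet_Ioi,
    ← (measurePreserving_add_right volume t).integrable_comp_emb
      (MeasurableEquiv.addRight t).measurableEmbedding]
  refine iff_of_eq (congrArg (fun F => Integrable F volume) ?_)
  ext y
  by_cases hy : y ∈ Ioi (0 : ℝ)
  · have hy' : y + t ∈ Ioi (0 : ℝ) := by simp only [mem_Ioi] at hy ⊢; linarith
    simp only [Function.comp_apply, indicator_of_mem hy', indicator_of_mem hy, shiftFun,
      add_sub_cancel_right]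
  · rw [indicator_of_notMem hy, Function.comp_apply, indicator_apply_eq_zero]
    intro _
    rw [shiftFun, add_sub_cancel_right, indicator_of_notMem hy, mul_zero]

lemma integral_mul_shiftFun {t : ℝ} (ht : 0 ≤ t) (k f : ℝ → ℂ) :
    ∫ y, k y * shiftFun t f y ∂halfLine = ∫ y, k (y + t) * f y ∂halfLine := by
  rw [← integral_indicator measurableSet_Ioi, ← integral_indicator measurableSet_Ioi,
    ← integral_add_right_eq_self _ t]
  congr 1 with y
  by_cases hy : y ∈ Ioi (0 : ℝ)
  · have hy' : y + t ∈ Ioi (0 : ℝ) := by simp only [mem_Ioi] at hy ⊢; linarith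
    simp only [indicator_of_mem hy', indicator_of_mem hy, shiftFun, add_sub_cancel_right]
  · simp [indicator, shiftFun, hy]

lemma HasKernel.shifted {K : L2 →L[ℂ] L2} {k : ℝ → ℝ → ℂ} (h : HasKernel K k) {t : ℝ}
    (ht : 0 ≤ t) : HasKernel (shifted K t) fun x y => k (x + t) (y + t) := by
  intro f
  simp only [HamKernel.shifted, adjoint_shift, ContinuousLinearMap.comp_apply]
  filter_upwards [coeFn_shift_neg ht (K (shift t f)),
    (quasiMeasurePreserving_add ht).ae (h (shift t f))] with x h1 h2
  have e : (fun y => k (x + t) y * shift t f y) =ᵐ[halfLine]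
      fun y => k (x + t) y * shiftFun t f y := by
    filter_upwards [coeFn_shift t f] with y hy
    rw [hy]
  refine ⟨(integrable_mul_shiftFun_iff ht _ _).1 (h2.1.congr e), ?_⟩
  rw [h1, h2.2, integral_congr_ae e, integral_mul_shiftFun ht]

/-! ### The generator of the adjoint shift and the Lyapunov equation -/

lemma generator_spec (T : ℝ → L2 →L[ℂ] L2) (u : (generator T).domain) :
    Tendsto (fun t : ℝ => ((t : ℂ)⁻¹) • (T t u - u)) (𝓝[>] 0) (𝓝 (generator T u)) :=
  u.2.choose_spec

lemma generator_eq {T : ℝ → L2 →L[ℂ] L2} {u h : L2}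
    (hu : Tendsto (fun t : ℝ => ((t : ℂ)⁻¹) • (T t u - u)) (𝓝[>] 0) (𝓝 h)) :
    ∃ hd : u ∈ (generator T).domain, generator T ⟨u, hd⟩ = h :=
  ⟨⟨h, hu⟩, tendsto_nhds_unique (generator_spec T ⟨u, ⟨h, hu⟩⟩) hu⟩

/-- The generator of the semigroup of left translations. -/
abbrev translationGenerator : L2 →ₗ.[ℂ] L2 :=
  generator fun s => ContinuousLinearMap.adjoint (shift s)

lemma ofReal_inv_smul (t : ℝ) (v : L2) : ((t : ℂ)⁻¹) • v = t⁻¹ • v := by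
  rw [RCLike.real_smul_eq_coe_smul (K := ℂ) t⁻¹ v]
  congr 1
  exact (Complex.ofReal_inv t).symm

lemma translation_tendsto {u h : L2} {r : ℝ} (hr : 0 ≤ r)
    (hu : Tendsto (fun t : ℝ => ((t : ℂ)⁻¹) • (shift (-t) u - u)) (𝓝[>] 0) (𝓝 h)) :
    Tendsto (fun t : ℝ => ((t : ℂ)⁻¹) • (shift (-(r + t)) u - shift (-r) u)) (𝓝[>] 0)
      (𝓝 (shift (-r) h)) := by
  refine (((shift (-r)).continuous.tendsto h).comp hu).congr' ?_
  filter_upwards [self_mem_nhdsWithin] with t ht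
  rw [Function.comp_apply, map_smul, map_sub, shift_neg_add hr (le_of_lt ht),
    ContinuousLinearMap.comp_apply]

lemma generator_translation (u : translationGenerator.domain) {r : ℝ} (hr : 0 ≤ r) :
    ∃ hd : shift (-r) u ∈ translationGenerator.domain,
      translationGenerator ⟨shift (-r) u, hd⟩ = shift (-r) (translationGenerator u) := by
  have h := generator_spec _ u
  simp only [adjoint_shift] at h
  refine generator_eq ?_
  simp only [adjoint_shift]
  refine (translation_tendsto hr h).congr' ?_
  filter_upwards [self_mem_nhdsWithin] with t ht
  rw [add_comm, shift_neg_add (le_of_lt ht) hr, ContinuousLinearMap.comp_apply]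

lemma hasDerivWithinAt_translation (u : translationGenerator.domain) {r : ℝ} (hr : 0 ≤ r) :
    HasDerivWithinAt (fun s => shift (-s) (u : L2)) (shift (-r) (translationGenerator u))
      (Ioi r) r := by
  have h := generator_spec _ u
  simp only [adjoint_shift] at h
  rw [hasDerivWithinAt_iff_tendsto_slope' (by simp)]
  have h2 := translation_tendsto hr h
  have h3 : Tendsto (fun s : ℝ => s - r) (𝓝[>] r) (𝓝[>] 0) := by
    refine tendsto_nhdsWithin_of_tendsto_nhds_of_eventually_within _ ?_ ?_
    · have : Tendsto (fun s : ℝ => s - r) (𝓝 r) (𝓝 (r - r)) :=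
        (continuous_id.sub continuous_const).tendsto r
      rw [sub_self] at this
      exact this.mono_left nhdsWithin_le_nhds
    · filter_upwards [self_mem_nhdsWithin] with s hs
      simpa using hs
  refine (h2.comp h3).congr fun s => ?_
  simp only [Function.comp_apply, add_sub_cancel, slope, vsub_eq_sub]
  rw [ofReal_inv_smul]

/-- The averages ∫₀ʰ T_r v dr lie in the domain, the generator sends them to T_h v - v, and divided
by h they tend to v. Density is needed because `LinearPMap.adjoint` is the true adjoint only for
densely defined operators. -/
lemma dense_translationGenerator : Dense (translationGenerator.domain : Set L2) := by
  intro v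
  have hc : Continuous fun r : ℝ => shift (-r) v := (continuous_shift v).comp continuous_neg
  have hii : ∀ a b : ℝ, IntervalIntegrable (fun r => shift (-r) v) volume a b :=
    fun a b => hc.intervalIntegrable a b
  have hder : ∀ h : ℝ, HasDerivAt (fun t : ℝ => ∫ r in (0 : ℝ)..t, shift (-r) v) (shift (-h) v) h :=
    fun h => intervalIntegral.integral_hasDerivAt_right (hii 0 h)
      hc.stronglyMeasurable.stronglyMeasurableAtFilter hc.continuousAt
  have hmem : ∀ h : ℝ, 0 ≤ h →
      (∫ r in (0 : ℝ)..h, shift (-r) v) ∈ translationGenerator.domain := by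
    intro h hh
    refine (generator_eq (h := shift (-h) v - v) ?_).1
    have d1 := (hasDerivAt_iff_tendsto_slope_zero.1 (hder h)).mono_left
      (nhdsWithin_mono (0 : ℝ) (s := Ioi 0) (t := {0}ᶜ) fun x hx => ne_of_gt hx)
    have d2 := (hasDerivAt_iff_tendsto_slope_zero.1 (hder 0)).mono_left
      (nhdsWithin_mono (0 : ℝ) (s := Ioi 0) (t := {0}ᶜ) fun x hx => ne_of_gt hx)
    rw [neg_zero, shift_zero, one_apply_eq_self] at d2
    refine (d1.sub d2).congr' ?_
    filter_upwards [self_mem_nhdsWithin] with t ht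
    have e1 : shift (-t) (∫ r in (0 : ℝ)..h, shift (-r) v) = ∫ r in t..(t + h), shift (-r) v := by
      rw [← ContinuousLinearMap.intervalIntegral_comp_comm _ (hii 0 h)]
      have : ∫ r in (0 : ℝ)..h, shift (-t) (shift (-r) v) =
          ∫ r in (0 : ℝ)..h, shift (-(t + r)) v := by
        refine intervalIntegral.integral_congr fun r hr => ?_
        rw [uIcc_of_le hh] at hr
        rw [shift_neg_add (le_of_lt ht) hr.1, ContinuousLinearMap.comp_apply]
      rw [this, intervalIntegral.integral_comp_add_left (fun r => shift (-r) v) t, add_zero]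
    have e2 : (∫ r in (0 : ℝ)..(h + t), shift (-r) v) =
        (∫ r in (0 : ℝ)..t, shift (-r) v) + ∫ r in t..(t + h), shift (-r) v := by
      rw [intervalIntegral.integral_add_adjacent_intervals (hii _ _) (hii _ _), add_comm h t]
    rw [adjoint_shift, e1, e2, zero_add, intervalIntegral.integral_same, sub_zero,
      ofReal_inv_smul, ← smul_sub]
    congr 1
    abel
  have d2 := (hasDerivAt_iff_tendsto_slope_zero.1 (hder 0)).mono_left
    (nhdsWithin_mono (0 : ℝ) (s := Ioi 0) (t := {0}ᶜ) fun x hx => ne_of_gt hx)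
  rw [neg_zero, shift_zero, one_apply_eq_self] at d2
  refine mem_closure_of_tendsto d2 ?_
  filter_upwards [self_mem_nhdsWithin] with t ht
  rw [zero_add, intervalIntegral.integral_same, sub_zero, ← ofReal_inv_smul]
  exact Submodule.smul_mem _ _ (hmem t (le_of_lt ht))

lemma dense_opA : Dense (opA.domain : Set L2) := dense_translationGenerator

lemma inner_adjoint_opA (f : opA.adjoint.domain) (u : translationGenerator.domain) :
    inner ℂ (translationGenerator u) (f : L2) = -inner ℂ (u : L2) (opA.adjoint f) := by
  have h := LinearPMap.adjoint_isFormalAdjoint dense_opA f u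
  rw [show opA u = -translationGenerator u from rfl, inner_neg_right] at h
  rw [← inner_conj_symm, ← inner_conj_symm (u : L2), h, map_neg, neg_neg]

/-- Pair with u in the dense domain of the generator. Moving the shift onto u, the function r ↦ ⟨u,
S_r f⟩ is continuous with right derivative -⟨u, S_r A†f⟩, since translations commute with the
generator and f lies in D(A†). A right derivative is enough for the fundamental theorem of calculus.
-/
lemma shift_sub_eq_integral (f : opA.adjoint.domain) {s : ℝ} (hs : 0 ≤ s) :
    shift s (f : L2) - f = -∫ r in (0 : ℝ)..s, shift r (opA.adjoint f) := by
  refine dense_translationGenerator.eq_of_inner_right (𝕜 := ℂ) fun u hu => ?_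
  have hc := continuous_shift (opA.adjoint f)
  have key : ∫ r in (0 : ℝ)..s, -inner ℂ u (shift r (opA.adjoint f)) =
      inner ℂ u (shift s (f : L2)) - inner ℂ u (shift 0 (f : L2)) := by
    refine intervalIntegral.integral_eq_sub_of_hasDeriv_right
      (f := fun r => inner ℂ u (shift r (f : L2))) ?_ ?_ ?_
    · exact (continuous_const.inner (continuous_shift (f : L2))).continuousOn
    · intro r hr
      rw [min_eq_left hs] at hr
      have h1 := hasDerivWithinAt_translation ⟨u, hu⟩ hr.1.le
      obtain ⟨hd, h2⟩ := generator_translation ⟨u, hu⟩ hr.1.le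
      have h3 := h1.inner ℂ (hasDerivWithinAt_const r (Ioi r) (f : L2))
      simp only [inner_zero_right, zero_add] at h3
      rw [← h2, inner_adjoint_opA] at h3
      simp only [← adjoint_shift, ContinuousLinearMap.adjoint_inner_left] at h3
      exact h3
    · exact (continuous_const.inner hc).neg.intervalIntegrable _ _
  rw [shift_zero, one_apply_eq_self, intervalIntegral.integral_neg] at key
  rw [inner_sub_right, ← key, inner_neg_right]
  congr 1
  exact ContinuousLinearMap.intervalIntegral_comp_comm (innerSL ℂ u) (hc.intervalIntegrable 0 s)

lemma hasDerivAt_shift (f : opA.adjoint.domain) {t : ℝ} (ht : 0 < t) :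
    HasDerivAt (fun s => shift s (f : L2)) (-shift t (opA.adjoint f)) t := by
  have hc := continuous_shift (opA.adjoint f)
  have h := (intervalIntegral.integral_hasDerivAt_right (hc.intervalIntegrable 0 t)
    hc.stronglyMeasurable.stronglyMeasurableAtFilter hc.continuousAt).neg.const_add (f : L2)
  refine h.congr_of_eventuallyEq ?_
  filter_upwards [lt_mem_nhds ht] with s hs
  rw [← sub_eq_iff_eq_add']
  exact shift_sub_eq_integral f hs.le

/-- This is the product rule for ⟨S_t g, K S_t f⟩; no property of K beyond boundedness enters. -/
lemma satisfiesLyapunov_shifted (K : L2 →L[ℂ] L2) : SatisfiesLyapunov opA (shifted K) := by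
  intro f g t ht
  have h1 := hasDerivAt_shift f ht
  have h2 := hasDerivAt_shift g ht
  have h3 : HasDerivAt (fun s => K (shift s (f : L2))) (K (-shift t (opA.adjoint f))) t :=
    (K.restrictScalars ℝ).hasFDerivAt.comp_hasDerivAt t h1
  have h4 := h2.inner ℂ h3
  simp only [shifted, ContinuousLinearMap.comp_apply, ContinuousLinearMap.adjoint_inner_right]
  refine h4.congr_deriv ?_
  rw [map_neg, inner_neg_right, inner_neg_left]
  ring

end HamKernel

namespace HamKernel

/-! ### Elementary matrix estimates -/

section MatrixEstimates

variable {ι : Type} [Fintype ι] [DecidableEq ι]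

lemma norm_entry_le_l2_opNorm {𝕜 : Type*} [RCLike 𝕜] (A : Matrix ι ι 𝕜) (i j : ι) :
    ‖A i j‖ ≤ ‖A‖ := by
  have h := A.l2_opNorm_mulVec (EuclideanSpace.single j (1 : 𝕜))
  rw [PiLp.norm_single, norm_one, mul_one] at h
  refine le_trans ?_ h
  have h2 := PiLp.norm_apply_le ((EuclideanSpace.equiv ι 𝕜).symm
    (A *ᵥ (EuclideanSpace.single j (1 : 𝕜)).ofLp)) i
  refine le_trans (le_of_eq ?_) h2
  simp

omit [DecidableEq ι]

/-- Vectors carry the sup norm and matrices the ℓ² operator norm, so estimates go through entries at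
the cost of factors `Fintype.card`, whose size never matters. -/
lemma norm_dotProduct_le (u v : ι → ℂ) : ‖u ⬝ᵥ v‖ ≤ Fintype.card ι * (‖u‖ * ‖v‖) := by
  calc ‖u ⬝ᵥ v‖ ≤ ∑ i, ‖u i * v i‖ := norm_sum_le _ _
    _ ≤ ∑ _i : ι, ‖u‖ * ‖v‖ := by
        refine Finset.sum_le_sum fun i _ => ?_
        rw [norm_mul]
        exact mul_le_mul (norm_le_pi_norm u i) (norm_le_pi_norm v i) (norm_nonneg _)
          (norm_nonneg _)
    _ = _ := by simp

lemma norm_mulVec_le {A : Matrix ι ι ℂ} {c : ℝ} (hc : 0 ≤ c) (hA : ∀ i j, ‖A i j‖ ≤ c)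
    (v : ι → ℂ) : ‖A *ᵥ v‖ ≤ Fintype.card ι * (c * ‖v‖) := by
  refine (pi_norm_le_iff_of_nonneg (by positivity)).2 fun i => ?_
  refine (norm_dotProduct_le (A i) v).trans ?_
  gcongr
  exact (pi_norm_le_iff_of_nonneg hc).2 (hA i)

end MatrixEstimates

variable {m : ℕ}

lemma norm_J_le (i j : Fin m ⊕ Fin m) : ‖Matrix.J (Fin m) ℂ i j‖ ≤ 1 := by
  rcases i with i | i <;> rcases j with j | j <;>
    simp [Matrix.J, Matrix.one_apply] <;> split_ifs <;> simp

lemma norm_J_mulVec_le (v : Fin m ⊕ Fin m → ℂ) :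
    ‖Matrix.J (Fin m) ℂ *ᵥ v‖ ≤ Fintype.card (Fin m ⊕ Fin m) * ‖v‖ := by
  simpa using norm_mulVec_le zero_le_one norm_J_le v

lemma J_mulVec_J_mulVec (v : Fin m ⊕ Fin m → ℂ) :
    Matrix.J (Fin m) ℂ *ᵥ (Matrix.J (Fin m) ℂ *ᵥ v) = -v := by
  rw [Matrix.mulVec_mulVec, Matrix.J_squared, Matrix.neg_mulVec, Matrix.one_mulVec]

lemma J_mulVec_dotProduct (u v : Fin m ⊕ Fin m → ℂ) :
    (Matrix.J (Fin m) ℂ *ᵥ u) ⬝ᵥ v = -(u ⬝ᵥ (Matrix.J (Fin m) ℂ *ᵥ v)) := by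
  rw [Matrix.dotProduct_mulVec, ← Matrix.mulVec_transpose, Matrix.J_transpose, Matrix.neg_mulVec,
    neg_dotProduct, neg_neg]

/-- Skew-symmetry of J. It makes the numerator of the kernel vanish on the diagonal and thus cancels
the singularity of 1/(x - y). -/
lemma J_mulVec_dotProduct_self (u : Fin m ⊕ Fin m → ℂ) :
    (Matrix.J (Fin m) ℂ *ᵥ u) ⬝ᵥ u = 0 := by
  have h := J_mulVec_dotProduct u u
  rw [dotProduct_comm u] at h
  exact self_eq_neg.1 h

/-! ### Solutions of the Hamiltonian system -/

/-- `‖Ψ'‖ ≤ C ‖Ψ‖` on `(0,∞)`, with a continuously differentiable `Ψ ∈ L²`. -/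
structure IsTame (C : ℝ) (Ψ : ℝ → Fin m ⊕ Fin m → ℂ) : Prop where
  nonneg : 0 ≤ C
  hasDerivAt : ∀ x > 0, HasDerivAt Ψ (deriv Ψ x) x
  continuousOn_deriv : ContinuousOn (deriv Ψ) (Ioi 0)
  norm_deriv_le : ∀ x > 0, ‖deriv Ψ x‖ ≤ C * ‖Ψ x‖
  memLp : MemLp Ψ 2 halfLine

variable {E F : ℝ → Matrix (Fin m ⊕ Fin m) (Fin m ⊕ Fin m) ℝ} {lam : ℂ}
  {Ψ : ℝ → Fin m ⊕ Fin m → ℂ}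

lemma continuousOn_potential_entry (hE : IsCoefficient E) (hF : IsCoefficient F) (lam : ℂ)
    (i j : Fin m ⊕ Fin m) : ContinuousOn (fun x => potential E F lam x i j) (Ioi 0) := by
  have h : ∀ {A : ℝ → Matrix (Fin m ⊕ Fin m) (Fin m ⊕ Fin m) ℝ}, IsCoefficient A →
      ContinuousOn (fun x => (A x i j : ℂ)) (Ioi 0) := fun {A} hA =>
    (Complex.continuous_ofReal.comp
      (continuous_id.matrix_elem i j)).comp_continuousOn hA.continuousOn
  exact (continuousOn_const.mul (h hE)).add (h hF)

lemma potential_isSymm (hE : IsCoefficient E) (hF : IsCoefficient F) (lam : ℂ) {x : ℝ}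
    (hx : 0 < x) : (potential E F lam x).IsSymm :=
  (((hE.isSymm x hx).map _).smul lam).add ((hF.isSymm x hx).map _)

lemma exists_norm_potential_le (hE : IsCoefficient E) (hF : IsCoefficient F) :
    ∃ c : ℝ, 0 ≤ c ∧ ∀ (lam : ℂ), ∀ x > 0, ∀ i j, ‖potential E F lam x i j‖ ≤ c * (1 + ‖lam‖) := by
  obtain ⟨a, ha⟩ := hE.bounded
  obtain ⟨b, hb⟩ := hF.bounded
  have ha0 : 0 ≤ a := (norm_nonneg _).trans (ha 1 one_pos)
  have hb0 : 0 ≤ b := (norm_nonneg _).trans (hb 1 one_pos)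
  refine ⟨a + b, by positivity, fun lam x hx i j => ?_⟩
  have h1 : ‖potential E F lam x i j‖ ≤ ‖lam‖ * ‖E x i j‖ + ‖F x i j‖ := by
    refine (norm_add_le _ _).trans ?_
    simp
  have h2 := (norm_entry_le_l2_opNorm (E x) i j).trans (ha x hx)
  have h3 := (norm_entry_le_l2_opNorm (F x) i j).trans (hb x hx)
  nlinarith [norm_nonneg lam, mul_le_mul_of_nonneg_left h2 (norm_nonneg lam),
    mul_nonneg hb0 (norm_nonneg lam)]

lemma IsBoundedL2Solution.deriv_eq (h : IsBoundedL2Solution E F lam Ψ) {x : ℝ} (hx : 0 < x) :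
    deriv Ψ x = -(Matrix.J (Fin m) ℂ *ᵥ (potential E F lam x *ᵥ Ψ x)) := by
  rw [← h.equation x hx, J_mulVec_J_mulVec, neg_neg]

/-- The constant c is chosen before λ and Ψ: the estimates for K_λ have to be locally uniform in λ.
-/
lemma exists_isTame (hE : IsCoefficient E) (hF : IsCoefficient F) :
    ∃ c : ℝ, 0 ≤ c ∧ ∀ (lam : ℂ) (Ψ : ℝ → Fin m ⊕ Fin m → ℂ), IsBoundedL2Solution E F lam Ψ →
      IsTame (c * (1 + ‖lam‖)) Ψ := by
  obtain ⟨c, hc, hP⟩ := exists_norm_potential_le hE hF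
  set N : ℝ := ((Fintype.card (Fin m ⊕ Fin m) : ℕ) : ℝ) with hN
  have hN0 : 0 ≤ N := Nat.cast_nonneg _
  refine ⟨N * (N * c), by positivity, fun lam Ψ h => ⟨by positivity,
    fun x hx => (h.differentiableAt x hx).hasDerivAt, ?_, fun x hx => ?_, h.memLp⟩⟩
  · have hΨ : ContinuousOn Ψ (Ioi 0) := fun x hx =>
      (h.differentiableAt x hx).continuousAt.continuousWithinAt
    have hP' : ∀ i j, ContinuousOn (fun x => potential E F lam x i j) (Ioi 0) :=
      continuousOn_potential_entry hE hF lam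
    have h1 : ContinuousOn
        (fun x => -(Matrix.J (Fin m) ℂ *ᵥ (potential E F lam x *ᵥ Ψ x))) (Ioi 0) := by
      refine (continuousOn_pi.2 fun i => continuousOn_finsetSum _ fun j _ =>
        continuousOn_const.mul (continuousOn_finsetSum _ fun k _ => ?_)).neg
      exact (hP' j k).mul (continuousOn_pi.1 hΨ k)
    exact h1.congr fun x hx => h.deriv_eq hx
  · rw [h.deriv_eq hx, norm_neg]
    refine (norm_J_mulVec_le _).trans ?_
    have h1 := norm_mulVec_le (by positivity) (hP lam x hx) (Ψ x)
    rw [← hN] at h1 ⊢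
    calc N * ‖potential E F lam x *ᵥ Ψ x‖ ≤ N * (N * (c * (1 + ‖lam‖) * ‖Ψ x‖)) := by gcongr
      _ = _ := by ring

namespace IsTame

variable {C : ℝ}

lemma continuousOn (h : IsTame C Ψ) : ContinuousOn Ψ (Ioi 0) := fun x hx =>
  (h.hasDerivAt x hx).continuousAt.continuousWithinAt

lemma integrable_norm_sq (h : IsTame C Ψ) : Integrable (fun x => ‖Ψ x‖ ^ 2) halfLine :=
  (memLp_two_iff_integrable_sq_norm h.memLp.1).1 h.memLp

/-- Average ‖Ψ(x)‖ ≤ ‖Ψ(y)‖ + C ∫ ‖Ψ‖ over y in [x, x+1], then apply Cauchy-Schwarz on this unit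
interval. The tail on the right gives decay at infinity. -/
lemma norm_sq_le (h : IsTame C Ψ) {x : ℝ} (hx : 0 < x) :
    ‖Ψ x‖ ^ 2 ≤ (1 + C) ^ 2 * ∫ y in Ioi x, ‖Ψ y‖ ^ 2 := by
  have hpos : ∀ y ∈ uIcc x (x + 1), y ∈ Ioi (0 : ℝ) := fun y hy => by
    rw [uIcc_of_le (by linarith)] at hy
    exact hx.trans_le hy.1
  have hcn : ContinuousOn (fun y => ‖Ψ y‖) (uIcc x (x + 1)) := (h.continuousOn.mono hpos).norm
  have hi1 : IntervalIntegrable (fun y => ‖Ψ y‖) volume x (x + 1) := hcn.intervalIntegrable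
  have hi2 : IntervalIntegrable (fun y => ‖Ψ y‖ ^ 2) volume x (x + 1) :=
    (hcn.pow 2).intervalIntegrable
  set M := ∫ y in x..(x + 1), ‖Ψ y‖ with hM
  have h1 : ∀ y ∈ Icc x (x + 1), ‖Ψ x‖ ≤ ‖Ψ y‖ + C * M := by
    intro y hy
    have hsub : uIcc x y ⊆ uIcc x (x + 1) := by
      rw [uIcc_of_le hy.1, uIcc_of_le (by linarith)]
      exact Icc_subset_Icc_right hy.2
    have h2 := intervalIntegral.integral_eq_sub_of_hasDerivAt
      (fun z hz => h.hasDerivAt z (hpos z (hsub hz)))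
      ((h.continuousOn_deriv.mono fun z hz => hpos z (hsub hz)).intervalIntegrable)
    have h3 : ‖Ψ y - Ψ x‖ ≤ C * M := by
      rw [← h2]
      refine (intervalIntegral.norm_integral_le_of_norm_le hy.1
        (g := fun z => C * ‖Ψ z‖) (Eventually.of_forall fun z hz => ?_) ?_).trans ?_
      · exact h.norm_deriv_le z (hx.trans hz.1)
      · exact ((hi1.mono_set hsub).const_mul C)
      · rw [intervalIntegral.integral_const_mul]
        refine mul_le_mul_of_nonneg_left ?_ h.nonneg
        exact intervalIntegral.integral_mono_interval le_rfl hy.1 hy.2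
          (Eventually.of_forall fun z => norm_nonneg _) hi1
    have h4 := norm_sub_norm_le (Ψ x) (Ψ y)
    rw [norm_sub_rev] at h4
    linarith
  have h5 : ‖Ψ x‖ ≤ (1 + C) * M := by
    have h6 := intervalIntegral.integral_mono_on (by linarith : x ≤ x + 1)
      (intervalIntegrable_const (c := ‖Ψ x‖)) (hi1.add (intervalIntegrable_const (c := C * M))) h1
    rw [intervalIntegral.integral_add hi1 intervalIntegrable_const] at h6
    simp only [intervalIntegral.integral_const, add_sub_cancel_left, one_smul] at h6
    rw [← hM] at h6
    linarith
  -- Cauchy-Schwarz in the form that a variance is nonnegative: M is the mean of ‖Ψ‖ over an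
  -- interval of length 1.
  have h7 : M ^ 2 ≤ ∫ y in x..(x + 1), ‖Ψ y‖ ^ 2 := by
    have h8 : 0 ≤ ∫ y in x..(x + 1), (‖Ψ y‖ - M) ^ 2 :=
      intervalIntegral.integral_nonneg (by linarith) fun y _ => sq_nonneg _
    have h9 : ∫ y in x..(x + 1), (‖Ψ y‖ - M) ^ 2 =
        ∫ y in x..(x + 1), (‖Ψ y‖ ^ 2 - (2 * M) * ‖Ψ y‖ + M ^ 2) :=
      intervalIntegral.integral_congr fun y _ => by ring
    rw [h9, intervalIntegral.integral_add (hi2.sub (hi1.const_mul _)) intervalIntegrable_const,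
      intervalIntegral.integral_sub hi2 (hi1.const_mul _), intervalIntegral.integral_const_mul,
      ← hM] at h8
    simp only [intervalIntegral.integral_const, add_sub_cancel_left, one_smul] at h8
    nlinarith
  have h10 : ∫ y in x..(x + 1), ‖Ψ y‖ ^ 2 ≤ ∫ y in Ioi x, ‖Ψ y‖ ^ 2 := by
    rw [intervalIntegral.integral_of_le (by linarith)]
    refine setIntegral_mono_set ?_ (Eventually.of_forall fun y => sq_nonneg _)
      Ioc_subset_Ioi_self.eventuallyLE
    exact IntegrableOn.mono_set h.integrable_norm_sq (Ioi_subset_Ioi hx.le)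
  have h0 : 0 ≤ ‖Ψ x‖ := norm_nonneg _
  calc ‖Ψ x‖ ^ 2 ≤ ((1 + C) * M) ^ 2 := by gcongr
    _ = (1 + C) ^ 2 * M ^ 2 := by ring
    _ ≤ _ := by gcongr; exact h7.trans h10

lemma tendsto_integral_tail {f : ℝ → ℝ} (hf : Integrable f halfLine) :
    Tendsto (fun x => ∫ y in Ioi x, f y) atTop (𝓝 0) := by
  have h1 := intervalIntegral_tendsto_integral_Ioi 0 hf tendsto_id
  have h2 := (tendsto_const_nhds (x := ∫ y in Ioi (0 : ℝ), f y)).sub h1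
  rw [sub_self] at h2
  refine h2.congr' ?_
  filter_upwards [eventually_ge_atTop 0] with x hx
  rw [id, intervalIntegral.integral_of_le hx, ← Ioc_union_Ioi_eq_Ioi hx,
    setIntegral_union (Ioc_disjoint_Ioi le_rfl) measurableSet_Ioi
      (IntegrableOn.mono_set hf Ioc_subset_Ioi_self) (IntegrableOn.mono_set hf (Ioi_subset_Ioi hx))]
  ring

lemma tendsto_zero (h : IsTame C Ψ) : Tendsto Ψ atTop (𝓝 0) := by
  rw [tendsto_zero_iff_norm_tendsto_zero]
  have h1 : Tendsto (fun x => (1 + C) ^ 2 * ∫ y in Ioi x, ‖Ψ y‖ ^ 2) atTop (𝓝 0) := by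
    simpa using (tendsto_integral_tail h.integrable_norm_sq).const_mul ((1 + C) ^ 2)
  have h2 : Tendsto (fun x => ‖Ψ x‖ ^ 2) atTop (𝓝 0) := by
    refine squeeze_zero' (Eventually.of_forall fun x => sq_nonneg _) ?_ h1
    filter_upwards [eventually_gt_atTop 0] with x hx
    exact h.norm_sq_le hx
  have h3 := h2.sqrt
  simpa [Real.sqrt_sq] using h3

/-- The square of the `L²` norm. -/
abbrev mass (Ψ : ℝ → Fin m ⊕ Fin m → ℂ) : ℝ := ∫ y, ‖Ψ y‖ ^ 2 ∂halfLine

lemma mass_nonneg (Ψ : ℝ → Fin m ⊕ Fin m → ℂ) : 0 ≤ mass Ψ :=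
  integral_nonneg fun _ => sq_nonneg _

/-- A sup bound in terms of the L² norm, which is the quantity that an analytic family controls
locally uniformly in λ. -/
lemma norm_le (h : IsTame C Ψ) {x : ℝ} (hx : 0 < x) : ‖Ψ x‖ ≤ (1 + C) * √(mass Ψ) := by
  have hC := h.nonneg
  refine abs_le_of_sq_le_sq' ?_ (by positivity) |>.2
  rw [mul_pow, Real.sq_sqrt (mass_nonneg Ψ)]
  refine (h.norm_sq_le hx).trans ?_
  gcongr
  exact setIntegral_mono_set h.integrable_norm_sq (Eventually.of_forall fun y => sq_nonneg _)
    (Ioi_subset_Ioi hx.le).eventuallyLE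

lemma norm_sub_le (h : IsTame C Ψ) {x y : ℝ} (hx : 0 < x) (hy : 0 < y) :
    ‖Ψ x - Ψ y‖ ≤ C * ((1 + C) * √(mass Ψ)) * |x - y| := by
  have := h.nonneg
  refine (convex_Ioi (0 : ℝ)).norm_image_sub_le_of_norm_hasDerivWithin_le (f' := deriv Ψ)
    (fun z hz => (h.hasDerivAt z hz).hasDerivWithinAt) (fun z hz => ?_) hy hx
  refine (h.norm_deriv_le z hz).trans ?_
  gcongr
  exact h.norm_le hz

end IsTame

end HamKernel

namespace HamKernel

variable {m : ℕ} {E F : ℝ → Matrix (Fin m ⊕ Fin m) (Fin m ⊕ Fin m) ℝ} {lam : ℂ}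
  {Ψ : ℝ → Fin m ⊕ Fin m → ℂ} {C δ : ℝ}

/-! ### Square integrability of the kernel -/

/-- `⟨J Ψ(x), Ψ(y)⟩`. -/
def wronskian (Ψ : ℝ → Fin m ⊕ Fin m → ℂ) (x y : ℝ) : ℂ :=
  (Matrix.J (Fin m) ℂ *ᵥ Ψ x) ⬝ᵥ Ψ y

/-- `1 / (x - y)`, cut off near the diagonal. -/
def cutoff (δ x y : ℝ) : ℂ := if δ < |x - y| then ((x : ℂ) - y)⁻¹ else 0

lemma norm_cutoff_le (hδ : 0 < δ) (x y : ℝ) : ‖cutoff δ x y‖ ≤ δ⁻¹ := by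
  unfold cutoff
  split_ifs with h
  · rw [norm_inv, ← Complex.ofReal_sub, Complex.norm_real, Real.norm_eq_abs]
    exact inv_anti₀ hδ h.le
  · simpa using hδ.le

lemma measurable_cutoff (δ : ℝ) : Measurable fun z : ℝ × ℝ => cutoff δ z.1 z.2 := by
  unfold cutoff
  refine Measurable.ite ?_ ?_ measurable_const
  · exact measurableSet_lt measurable_const (measurable_fst.sub measurable_snd).abs
  · exact ((Complex.measurable_ofReal.comp measurable_fst).sub
      (Complex.measurable_ofReal.comp measurable_snd)).inv

lemma ae_fst_ne_snd : ∀ᵐ z ∂(halfLine.prod halfLine), z.1 ≠ z.2 := by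
  rw [Measure.ae_prod_iff_ae_ae]
  · refine Eventually.of_forall fun x => ?_
    filter_upwards [Measure.ae_ne halfLine x] with y hy
    exact hy.symm
  · exact (measurableSet_eq_fun measurable_fst measurable_snd).compl

lemma ae_pos_prod : ∀ᵐ z ∂(halfLine.prod halfLine), 0 < z.1 ∧ 0 < z.2 := by
  rw [Measure.prod_restrict]
  filter_upwards [ae_restrict_mem (measurableSet_Ioi.prod measurableSet_Ioi)] with z hz
  exact hz

lemma kernel_of_ne {x y : ℝ} (h : x ≠ y) :
    kernel E F lam Ψ x y = wronskian Ψ x y / ((x : ℂ) - y) := by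
  rw [kernel, if_neg h, wronskian]

lemma kernel_self (x : ℝ) : kernel E F lam Ψ x x = diagonal E F lam Ψ x := by
  rw [kernel, if_pos rfl]

lemma ae_kernel_eq : Function.uncurry (kernel E F lam Ψ) =ᵐ[halfLine.prod halfLine]
    fun z => wronskian Ψ z.1 z.2 / ((z.1 : ℂ) - z.2) := by
  filter_upwards [ae_fst_ne_snd] with z hz
  exact kernel_of_ne hz

namespace IsTame

lemma memLp_apply (h : IsTame C Ψ) (i : Fin m ⊕ Fin m) : MemLp (fun x => Ψ x i) 2 halfLine :=
  (ContinuousLinearMap.proj (R := ℂ) (φ := fun _ : Fin m ⊕ Fin m => ℂ) i).comp_memLp' h.memLp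

lemma memLp_J_apply (h : IsTame C Ψ) (i : Fin m ⊕ Fin m) :
    MemLp (fun x => (Matrix.J (Fin m) ℂ *ᵥ Ψ x) i) 2 halfLine :=
  ((ContinuousLinearMap.proj (R := ℂ) (φ := fun _ : Fin m ⊕ Fin m => ℂ) i).comp
    (LinearMap.toContinuousLinearMap (Matrix.mulVecLin (Matrix.J (Fin m) ℂ)))).comp_memLp' h.memLp

lemma aestronglyMeasurable_wronskian (h : IsTame C Ψ) :
    AEStronglyMeasurable (fun z : ℝ × ℝ => wronskian Ψ z.1 z.2) (halfLine.prod halfLine) := by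
  unfold wronskian dotProduct
  refine Finset.aestronglyMeasurable_fun_sum _ fun i _ => ?_
  exact (h.memLp_J_apply i).1.comp_fst.mul (h.memLp_apply i).1.comp_snd

lemma aestronglyMeasurable_kernel (h : IsTame C Ψ) :
    AEStronglyMeasurable (Function.uncurry (kernel E F lam Ψ)) (halfLine.prod halfLine) := by
  refine AEStronglyMeasurable.congr ?_ ae_kernel_eq.symm
  refine (h.aestronglyMeasurable_wronskian.aemeasurable.div
    (Measurable.aemeasurable ?_)).aestronglyMeasurable
  exact (Complex.measurable_ofReal.comp measurable_fst).sub
    (Complex.measurable_ofReal.comp measurable_snd)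

/-- Since ⟨JΨ(x), Ψ(x)⟩ = 0, the vector Ψ(y) may be replaced by Ψ(y) - Ψ(x), which is O(|x - y|).
The remaining factor ‖Ψ(x)‖ makes the bound square integrable in x. -/
lemma norm_kernel_le (h : IsTame C Ψ) {x y : ℝ} (hx : 0 < x) (hy : 0 < y) (hxy : x ≠ y) :
    ‖kernel E F lam Ψ x y‖ ≤
      (Fintype.card (Fin m ⊕ Fin m)) ^ 2 * (C * ((1 + C) * √(mass Ψ))) * ‖Ψ x‖ := by
  have h1 : wronskian Ψ x y = (Matrix.J (Fin m) ℂ *ᵥ Ψ x) ⬝ᵥ (Ψ y - Ψ x) := by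
    rw [dotProduct_sub, J_mulVec_dotProduct_self, sub_zero, wronskian]
  have h2 : 0 < |x - y| := abs_pos.2 (sub_ne_zero.2 hxy)
  have hC := h.nonneg
  rw [kernel_of_ne hxy, norm_div, ← Complex.ofReal_sub, Complex.norm_real, Real.norm_eq_abs,
    div_le_iff₀ h2, h1]
  refine (norm_dotProduct_le _ _).trans ?_
  have h3 := norm_J_mulVec_le (Ψ x)
  have h4 := h.norm_sub_le hy hx
  rw [abs_sub_comm] at h4
  calc (Fintype.card (Fin m ⊕ Fin m) : ℝ) * (‖Matrix.J (Fin m) ℂ *ᵥ Ψ x‖ * ‖Ψ y - Ψ x‖)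
      ≤ (Fintype.card (Fin m ⊕ Fin m) : ℝ) * ((Fintype.card (Fin m ⊕ Fin m) * ‖Ψ x‖) *
        (C * ((1 + C) * √(mass Ψ)) * |x - y|)) := by gcongr
    _ = _ := by ring

/-- The part of the kernel near the diagonal. -/
lemma lintegral_near_le (h : IsTame C Ψ) (hδ : 0 ≤ δ) {k : ℝ → ℝ → ℂ}
    (hk : AEStronglyMeasurable (Function.uncurry k) (halfLine.prod halfLine))
    (hk1 : ∀ x > 0, ∀ y > 0, x ≠ y → |x - y| ≤ δ → ‖k x y‖ ≤ ‖kernel E F lam Ψ x y‖)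
    (hk2 : ∀ x > 0, ∀ y > 0, δ < |x - y| → k x y = 0) :
    ∫⁻ z, ‖Function.uncurry k z‖ₑ ^ 2 ∂(halfLine.prod halfLine) ≤ ENNReal.ofReal
      ((√(2 * δ) * ((Fintype.card (Fin m ⊕ Fin m)) ^ 2 * (C * ((1 + C) * mass Ψ)))) ^ 2) := by
  set b : ℝ := (Fintype.card (Fin m ⊕ Fin m)) ^ 2 * (C * ((1 + C) * √(mass Ψ))) with hb
  rw [lintegral_prod_enorm_sq hk]
  calc ∫⁻ x, ∫⁻ y, ‖k x y‖ₑ ^ 2 ∂halfLine ∂halfLine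
      ≤ ∫⁻ x, ENNReal.ofReal (b ^ 2 * (2 * δ) * ‖Ψ x‖ ^ 2) ∂halfLine := by
        refine lintegral_mono_ae ?_
        filter_upwards [ae_restrict_mem measurableSet_Ioi] with x hx
        -- At fixed x the section is bounded by b‖Ψ(x)‖ and lives on an interval of length 2δ.
        calc ∫⁻ y, ‖k x y‖ₑ ^ 2 ∂halfLine
            ≤ ∫⁻ y, (Metric.closedBall x δ).indicator
                (fun _ => ENNReal.ofReal (b ^ 2 * ‖Ψ x‖ ^ 2)) y ∂halfLine := by
              refine lintegral_mono_ae ?_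
              filter_upwards [ae_restrict_mem measurableSet_Ioi, Measure.ae_ne halfLine x]
                with y hy hyx
              by_cases hd : |x - y| ≤ δ
              · rw [indicator_of_mem (by rw [Metric.mem_closedBall, Real.dist_eq, abs_sub_comm]
                                         exact hd), ← ofReal_norm,
                  ← ENNReal.ofReal_pow (norm_nonneg _), ← mul_pow]
                refine ENNReal.ofReal_le_ofReal ?_
                gcongr
                exact (hk1 x hx y hy hyx.symm hd).trans (h.norm_kernel_le hx hy hyx.symm)
              · rw [hk2 x hx y hy (not_le.1 hd)]
                simp
          _ ≤ ∫⁻ y, (Metric.closedBall x δ).indicator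
                (fun _ => ENNReal.ofReal (b ^ 2 * ‖Ψ x‖ ^ 2)) y := setLIntegral_le_lintegral _ _
          _ = ENNReal.ofReal (b ^ 2 * (2 * δ) * ‖Ψ x‖ ^ 2) := by
              rw [lintegral_indicator_const measurableSet_closedBall, Real.volume_closedBall,
                ← ENNReal.ofReal_mul (by positivity)]
              congr 1
              ring
    _ = ENNReal.ofReal (b ^ 2 * (2 * δ) * mass Ψ) := by
        rw [← ofReal_integral_eq_lintegral_ofReal (h.integrable_norm_sq.const_mul _)
          (Eventually.of_forall fun x => by positivity), integral_const_mul]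
    _ = _ := by
        congr 1
        rw [hb, mul_pow (√(2 * δ)), Real.sq_sqrt (by positivity)]
        have := Real.sq_sqrt (mass_nonneg Ψ)
        calc _ = ((Fintype.card (Fin m ⊕ Fin m) : ℝ) ^ 2 * (C * (1 + C))) ^ 2 * (√(mass Ψ)) ^ 2
              * (2 * δ) * mass Ψ := by ring
          _ = _ := by rw [this]; ring

end IsTame

/-! ### Tensor kernels with a cutoff -/

lemma memLp_cutoff_mul (hδ : 0 < δ) {φ ψ : ℝ → ℂ} (hφ : MemLp φ 2 halfLine)
    (hψ : MemLp ψ 2 halfLine) :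
    MemLp (Function.uncurry fun x y => cutoff δ x y * (φ x * ψ y)) 2
      (halfLine.prod halfLine) := by
  refine MemLp.of_le_mul (c := δ⁻¹) (memLp_prod_mul hφ hψ) ?_ (Eventually.of_forall fun z => ?_)
  · exact (measurable_cutoff δ).aestronglyMeasurable.mul (hφ.1.comp_fst.mul hψ.1.comp_snd)
  · rw [Function.uncurry, norm_mul]
    gcongr
    exact norm_cutoff_le hδ _ _

/-- The integral operator with kernel `φ(x) ψ(y) / (x - y)`, cut off near the diagonal. -/
def cutoffOperator (hδ : 0 < δ) (p : L2 × L2) : L2 →L[ℂ] L2 :=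
  (exists_isIntegralOperator (memLp_cutoff_mul hδ (Lp.memLp p.1) (Lp.memLp p.2))).choose

lemma cutoffOperator_spec (hδ : 0 < δ) (p : L2 × L2) :
    IsIntegralOperator (cutoffOperator hδ p) fun x y => cutoff δ x y * (p.1 x * p.2 y) :=
  (exists_isIntegralOperator (memLp_cutoff_mul hδ (Lp.memLp p.1) (Lp.memLp p.2))).choose_spec

lemma norm_cutoffOperator_le (hδ : 0 < δ) (p : L2 × L2) :
    ‖cutoffOperator hδ p‖ ≤ δ⁻¹ * ‖p.1‖ * ‖p.2‖ := by
  refine (cutoffOperator_spec hδ p).norm_le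
    (memLp_cutoff_mul hδ (Lp.memLp p.1) (Lp.memLp p.2)) (by positivity) ?_
  have h1 : ∀ f : L2, ENNReal.ofReal (‖f‖ ^ 2) = ∫⁻ x, ‖f x‖ₑ ^ 2 ∂halfLine := fun f => by
    rw [ENNReal.ofReal_pow (norm_nonneg _), ofReal_norm, enorm_sq_eq_lintegral]
  calc _ ≤ ∫⁻ z, ENNReal.ofReal (δ⁻¹ ^ 2) * (‖p.1 z.1‖ₑ ^ 2 * ‖p.2 z.2‖ₑ ^ 2)
        ∂(halfLine.prod halfLine) := by
        refine lintegral_mono fun z => ?_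
        rw [Function.uncurry, enorm_mul, enorm_mul, mul_pow, mul_pow,
          ENNReal.ofReal_pow (by positivity)]
        gcongr
        rw [← ofReal_norm]
        exact ENNReal.ofReal_le_ofReal (norm_cutoff_le hδ _ _)
    _ = ENNReal.ofReal (δ⁻¹ ^ 2) * (ENNReal.ofReal (‖p.1‖ ^ 2) * ENNReal.ofReal (‖p.2‖ ^ 2)) := by
        rw [lintegral_const_mul' _ _ ENNReal.ofReal_ne_top, h1, h1,
          lintegral_prod_mul (f := fun x => ‖p.1 x‖ₑ ^ 2) (g := fun x => ‖p.2 x‖ₑ ^ 2)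
            ((Lp.aestronglyMeasurable _).enorm.pow_const 2)
            ((Lp.aestronglyMeasurable _).enorm.pow_const 2)]
    _ = _ := by
        rw [← ENNReal.ofReal_mul (by positivity), ← ENNReal.ofReal_mul (by positivity)]
        congr 1
        ring

/-- Neither factor is conjugated, so the dependence is bilinear over ℂ and therefore holomorphic. -/
lemma isBoundedBilinearMap_cutoffOperator (hδ : 0 < δ) :
    IsBoundedBilinearMap ℂ (cutoffOperator hδ) where
  add_left f g h := by
    refine (cutoffOperator_spec hδ _).ext
      ((cutoffOperator_spec hδ _).add (cutoffOperator_spec hδ _)) ?_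
    filter_upwards [Lp.coeFn_add f g] with x hx
    refine Eventually.of_forall fun y => ?_
    rw [hx, Pi.add_apply]
    ring
  smul_left c f h := by
    refine (cutoffOperator_spec hδ _).ext ((cutoffOperator_spec hδ _).const_smul c) ?_
    filter_upwards [Lp.coeFn_smul c f] with x hx
    refine Eventually.of_forall fun y => ?_
    rw [hx, Pi.smul_apply, smul_eq_mul]
    ring
  add_right f g h := by
    refine (cutoffOperator_spec hδ _).ext
      ((cutoffOperator_spec hδ _).add (cutoffOperator_spec hδ _)) ?_
    refine Eventually.of_forall fun x => ?_
    filter_upwards [Lp.coeFn_add g h] with y hy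
    rw [hy, Pi.add_apply]
    ring
  smul_right c f h := by
    refine (cutoffOperator_spec hδ _).ext ((cutoffOperator_spec hδ _).const_smul c) ?_
    refine Eventually.of_forall fun x => ?_
    filter_upwards [Lp.coeFn_smul c h] with y hy
    rw [hy, Pi.smul_apply, smul_eq_mul]
    ring
  bound := by
    refine ⟨δ⁻¹, by positivity, fun f g => ?_⟩
    exact norm_cutoffOperator_le hδ (f, g)

lemma IsIntegralOperator.sum {ι : Type*} (s : Finset ι) {T : ι → L2 →L[ℂ] L2}
    {k : ι → ℝ → ℝ → ℂ} (h : ∀ i, IsIntegralOperator (T i) (k i)) :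
    IsIntegralOperator (∑ i ∈ s, T i) fun x y => ∑ i ∈ s, k i x y := by
  classical
  induction s using Finset.induction_on with
  | empty =>
    intro f
    filter_upwards [Lp.coeFn_zero ℂ 2 halfLine] with x hx
    simpa using hx
  | insert a s ha ih =>
    simp only [Finset.sum_insert ha]
    exact (h a).add ih

/-- The components of `f ∈ L²((0,∞); ℂ^{2m})`. -/
def component (i : Fin m ⊕ Fin m) : Lp (Fin m ⊕ Fin m → ℂ) 2 halfLine →L[ℂ] L2 :=
  (ContinuousLinearMap.proj (R := ℂ) (φ := fun _ : Fin m ⊕ Fin m => ℂ) i).compLpL 2 halfLine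

/-- The components of `J f` for `f ∈ L²((0,∞); ℂ^{2m})`. -/
def componentJ (i : Fin m ⊕ Fin m) : Lp (Fin m ⊕ Fin m → ℂ) 2 halfLine →L[ℂ] L2 :=
  ((ContinuousLinearMap.proj (R := ℂ) (φ := fun _ : Fin m ⊕ Fin m => ℂ) i).comp
    (LinearMap.toContinuousLinearMap (Matrix.mulVecLin (Matrix.J (Fin m) ℂ)))).compLpL 2 halfLine

lemma coeFn_component (i : Fin m ⊕ Fin m) (f : Lp (Fin m ⊕ Fin m → ℂ) 2 halfLine) :
    component i f =ᵐ[halfLine] fun x => f x i :=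
  ContinuousLinearMap.coeFn_compLpL _ f

lemma coeFn_componentJ (i : Fin m ⊕ Fin m) (f : Lp (Fin m ⊕ Fin m → ℂ) 2 halfLine) :
    componentJ i f =ᵐ[halfLine] fun x => (Matrix.J (Fin m) ℂ *ᵥ f x) i :=
  ContinuousLinearMap.coeFn_compLpL _ f

/-- The operator with kernel `⟨J f(x), f(y)⟩ / (x - y)`, cut off near the diagonal. -/
def cutoffWronskianOperator (hδ : 0 < δ) (f : Lp (Fin m ⊕ Fin m → ℂ) 2 halfLine) : L2 →L[ℂ] L2 :=
  ∑ i, cutoffOperator hδ (componentJ i f, component i f)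

lemma differentiable_cutoffWronskianOperator (hδ : 0 < δ) :
    Differentiable ℂ (cutoffWronskianOperator (m := m) hδ) := by
  unfold cutoffWronskianOperator
  refine Differentiable.fun_sum fun i _ => ?_
  exact (isBoundedBilinearMap_cutoffOperator hδ).differentiable.comp
    ((componentJ i).differentiable.prodMk (component i).differentiable)

lemma isIntegralOperator_cutoffWronskian (hδ : 0 < δ) {f : Lp (Fin m ⊕ Fin m → ℂ) 2 halfLine}
    (hf : f =ᵐ[halfLine] Ψ) :
    IsIntegralOperator (cutoffWronskianOperator hδ f)
      fun x y => cutoff δ x y * wronskian Ψ x y := by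
  refine (IsIntegralOperator.sum Finset.univ fun i => cutoffOperator_spec hδ _).congr ?_
  filter_upwards [hf, ae_all_iff.2 fun i => coeFn_componentJ i f] with x hx hxJ
  filter_upwards [hf, ae_all_iff.2 fun i => coeFn_component i f] with y hy hyc
  simp only [hxJ, hyc, hx, hy, wronskian, dotProduct, Finset.mul_sum]

lemma kernel_eq_cutoff {x y : ℝ} (hδ : 0 ≤ δ) (h : δ < |x - y|) :
    kernel E F lam Ψ x y = cutoff δ x y * wronskian Ψ x y := by
  have hxy : x ≠ y := by
    rintro rfl
    simp only [sub_self, abs_zero] at h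
    linarith
  rw [kernel_of_ne hxy, cutoff, if_pos h, div_eq_inv_mul]

namespace IsTame

lemma aestronglyMeasurable_cutoff (h : IsTame C Ψ) (δ : ℝ) :
    AEStronglyMeasurable (Function.uncurry fun x y => cutoff δ x y * wronskian Ψ x y)
      (halfLine.prod halfLine) :=
  (measurable_cutoff δ).aestronglyMeasurable.mul h.aestronglyMeasurable_wronskian

lemma lintegral_kernel_sub_cutoff_le (h : IsTame C Ψ) (hδ : 0 ≤ δ) :
    ∫⁻ z, ‖Function.uncurry (fun x y => kernel E F lam Ψ x y - cutoff δ x y * wronskian Ψ x y) z‖ₑ ^ 2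
      ∂(halfLine.prod halfLine) ≤ ENNReal.ofReal
      ((√(2 * δ) * ((Fintype.card (Fin m ⊕ Fin m)) ^ 2 * (C * ((1 + C) * mass Ψ)))) ^ 2) := by
  refine h.lintegral_near_le (E := E) (F := F) (lam := lam) hδ
    (h.aestronglyMeasurable_kernel.sub (h.aestronglyMeasurable_cutoff δ)) ?_ ?_
  · intro x _ y _ _ hxy
    rw [cutoff, if_neg (not_lt.2 hxy), zero_mul, sub_zero]
  · intro x _ y _ hxy
    rw [kernel_eq_cutoff hδ hxy, sub_self]

lemma memLp_kernel_sub_cutoff (h : IsTame C Ψ) (hδ : 0 ≤ δ) :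
    MemLp (Function.uncurry fun x y => kernel E F lam Ψ x y - cutoff δ x y * wronskian Ψ x y) 2
      (halfLine.prod halfLine) :=
  memLp_two_of_lintegral_lt_top (h.aestronglyMeasurable_kernel.sub (h.aestronglyMeasurable_cutoff δ))
    ((h.lintegral_kernel_sub_cutoff_le hδ).trans_lt ENNReal.ofReal_lt_top)

/-- Split at |x - y| = 1: the strip is handled by the pointwise bound, the rest is a bounded
function times a finite sum of tensor products. -/
lemma memLp_kernel (h : IsTame C Ψ) :
    MemLp (Function.uncurry (kernel E F lam Ψ)) 2 (halfLine.prod halfLine) := by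
  have h1 := h.memLp_kernel_sub_cutoff (E := E) (F := F) (lam := lam) zero_le_one
  have h2 : MemLp (Function.uncurry fun x y => cutoff 1 x y * wronskian Ψ x y) 2
      (halfLine.prod halfLine) := by
    have h5 := memLp_finsetSum Finset.univ fun i (_ : i ∈ Finset.univ) =>
      memLp_cutoff_mul one_pos (h.memLp_J_apply i) (h.memLp_apply i)
    refine h5.ae_eq (Eventually.of_forall fun z => ?_)
    simp only [Function.uncurry, wronskian, dotProduct, Finset.mul_sum]
  refine (h1.add h2).ae_eq (Eventually.of_forall fun z => ?_)
  simp [Function.uncurry]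

/-- The difference is supported in the strip |x - y| ≤ δ, so its Hilbert-Schmidt norm is O(√δ). The
constant is expressed through ‖f‖ because that norm is continuous along an analytic family. -/
lemma norm_sub_cutoff_le (h : IsTame C Ψ) (hδ : 0 < δ)
    {f : Lp (Fin m ⊕ Fin m → ℂ) 2 halfLine} (hf : f =ᵐ[halfLine] Ψ) {K : L2 →L[ℂ] L2}
    (hK : HasKernel K (kernel E F lam Ψ)) :
    ‖K - cutoffWronskianOperator hδ f‖ ≤
      √(2 * δ) * ((Fintype.card (Fin m ⊕ Fin m)) ^ 2 * (C * ((1 + C) * ‖f‖ ^ 2))) := by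
  have hm : mass Ψ = ‖f‖ ^ 2 := by
    have h1 : ENNReal.ofReal (‖f‖ ^ 2) = ENNReal.ofReal (mass Ψ) := by
      rw [ENNReal.ofReal_pow (norm_nonneg _), ofReal_norm, Lp.enorm_def, eLpNorm_two_sq,
        ofReal_integral_eq_lintegral_ofReal h.integrable_norm_sq
          (Eventually.of_forall fun x => by positivity)]
      refine lintegral_congr_ae ?_
      filter_upwards [hf] with x hx
      rw [hx, ENNReal.ofReal_pow (norm_nonneg _), ofReal_norm]
    have h2 := congrArg ENNReal.toReal h1
    rw [ENNReal.toReal_ofReal (by positivity), ENNReal.toReal_ofReal (mass_nonneg Ψ)] at h2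
    exact h2.symm
  have hC := h.nonneg
  have h1 : IsIntegralOperator (K - cutoffWronskianOperator hδ f)
      fun x y => kernel E F lam Ψ x y - cutoff δ x y * wronskian Ψ x y := by
    have h2 : IsIntegralOperator K (kernel E F lam Ψ) := hK
    have h3 := h2.add ((isIntegralOperator_cutoffWronskian hδ hf).const_smul (-1))
    simpa only [neg_smul, one_smul, neg_mul, one_mul, ← sub_eq_add_neg] using h3
  rw [← hm]
  exact h1.norm_le (h.memLp_kernel_sub_cutoff hδ.le) (by have := mass_nonneg Ψ; positivity)
    (h.lintegral_kernel_sub_cutoff_le hδ.le)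

end IsTame

/-! ### Hilbert-Schmidt operators with integrable kernels -/

/-- L² is separable, and the balls of radius 1/2 about the basis vectors are disjoint, the vectors
being at mutual distance √2. Bases have arbitrary index types, and almost everywhere arguments need
countable ones. -/
lemma countable_of_hilbertBasis {ι : Type*} (b : HilbertBasis ι ℂ L2) : Countable ι := by
  have h2 : Fact ((2 : ENNReal) ≠ ⊤) := ⟨by norm_num⟩
  have hd : Pairwise (Function.onFun Disjoint fun i => Metric.ball (b i) 2⁻¹) := by
    intro i j hij
    refine Metric.ball_disjoint_ball ?_
    rw [dist_eq_norm]
    refine (sq_le_sq₀ (by norm_num) (norm_nonneg _)).1 ?_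
    have h := norm_sub_sq (𝕜 := ℂ) (b i) (b j)
    rw [b.orthonormal.2 hij, b.orthonormal.1 i, b.orthonormal.1 j] at h
    rw [h]
    norm_num
  exact hd.countable_of_isOpen_disjoint (fun i => Metric.isOpen_ball)
    fun i => Metric.nonempty_ball.2 (by norm_num)

lemma isHilbertSchmidt_of_memLp {T : L2 →L[ℂ] L2} {k : ℝ → ℝ → ℂ} (hT : HasKernel T k)
    (hk : MemLp (Function.uncurry k) 2 (halfLine.prod halfLine)) : IsHilbertSchmidt T := by
  intro ι b
  have := countable_of_hilbertBasis b
  have hT' : IsIntegralOperator T k := hT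
  have h := hT'.tsum_enorm_sq hk b
  have h2 : ∑' i, ENNReal.ofReal (‖T (b i)‖ ^ 2) ≠ ⊤ := by
    simp only [ENNReal.ofReal_pow (norm_nonneg _), ofReal_norm]
    rw [h, ← eLpNorm_two_sq]
    exact (ENNReal.pow_lt_top hk.2).ne
  have h3 := ENNReal.summable_toReal h2
  refine h3.congr fun i => ?_
  rw [ENNReal.toReal_ofReal (by positivity)]

lemma memLp_comp_add {k : ℝ → ℝ → ℂ} (hk : MemLp (Function.uncurry k) 2 (halfLine.prod halfLine))
    {t : ℝ} (ht : 0 ≤ t) :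
    MemLp (Function.uncurry fun x y => k (x + t) (y + t)) 2 (halfLine.prod halfLine) := by
  have hs : MeasurableSet (Ioi (0 : ℝ) ×ˢ Ioi (0 : ℝ)) := measurableSet_Ioi.prod measurableSet_Ioi
  have h1 : MemLp ((Ioi (0 : ℝ) ×ˢ Ioi (0 : ℝ)).indicator (Function.uncurry k)) 2
      ((volume : Measure ℝ).prod volume) := by
    rw [memLp_indicator_iff_restrict hs, ← Measure.prod_restrict]
    exact hk
  have h2 := h1.comp_measurePreserving ((measurePreserving_add_right volume t).prod
    (measurePreserving_add_right volume t))
  have h3 := h2.restrict (Ioi (0 : ℝ) ×ˢ Ioi (0 : ℝ))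
  rw [← Measure.prod_restrict] at h3
  refine h3.ae_eq ?_
  filter_upwards [ae_pos_prod] with z hz
  rw [Function.comp_apply, Prod.map_apply, indicator_of_mem]
  · rfl
  · exact ⟨by simp only [mem_Ioi]; linarith [hz.1], by simp only [mem_Ioi]; linarith [hz.2]⟩

lemma measurable_indicator_Ioi {f : ℝ → ℂ} (hf : ContinuousOn f (Ioi 0)) :
    Measurable ((Ioi (0 : ℝ)).indicator f) := by
  classical
  rw [← piecewise_eq_indicator]
  exact hf.measurable_piecewise continuousOn_const measurableSet_Ioi

/-- The ψ_j and ξ_j are the components of JΨ and Ψ. They are cut off to the half line because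
measurability is required on all of ℝ, where nothing is known about Ψ; the vanishing sum is
skew-symmetry of J. -/
lemma IsTame.isIntegrableKernel (h : IsTame C Ψ) {t : ℝ} (ht : 0 ≤ t) :
    IsIntegrableKernel fun x y => kernel E F lam Ψ (x + t) (y + t) := by
  let e := Fintype.equivFin (Fin m ⊕ Fin m)
  have hpos : ∀ x > 0, x + t ∈ Ioi (0 : ℝ) := fun x hx => by
    simp only [mem_Ioi] at hx ⊢
    linarith
  have hc : ContinuousOn (fun x => Ψ (x + t)) (Ioi 0) :=
    h.continuousOn.comp (continuous_add_const t).continuousOn hpos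
  have hcJ : ContinuousOn (fun x => Matrix.J (Fin m) ℂ *ᵥ Ψ (x + t)) (Ioi 0) :=
    (continuous_const.matrix_mulVec continuous_id).comp_continuousOn hc
  refine ⟨Fintype.card (Fin m ⊕ Fin m),
    fun j => (Ioi (0 : ℝ)).indicator fun x => (Matrix.J (Fin m) ℂ *ᵥ Ψ (x + t)) (e.symm j),
    fun j => (Ioi (0 : ℝ)).indicator fun x => Ψ (x + t) (e.symm j), fun j => ⟨?_, ?_⟩, ?_, ?_, ?_⟩
  · exact measurable_indicator_Ioi (continuousOn_pi.1 hcJ _)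
  · exact measurable_indicator_Ioi (continuousOn_pi.1 hc _)
  · intro S hS hSc
    obtain ⟨B₁, h1⟩ := hSc.exists_bound_of_continuousOn (hc.mono hS)
    obtain ⟨B₂, h2⟩ := hSc.exists_bound_of_continuousOn (hcJ.mono hS)
    refine ⟨max B₁ B₂, fun j x hx => ?_⟩
    simp only [indicator_of_mem (hS hx)]
    exact ⟨(norm_le_pi_norm _ _).trans ((h2 x hx).trans (le_max_right _ _)),
      (norm_le_pi_norm _ _).trans ((h1 x hx).trans (le_max_left _ _))⟩
  · intro x hx y hy hxy
    have hxy' : x + t ≠ y + t := by simpa using hxy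
    simp only [kernel_of_ne hxy', wronskian, dotProduct, indicator_of_mem (mem_Ioi.2 hx), indicator_of_mem (mem_Ioi.2 hy)]
    rw [e.symm.sum_comp fun i => (Matrix.J (Fin m) ℂ *ᵥ Ψ (x + t)) i * Ψ (y + t) i]
    push_cast
    rw [add_sub_add_right_eq_sub]
  · intro x hx
    simp only [indicator_of_mem (mem_Ioi.2 hx)]
    rw [e.symm.sum_comp fun i => (Matrix.J (Fin m) ℂ *ᵥ Ψ (x + t)) i * Ψ (x + t) i]
    exact J_mulVec_dotProduct_self _

end HamKernel

namespace HamKernel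

variable {m : ℕ} {E F : ℝ → Matrix (Fin m ⊕ Fin m) (Fin m ⊕ Fin m) ℝ} {lam : ℂ}
  {Ψ : ℝ → Fin m ⊕ Fin m → ℂ} {C δ : ℝ}

/-! ### The operators `K_λ` and their analytic dependence on `λ` -/

lemma IsTame.exists_hasKernel (h : IsTame C Ψ) :
    ∃ K : L2 →L[ℂ] L2, HasKernel K (kernel E F lam Ψ) :=
  exists_isIntegralOperator h.memLp_kernel

lemma IsTame.isHilbertSchmidt_shifted (h : IsTame C Ψ) {K : L2 →L[ℂ] L2}
    (hK : HasKernel K (kernel E F lam Ψ)) {t : ℝ} (ht : 0 ≤ t) : IsHilbertSchmidt (shifted K t) :=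
  isHilbertSchmidt_of_memLp (hK.shifted ht) (memLp_comp_add h.memLp_kernel ht)

lemma kernel_comm (x y : ℝ) : kernel E F lam Ψ x y = kernel E F lam Ψ y x := by
  by_cases hxy : x = y
  · rw [hxy]
  · rw [kernel_of_ne hxy, kernel_of_ne (Ne.symm hxy), wronskian, J_mulVec_dotProduct,
      dotProduct_comm, ← wronskian, neg_div, ← div_neg, neg_sub]

lemma conj_dotProduct_of_real {ι : Type*} [Fintype ι] {u v : ι → ℂ} (hu : ∀ i, (u i).im = 0)
    (hv : ∀ i, (v i).im = 0) : conj (u ⬝ᵥ v) = u ⬝ᵥ v := by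
  simp only [dotProduct, map_sum, map_mul, Complex.conj_eq_iff_im.2 (hu _),
    Complex.conj_eq_iff_im.2 (hv _)]

lemma im_mulVec_of_real {ι : Type*} [Fintype ι] {A : Matrix ι ι ℂ} {v : ι → ℂ}
    (hA : ∀ i j, (A i j).im = 0) (hv : ∀ i, (v i).im = 0) (i : ι) : ((A *ᵥ v) i).im = 0 :=
  Complex.conj_eq_iff_im.1 (conj_dotProduct_of_real (hA i) hv)

lemma im_J (i j : Fin m ⊕ Fin m) : (Matrix.J (Fin m) ℂ i j).im = 0 := by
  rcases i with i | i <;> rcases j with j | j <;>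
    simp [Matrix.J, Matrix.one_apply] <;> split_ifs <;> simp

lemma conj_kernel_of_ne (hΨ : IsRealValued Ψ) {x y : ℝ} (hx : 0 < x) (hy : 0 < y) (hxy : x ≠ y) :
    conj (kernel E F lam Ψ x y) = kernel E F lam Ψ x y := by
  rw [kernel_of_ne hxy, map_div₀, wronskian,
    conj_dotProduct_of_real (im_mulVec_of_real im_J (hΨ x hx)) (hΨ y hy), ← Complex.ofReal_sub,
    Complex.conj_ofReal]

lemma IsTame.isSelfAdjoint (h : IsTame C Ψ) (hΨ : IsRealValued Ψ) {K : L2 →L[ℂ] L2}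
    (hK : HasKernel K (kernel E F lam Ψ)) : IsSelfAdjoint K := by
  rw [ContinuousLinearMap.isSelfAdjoint_iff']
  have h1 : IsIntegralOperator K (kernel E F lam Ψ) := hK
  refine (h1.adjoint h.memLp_kernel).ext h1 ?_
  filter_upwards [ae_restrict_mem measurableSet_Ioi] with x hx
  filter_upwards [ae_restrict_mem measurableSet_Ioi, Measure.ae_ne halfLine x] with y hy hyx
  rw [conj_kernel_of_ne hΨ hy hx hyx, kernel_comm]

lemma shifted_adjoint (K : L2 →L[ℂ] L2) (t : ℝ) :
    ContinuousLinearMap.adjoint (shifted K t) = shifted (ContinuousLinearMap.adjoint K) t := by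
  simp only [shifted, ContinuousLinearMap.adjoint_comp, ContinuousLinearMap.adjoint_adjoint,
    ContinuousLinearMap.comp_assoc]

/-- The operators cut off at width 1/(n+1) are bounded quadratic expressions in the L² element G λ,
hence holomorphic. They converge to K locally uniformly in operator norm, so the Weierstrass theorem
applies. -/
lemma differentiableOn_of_hasKernel (hE : IsCoefficient E) (hF : IsCoefficient F) {D : Set ℂ}
    (hD : IsOpen D) {Ψ : ℂ → ℝ → Fin m ⊕ Fin m → ℂ}
    (hΨ : ∀ lam ∈ D, IsBoundedL2Solution E F lam (Ψ lam)) (hA : IsAnalyticFamily D Ψ)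
    {K : ℂ → L2 →L[ℂ] L2} (hK : ∀ lam ∈ D, HasKernel (K lam) (kernel E F lam (Ψ lam))) :
    DifferentiableOn ℂ K D := by
  obtain ⟨G, hG, hGΨ⟩ := hA
  obtain ⟨c, hc, htame⟩ := exists_isTame hE hF
  have hpos : ∀ n : ℕ, (0 : ℝ) < 1 / ((n : ℝ) + 1) := fun n => Nat.one_div_pos_of_nat
  let Kn : ℕ → ℂ → L2 →L[ℂ] L2 := fun n lam => cutoffWronskianOperator (hpos n) (G lam)
  have hlim : TendstoLocallyUniformlyOn Kn K atTop D := by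
    rw [Metric.tendstoLocallyUniformlyOn_iff]
    intro η hη z hz
    -- The constant of `norm_sub_cutoff_le` apart from √(2δ); being continuous in λ, it stays below
    -- B z + 1 near z.
    let B : ℂ → ℝ := fun lam => (Fintype.card (Fin m ⊕ Fin m)) ^ 2 *
      ((c * (1 + ‖lam‖)) * ((1 + c * (1 + ‖lam‖)) * ‖G lam‖ ^ 2))
    have hB : ContinuousOn B D := by
      have h1 := hG.continuousOn.norm
      have h2 : ContinuousOn (fun lam : ℂ => ‖lam‖) D := continuous_norm.continuousOn
      fun_prop
    have hB1 : ∀ᶠ lam in 𝓝[D] z, B lam < B z + 1 :=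
      (hB z hz).eventually (gt_mem_nhds (lt_add_one _))
    have hBz : 0 < B z + 1 := by positivity
    refine ⟨{lam | B lam < B z + 1} ∩ D, inter_mem hB1 self_mem_nhdsWithin, ?_⟩
    have hs : Tendsto (fun n : ℕ => √(2 * (1 / ((n : ℝ) + 1))) * (B z + 1)) atTop (𝓝 0) := by
      have := ((tendsto_one_div_add_atTop_nhds_zero_nat (𝕜 := ℝ)).const_mul 2).sqrt.mul_const
        (B z + 1)
      simpa using this
    filter_upwards [hs.eventually (gt_mem_nhds hη)] with n hn lam hlam
    rw [dist_eq_norm]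
    refine lt_of_le_of_lt ?_ hn
    refine ((htame lam _ (hΨ lam hlam.2)).norm_sub_cutoff_le (hpos n) (hGΨ lam hlam.2)
      (hK lam hlam.2)).trans ?_
    gcongr
    exact hlam.1.le
  exact hlim.differentiableOn (Eventually.of_forall fun n =>
    (differentiable_cutoffWronskianOperator (hpos n)).comp_differentiableOn hG) hD

/-- The function z ↦ K(conj z)† is holomorphic on the symmetric set D and equals K on the positive
reals, where K is self-adjoint. These accumulate at 1, and D is connected. -/
lemma eq_adjoint_of_hasKernel (hE : IsCoefficient E) (hF : IsCoefficient F) {D : Set ℂ}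
    (hD : IsOpen D) (hDc : IsConnected D) (hDs : ∀ lam ∈ D, conj lam ∈ D)
    (hDp : ∀ lam : ℝ, 0 < lam → (lam : ℂ) ∈ D) {Ψ : ℂ → ℝ → Fin m ⊕ Fin m → ℂ}
    (hΨ : ∀ lam ∈ D, IsBoundedL2Solution E F lam (Ψ lam))
    (hreal : ∀ lam : ℝ, 0 < lam → IsRealValued (Ψ lam))
    {K : ℂ → L2 →L[ℂ] L2} (hK : ∀ lam ∈ D, HasKernel (K lam) (kernel E F lam (Ψ lam)))
    (hKd : DifferentiableOn ℂ K D) {lam : ℂ} (hlam : lam ∈ D) :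
    K (conj lam) = ContinuousLinearMap.adjoint (K lam) := by
  obtain ⟨c, hc, htame⟩ := exists_isTame hE hF
  have h1 : DifferentiableOn ℂ (fun z => star (K (conj z))) D := by
    intro z hz
    have h2 := (hKd (conj z) (hDs z hz)).differentiableAt (hD.mem_nhds (hDs z hz))
    have h3 := h2.hasDerivAt.star_conj
    rw [Complex.conj_conj] at h3
    exact h3.differentiableAt.differentiableWithinAt
  have h4 : ∃ᶠ z in 𝓝[≠] (1 : ℂ), star (K (conj z)) = K z := by
    have h5 : Tendsto (fun r : ℝ => (r : ℂ)) (𝓝[≠] 1) (𝓝[≠] 1) := by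
      refine tendsto_nhdsWithin_of_tendsto_nhds_of_eventually_within _ ?_ ?_
      · have := Complex.continuous_ofReal.tendsto 1
        rw [Complex.ofReal_one] at this
        exact this.mono_left nhdsWithin_le_nhds
      · filter_upwards [self_mem_nhdsWithin] with r hr
        simpa using hr
    refine h5.frequently (Eventually.frequently ?_)
    filter_upwards [nhdsWithin_le_nhds (lt_mem_nhds (one_pos (α := ℝ)))] with r hr
    rw [Complex.conj_ofReal]
    exact (htame _ _ (hΨ r (hDp r hr))).isSelfAdjoint (hreal r hr) (hK r (hDp r hr))
  have h6 := (h1.analyticOnNhd hD).eqOn_of_preconnected_of_frequently_eq (hKd.analyticOnNhd hD)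
    hDc.isPreconnected (by simpa using hDp 1 one_pos) h4
  have h7 : star (K (conj lam)) = K lam := h6 hlam
  rw [← h7, ← ContinuousLinearMap.star_eq_adjoint, star_star]

/-- Analytic families of solutions give analytic families of operators. -/
theorem analytic_family (hE : IsCoefficient E) (hF : IsCoefficient F) {D : Set ℂ}
    (hD : IsOpen D) (hDc : IsConnected D) (hDs : ∀ lam ∈ D, conj lam ∈ D)
    (hDp : ∀ lam : ℝ, 0 < lam → (lam : ℂ) ∈ D) {Ψ : ℂ → ℝ → Fin m ⊕ Fin m → ℂ}
    (hΨ : ∀ lam ∈ D, IsBoundedL2Solution E F lam (Ψ lam))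
    (hreal : ∀ lam : ℝ, 0 < lam → IsRealValued (Ψ lam)) (hA : IsAnalyticFamily D Ψ) :
    ∃ K : ℂ → L2 →L[ℂ] L2,
      (∀ lam ∈ D, HasKernel (K lam) (kernel E F lam (Ψ lam))) ∧
      ∀ t ≥ 0,
        (∀ lam ∈ D, HasKernel (shifted (K lam) t)
          fun x y => kernel E F lam (Ψ lam) (x + t) (y + t)) ∧
        AnalyticOnNhd ℂ (fun lam => shifted (K lam) t) D ∧
        (∀ lam ∈ D, shifted (K (conj lam)) t =
          ContinuousLinearMap.adjoint (shifted (K lam) t)) ∧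
        (∀ lam ∈ D, IsHilbertSchmidt (shifted (K lam) t)) ∧
        (∀ lam ∈ D, IsIntegrableKernel
          fun x y => kernel E F lam (Ψ lam) (x + t) (y + t)) := by
  obtain ⟨c, hc, htame⟩ := exists_isTame hE hF
  have hex : ∀ lam : ℂ, ∃ K : L2 →L[ℂ] L2, lam ∈ D → HasKernel K (kernel E F lam (Ψ lam)) := by
    intro lam
    by_cases hlam : lam ∈ D
    · obtain ⟨K, hK⟩ := (htame _ _ (hΨ lam hlam)).exists_hasKernel (E := E) (F := F) (lam := lam)
      exact ⟨K, fun _ => hK⟩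
    · exact ⟨0, fun h => absurd h hlam⟩
  choose K hK using hex
  have hKd := differentiableOn_of_hasKernel hE hF hD hΨ hA hK
  refine ⟨K, hK, fun t ht => ⟨fun lam hlam => (hK lam hlam).shifted ht, ?_, fun lam hlam => ?_,
    fun lam hlam => (htame _ _ (hΨ lam hlam)).isHilbertSchmidt_shifted (hK lam hlam) ht,
    fun lam hlam => (htame _ _ (hΨ lam hlam)).isIntegrableKernel ht⟩⟩
  · refine DifferentiableOn.analyticOnNhd ?_ hD
    unfold shifted
    exact (differentiableOn_const _).clm_comp (hKd.clm_comp (differentiableOn_const _))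
  · rw [shifted_adjoint, eq_adjoint_of_hasKernel hE hF hD hDc hDs hDp hΨ hreal hK hKd hlam]

end HamKernel

namespace HamKernel

/-! ### Kernels that accumulate a positive kernel along the diagonal direction -/

/-- `∂ₜ k(x+t,y+t) = ε ℓ(x+t,y+t)` and `k(x+t,y+t) → 0`, with `ℓ(x,y) = ∑ a_i(x) conj a_i(y)`. -/
structure IsCumulative {κ : Type} (a : κ → ℝ → ℂ) (ℓ k : ℝ → ℝ → ℂ) (ε : ℝ) (w : ℝ → ℝ) :
    Prop where
  sq : ε * ε = 1
  continuousOn : ∀ i, ContinuousOn (a i) (Ioi 0)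
  hasSum : ∀ x > 0, ∀ y > 0, HasSum (fun i => a i x * conj (a i y)) (ℓ x y)
  integrable_weight : Integrable w halfLine
  norm_le : ∀ x > 0, ‖ℓ x x‖ ≤ w x
  sub_eq : ∀ x > 0, ∀ y > 0, ∀ T ≥ 0,
    k (x + T) (y + T) - k x y = ε * ∫ s in (0 : ℝ)..T, ℓ (x + s) (y + s)
  tendsto : ∀ x > 0, ∀ y > 0, Tendsto (fun T => k (x + T) (y + T)) atTop (𝓝 0)
  integrable_diag : Integrable (fun x => k x x) halfLine

/-- The kernel `conj a_i(x + s)` of the factor `Γ` in `-ε K = Γ†Γ`, as a function of `(s, i)`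
and `x`. -/
def factorKernel {κ : Type} (a : κ → ℝ → ℂ) (σ : ℝ × κ) (x : ℝ) : ℂ :=
  conj ((Ioi (0 : ℝ)).indicator (a σ.2) (x + σ.1))

lemma hasSum_norm_sq {κ : Type} {a : κ → ℂ} {z : ℂ} (h : HasSum (fun i => a i * conj (a i)) z) :
    HasSum (fun i => ‖a i‖ ^ 2) ‖z‖ := by
  have h1 : HasSum (fun i => ((‖a i‖ ^ 2 : ℝ) : ℂ)) z := by
    refine h.congr_fun fun i => ?_
    rw [Complex.mul_conj, Complex.normSq_eq_norm_sq]
  have h2 := Complex.hasSum_re h1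
  simp only [Complex.ofReal_re] at h2
  have h3 : (z.re : ℂ) = z := (Complex.hasSum_ofReal.2 h2).unique h1
  have h4 : 0 ≤ z.re := h2.nonneg fun i => by positivity
  rw [← h3, Complex.norm_real, Real.norm_of_nonneg h4]
  exact h2

lemma lintegral_halfLine_add (g : ℝ → ENNReal) (t : ℝ) :
    ∫⁻ x, g (x + t) ∂halfLine = ∫⁻ x in Ioi t, g x := by
  have h := (measurePreserving_add_right volume t).setLIntegral_comp_preimage_emb
    (MeasurableEquiv.addRight t).measurableEmbedding g (Ioi t)
  rwa [preimage_add_const_Ioi, sub_self] at h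

lemma abs_of_smul_nonneg {H : Type} [NormedAddCommGroup H] [InnerProductSpace ℂ H]
    [CompleteSpace H] {ε : ℝ} (hε : ε * ε = 1) {T : H →L[ℂ] H} (h0 : 0 ≤ (-(ε : ℂ)) • T) :
    CFC.abs T = (-(ε : ℂ)) • T := by
  rcases mul_self_eq_one_iff.1 hε with h1 | h1
  · rw [h1] at h0 ⊢
    rw [Complex.ofReal_one, neg_smul, one_smul] at h0 ⊢
    exact CFC.abs_of_nonpos _ (neg_nonneg.1 h0)
  · rw [h1] at h0 ⊢
    rw [Complex.ofReal_neg, Complex.ofReal_one, neg_neg, one_smul] at h0 ⊢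
    exact CFC.abs_of_nonneg _ h0

namespace IsCumulative

variable {κ : Type} [Countable κ] {a : κ → ℝ → ℂ} {ℓ k : ℝ → ℝ → ℂ}
  {ε : ℝ} {w : ℝ → ℝ} {K : L2 →L[ℂ] L2}

omit [Countable κ] in
lemma factorKernel_of_pos {x : ℝ} {σ : ℝ × κ} (hx : 0 < x + σ.1) :
    factorKernel a σ x = conj (a σ.2 (x + σ.1)) := by
  rw [factorKernel, indicator_of_mem (mem_Ioi.2 hx)]

omit [Countable κ] in
lemma smul_smul_self (h : IsCumulative a ℓ k ε w) (T : L2 →L[ℂ] L2) :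
    (-(ε : ℂ)) • (-(ε : ℂ)) • T = T := by
  have h4 : (ε : ℂ) * ε = 1 := by exact_mod_cast h.sq
  rw [smul_smul, neg_mul_neg, h4, one_smul]

/-! ### The factorization -ε K_t = Γ†Γ through L² of (0,∞) × κ, and its consequences. -/

section Measure

variable [MeasurableSpace κ] [DiscreteMeasurableSpace κ]

lemma measurable_factorKernel (h : IsCumulative a ℓ k ε w) :
    Measurable fun z : (ℝ × κ) × ℝ => factorKernel a z.1 z.2 := by
  have h1 : Measurable fun z : (ℝ × ℝ) × κ =>
      conj ((Ioi (0 : ℝ)).indicator (a z.2) (z.1.2 + z.1.1)) := by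
    refine measurable_from_prod_countable_left fun i => ?_
    exact Complex.continuous_conj.measurable.comp
      ((measurable_indicator_Ioi (h.continuousOn i)).comp (measurable_snd.add measurable_fst))
  exact h1.comp (((measurable_fst.comp measurable_fst).prodMk measurable_snd).prodMk
    (measurable_snd.comp measurable_fst))

lemma lintegral_factorKernel (h : IsCumulative a ℓ k ε w) {x : ℝ} (hx : 0 < x) :
    ∫⁻ σ, ‖factorKernel a σ x‖ₑ ^ 2 ∂(halfLine.prod Measure.count) =
      ∫⁻ s, ‖ℓ (x + s) (x + s)‖ₑ ∂halfLine := by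
  have hm : Measurable fun σ : ℝ × κ => factorKernel a σ x :=
    h.measurable_factorKernel.comp (measurable_id.prodMk measurable_const)
  rw [lintegral_prod _ (hm.enorm.pow_const 2).aemeasurable]
  refine lintegral_congr_ae ?_
  filter_upwards [ae_restrict_mem measurableSet_Ioi] with s hs
  have hxs : 0 < x + s := add_pos hx hs
  have h1 := hasSum_norm_sq (h.hasSum _ hxs _ hxs)
  rw [lintegral_count, ← ofReal_norm, ← h1.tsum_eq,
    ENNReal.ofReal_tsum_of_nonneg (fun i => by positivity) h1.summable]
  refine tsum_congr fun i => ?_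
  rw [factorKernel_of_pos hxs, RCLike.enorm_conj, ENNReal.ofReal_pow (norm_nonneg _), ofReal_norm]

/-- The integrable majorant w makes ∫ ℓ(x+s, x+s) ds finite. Through Cauchy-Schwarz this also
justifies the off-diagonal integrals in `integral_factorKernel`. -/
lemma memLp_factorKernel (h : IsCumulative a ℓ k ε w) {x : ℝ} (hx : 0 < x) :
    MemLp (fun σ => factorKernel a σ x) 2 (halfLine.prod Measure.count) := by
  refine memLp_two_of_lintegral_lt_top
    (h.measurable_factorKernel.comp (measurable_id.prodMk measurable_const)).aestronglyMeasurable ?_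
  rw [h.lintegral_factorKernel hx]
  have h1 : ∫⁻ s, ‖ℓ (x + s) (x + s)‖ₑ ∂halfLine ≤ ∫⁻ s, ‖w (x + s)‖ₑ ∂halfLine := by
    refine lintegral_mono_ae ?_
    filter_upwards [ae_restrict_mem measurableSet_Ioi] with s hs
    rw [← ofReal_norm, ← ofReal_norm]
    exact ENNReal.ofReal_le_ofReal ((h.norm_le _ (add_pos hx hs)).trans (Real.le_norm_self _))
  refine h1.trans_lt ?_
  have h2 : ∫⁻ s, ‖w (x + s)‖ₑ ∂halfLine = ∫⁻ s in Ioi x, ‖w s‖ₑ := by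
    simp only [add_comm x]
    exact lintegral_halfLine_add (fun s => ‖w s‖ₑ) x
  rw [h2]
  exact (lintegral_mono_set (Ioi_subset_Ioi hx.le)).trans_lt h.integrable_weight.2

/-- Summing over i leaves ℓ(x+s, y+s). By the cumulative property ε ∫₀ᵀ ℓ(x+s, y+s) ds = k(x+T, y+T)
- k(x,y), which tends to -k(x,y); multiply by ε and use ε² = 1. -/
lemma integral_factorKernel (h : IsCumulative a ℓ k ε w) {x y : ℝ} (hx : 0 < x) (hy : 0 < y) :
    ∫ σ, conj (factorKernel a σ x) * factorKernel a σ y ∂(halfLine.prod Measure.count) =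
      -(ε * k x y) := by
  have hi : Integrable (fun σ : ℝ × κ => conj (factorKernel a σ x) * factorKernel a σ y)
      (halfLine.prod Measure.count) :=
    (h.memLp_factorKernel hx).star.integrable_mul (h.memLp_factorKernel hy)
  have hin : ∀ᵐ s ∂halfLine, ∫ i, conj (factorKernel a (s, i) x) * factorKernel a (s, i) y
      ∂Measure.count = ℓ (x + s) (y + s) := by
    filter_upwards [ae_restrict_mem measurableSet_Ioi, hi.prod_right_ae] with s hs h1
    rw [integral_countable h1, ← (h.hasSum _ (add_pos hx hs) _ (add_pos hy hs)).tsum_eq]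
    refine tsum_congr fun i => ?_
    rw [factorKernel_of_pos (σ := (s, i)) (add_pos hx hs),
      factorKernel_of_pos (σ := (s, i)) (add_pos hy hs)]
    simp
  have hint : Integrable (fun s => ℓ (x + s) (y + s)) halfLine := hi.integral_prod_left.congr hin
  rw [integral_prod _ hi, integral_congr_ae hin]
  have h1 := (intervalIntegral_tendsto_integral_Ioi 0 hint tendsto_id).const_mul (ε : ℂ)
  have h2 : Tendsto (fun T : ℝ => (ε : ℂ) * ∫ s in (0 : ℝ)..T, ℓ (x + s) (y + s)) atTop
      (𝓝 (0 - k x y)) := by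
    refine ((h.tendsto x hx y hy).sub_const (k x y)).congr' ?_
    filter_upwards [eventually_ge_atTop 0] with T hT
    exact h.sub_eq x hx y hy T hT
  have h3 := tendsto_nhds_unique h1 h2
  have h4 : (ε : ℂ) * ε = 1 := by exact_mod_cast h.sq
  calc ∫ s, ℓ (x + s) (y + s) ∂halfLine
      = ε * (ε * ∫ s, ℓ (x + s) (y + s) ∂halfLine) := by rw [← mul_assoc, h4, one_mul]
    _ = -(ε * k x y) := by rw [h3]; ring

lemma ofReal_lintegral_factorKernel (h : IsCumulative a ℓ k ε w) {x : ℝ} (hx : 0 < x) :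
    ((∫⁻ σ, ‖factorKernel a σ x‖ₑ ^ 2 ∂(halfLine.prod Measure.count)).toReal : ℂ) =
      -(ε * k x x) := by
  rw [← h.integral_factorKernel hx hx]
  have h1 : ∀ σ, conj (factorKernel a σ x) * factorKernel a σ x =
      ((‖factorKernel a σ x‖ ^ 2 : ℝ) : ℂ) := fun σ => by
    rw [mul_comm, Complex.mul_conj, Complex.normSq_eq_norm_sq]
  simp only [h1]
  rw [integral_complex_ofReal, integral_eq_lintegral_of_nonneg_ae]
  · congr 3 with σ
    rw [ENNReal.ofReal_pow (norm_nonneg _), ofReal_norm]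
  · exact Eventually.of_forall fun σ => by positivity
  · exact ((h.memLp_factorKernel hx).1.norm.pow 2)

lemma lintegral_factorKernel_eq (h : IsCumulative a ℓ k ε w) {x : ℝ} (hx : 0 < x) :
    ∫⁻ σ, ‖factorKernel a σ x‖ₑ ^ 2 ∂(halfLine.prod Measure.count) = ‖k x x‖ₑ := by
  have h1 : ∫⁻ σ, ‖factorKernel a σ x‖ₑ ^ 2 ∂(halfLine.prod Measure.count) ≠ ⊤ := by
    rw [← eLpNorm_two_sq]
    exact (ENNReal.pow_lt_top (h.memLp_factorKernel hx).2).ne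
  have h2 := congrArg norm (h.ofReal_lintegral_factorKernel hx)
  have h3 : ‖(ε : ℂ)‖ = 1 := by
    rcases mul_self_eq_one_iff.1 h.sq with h1 | h1 <;> simp [h1]
  rw [norm_neg, norm_mul, h3, one_mul, Complex.norm_real,
    Real.norm_of_nonneg ENNReal.toReal_nonneg] at h2
  rw [← ofReal_norm, ← h2, ENNReal.ofReal_toReal h1]

/-- By Tonelli the squared Hilbert-Schmidt norm of the factor at time t is a tail integral of the
diagonal. The trace formula and the decay of ‖K_t‖ both come from this. -/
lemma lintegral_factorKernel_prod (h : IsCumulative a ℓ k ε w) {t : ℝ} (ht : 0 ≤ t) :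
    ∫⁻ z, ‖Function.uncurry (fun σ x => factorKernel a σ (x + t)) z‖ₑ ^ 2
      ∂((halfLine.prod Measure.count).prod halfLine) = ∫⁻ x in Ioi t, ‖k x x‖ₑ := by
  have hm : Measurable fun z : (ℝ × κ) × ℝ => factorKernel a z.1 (z.2 + t) :=
    h.measurable_factorKernel.comp
      (f := fun z : (ℝ × κ) × ℝ => (z.1, z.2 + t)) (by fun_prop)
  have h1 := lintegral_prod_symm (μ := halfLine.prod (Measure.count (α := κ))) (ν := halfLine)
    (fun z => ‖factorKernel a z.1 (z.2 + t)‖ₑ ^ 2) (hm.enorm.pow_const 2).aemeasurable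
  rw [← lintegral_halfLine_add (fun x => ‖k x x‖ₑ) t]
  refine h1.trans (lintegral_congr_ae ?_)
  filter_upwards [ae_restrict_mem measurableSet_Ioi] with x hx
  exact h.lintegral_factorKernel_eq (add_pos_of_pos_of_nonneg hx ht)

lemma memLp_factorKernel_prod (h : IsCumulative a ℓ k ε w) {t : ℝ} (ht : 0 ≤ t) :
    MemLp (Function.uncurry fun σ x => factorKernel a σ (x + t)) 2
      ((halfLine.prod Measure.count).prod halfLine) := by
  refine memLp_two_of_lintegral_lt_top (h.measurable_factorKernel.comp
    (measurable_fst.prodMk (measurable_snd.add_const t))).aestronglyMeasurable ?_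
  rw [h.lintegral_factorKernel_prod ht]
  exact (lintegral_mono_set (Ioi_subset_Ioi ht)).trans_lt h.integrable_diag.2

lemma exists_factor (h : IsCumulative a ℓ k ε w) (hK : HasKernel K k) {t : ℝ} (ht : 0 ≤ t) :
    ∃ Γ : L2 →L[ℂ] Lp ℂ 2 (halfLine.prod (Measure.count (α := κ))),
      IsIntegralOperator Γ (fun σ x => factorKernel a σ (x + t)) ∧
      (-(ε : ℂ)) • shifted K t = (ContinuousLinearMap.adjoint Γ).comp Γ := by
  obtain ⟨Γ, hΓ⟩ := exists_isIntegralOperator (h.memLp_factorKernel_prod ht)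
  refine ⟨Γ, hΓ, ?_⟩
  have h1 : IsIntegralOperator (shifted K t) fun x y => k (x + t) (y + t) := hK.shifted ht
  refine (h1.const_smul _).ext (hΓ.adjoint_comp_self (h.memLp_factorKernel_prod ht)) ?_
  filter_upwards [ae_restrict_mem measurableSet_Ioi] with x hx
  filter_upwards [ae_restrict_mem measurableSet_Ioi] with y hy
  rw [h.integral_factorKernel (add_pos_of_pos_of_nonneg hx ht) (add_pos_of_pos_of_nonneg hy ht),
    neg_mul]

omit [DiscreteMeasurableSpace κ] in
-- The kernel depends on x and s only through x + s, so a shift by t in x is a shift by t in s.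
-- Hence ‖Γ_t f‖² is the integral over u > t of a density φ that does not depend on t.
lemma norm_factor_apply_le {s t : ℝ} (hst : s ≤ t)
    {Γs Γt : L2 →L[ℂ] Lp ℂ 2 (halfLine.prod (Measure.count (α := κ)))}
    (hs : IsIntegralOperator Γs (fun σ x => factorKernel a σ (x + s)))
    (ht : IsIntegralOperator Γt (fun σ x => factorKernel a σ (x + t))) (f : L2) :
    ‖Γt f‖ ≤ ‖Γs f‖ := by
  let φ : ℝ → ENNReal := fun r => ∫⁻ i : κ, ‖∫ x, factorKernel a (r, i) x * f x ∂halfLine‖ₑ ^ 2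
    ∂Measure.count
  have key : ∀ {r : ℝ} {Γ : L2 →L[ℂ] Lp ℂ 2 (halfLine.prod (Measure.count (α := κ)))},
      IsIntegralOperator Γ (fun σ x => factorKernel a σ (x + r)) →
      ‖Γ f‖ₑ ^ 2 = ∫⁻ u in Ioi r, φ u := by
    intro r Γ hΓ
    have e : (fun σ => ‖Γ f σ‖ₑ ^ 2) =ᵐ[halfLine.prod Measure.count]
        fun σ => ‖∫ x, factorKernel a σ (x + r) * f x ∂halfLine‖ₑ ^ 2 := by
      filter_upwards [hΓ f] with σ hσ
      rw [hσ.2]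
    have hm := ((Lp.aestronglyMeasurable (Γ f)).enorm.pow_const 2).congr e
    rw [enorm_sq_eq_lintegral, lintegral_congr_ae e, lintegral_prod _ hm,
      ← lintegral_halfLine_add φ r]
    simp only [φ, factorKernel]
    refine lintegral_congr fun u => lintegral_congr fun i => ?_
    congr 3 with x
    rw [add_right_comm, add_assoc]
  have h1 : ‖Γt f‖ₑ ^ 2 ≤ ‖Γs f‖ₑ ^ 2 := by
    rw [key hs, key ht]
    exact lintegral_mono_set (Ioi_subset_Ioi hst)
  have h2 := (ENNReal.pow_le_pow_left_iff (by norm_num)).1 h1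
  simpa using ENNReal.toReal_mono enorm_ne_top h2

lemma antitoneOn_of_measure (h : IsCumulative a ℓ k ε w) (hK : HasKernel K k) :
    AntitoneOn (fun s => (-(ε : ℂ)) • shifted K s) (Ici 0) := by
  intro s hs t ht hst
  obtain ⟨Γs, hs1, hs2⟩ := h.exists_factor hK hs
  obtain ⟨Γt, ht1, ht2⟩ := h.exists_factor hK ht
  simp only [hs2, ht2]
  rw [ContinuousLinearMap.le_def, ContinuousLinearMap.isPositive_def']
  refine ⟨(ContinuousLinearMap.isPositive_adjoint_comp_self Γs).isSelfAdjoint.sub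
    (ContinuousLinearMap.isPositive_adjoint_comp_self Γt).isSelfAdjoint, fun f => ?_⟩
  have h1 := norm_factor_apply_le hst hs1 ht1 f
  rw [ContinuousLinearMap.reApplyInnerSelf_apply, sub_apply, inner_sub_left,
    ContinuousLinearMap.comp_apply, ContinuousLinearMap.comp_apply,
    ContinuousLinearMap.adjoint_inner_left, ContinuousLinearMap.adjoint_inner_left, map_sub,
    inner_self_eq_norm_sq, inner_self_eq_norm_sq, sub_nonneg]
  gcongr

lemma nonneg_of_measure (h : IsCumulative a ℓ k ε w) (hK : HasKernel K k) {t : ℝ} (ht : 0 ≤ t) :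
    0 ≤ (-(ε : ℂ)) • shifted K t := by
  obtain ⟨Γ, _, h2⟩ := h.exists_factor hK ht
  rw [h2, ContinuousLinearMap.nonneg_iff_isPositive]
  exact ContinuousLinearMap.isPositive_adjoint_comp_self Γ

lemma norm_smul_le_of_measure (h : IsCumulative a ℓ k ε w) (hK : HasKernel K k) {t : ℝ}
    (ht : 0 ≤ t) : ‖(-(ε : ℂ)) • shifted K t‖ ≤ ∫ x in Ioi t, ‖k x x‖ := by
  obtain ⟨Γ, h1, h2⟩ := h.exists_factor hK ht
  have h0 : 0 ≤ ∫ x in Ioi t, ‖k x x‖ := integral_nonneg fun _ => norm_nonneg _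
  have h3 : ‖Γ‖ ≤ √(∫ x in Ioi t, ‖k x x‖) := by
    refine h1.norm_le (h.memLp_factorKernel_prod ht) (Real.sqrt_nonneg _) ?_
    rw [h.lintegral_factorKernel_prod ht, Real.sq_sqrt h0, ofReal_integral_norm_eq_lintegral_enorm]
    exact IntegrableOn.mono_set h.integrable_diag (Ioi_subset_Ioi ht)
  rw [h2, ContinuousLinearMap.norm_adjoint_comp_self, ← Real.mul_self_sqrt h0]
  gcongr

/-- One has ⟨eᵢ, -ε K_t eᵢ⟩ = ‖Γ eᵢ‖², and these add up to the squared Hilbert-Schmidt norm of Γ. As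
|K_t| = -ε K_t, the trace and the trace class condition involve the same series up to sign. -/
lemma hasTrace_of_measure (h : IsCumulative a ℓ k ε w) (hK : HasKernel K k) {t : ℝ} (ht : 0 ≤ t) :
    HasTrace (shifted K t) (∫ x in Ioi t, k x x) := by
  obtain ⟨Γ, h1, h2⟩ := h.exists_factor hK ht
  have hsum : ∀ (ι : Type) (b : HilbertBasis ι ℂ L2),
      HasSum (fun i => ‖Γ (b i)‖ ^ 2) (∫⁻ x in Ioi t, ‖k x x‖ₑ).toReal := by
    intro ι b
    have := countable_of_hilbertBasis b
    have h3 := h1.tsum_enorm_sq (h.memLp_factorKernel_prod ht) b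
    rw [h.lintegral_factorKernel_prod ht] at h3
    have h4 : ∑' i, ‖Γ (b i)‖ₑ ^ 2 ≠ ⊤ := by
      rw [h3]
      exact ((lintegral_mono_set (Ioi_subset_Ioi ht)).trans_lt h.integrable_diag.2).ne
    have h5 := ENNReal.hasSum_toReal h4
    rw [← ENNReal.tsum_toReal_eq (ENNReal.ne_top_of_tsum_ne_top h4), h3] at h5
    simpa using h5
  have hin : ∀ f : L2, inner ℂ f (((-(ε : ℂ)) • shifted K t) f) = ((‖Γ f‖ ^ 2 : ℝ) : ℂ) := by
    intro f
    rw [h2, ContinuousLinearMap.comp_apply, ContinuousLinearMap.adjoint_inner_right,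
      inner_self_eq_norm_sq_to_K]
    norm_cast
  -- The diagonal has constant sign, k(x,x) = -ε |k(x,x)|, so the integral of |k(x,x)| becomes that
  -- of k(x,x) after multiplication by -ε.
  have htr : -(ε : ℂ) * (((∫⁻ x in Ioi t, ‖k x x‖ₑ).toReal : ℝ) : ℂ) = ∫ x in Ioi t, k x x := by
    have h4 : (ε : ℂ) * ε = 1 := by exact_mod_cast h.sq
    have h5 : ∀ x ∈ Ioi t, k x x = -(ε : ℂ) * ((‖k x x‖ : ℝ) : ℂ) := by
      intro x hx
      have hx0 : 0 < x := lt_of_le_of_lt ht hx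
      have h6 := h.ofReal_lintegral_factorKernel hx0
      rw [h.lintegral_factorKernel_eq hx0, toReal_enorm] at h6
      rw [h6, neg_mul_neg, ← mul_assoc, h4, one_mul]
    rw [setIntegral_congr_fun measurableSet_Ioi h5, integral_const_mul, integral_complex_ofReal,
      integral_norm_eq_lintegral_enorm]
    exact (IntegrableOn.mono_set h.integrable_diag (Ioi_subset_Ioi ht)).1
  refine ⟨fun ι b => ?_, fun ι b => ?_⟩
  · rw [abs_of_smul_nonneg h.sq (h.nonneg_of_measure hK ht)]
    simp only [hin, Complex.ofReal_re]
    exact (hsum ι b).summable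
  · have h3 := (Complex.hasSum_ofReal.2 (hsum ι b)).mul_left (-(ε : ℂ))
    rw [htr] at h3
    refine h3.congr_fun fun i => ?_
    rw [← hin, ← inner_smul_right, ← smul_apply, h.smul_smul_self]

end Measure

/-! ### The same consequences with no measurable structure on κ; the discrete one is supplied in the
proofs. -/

lemma antitoneOn (h : IsCumulative a ℓ k ε w) (hK : HasKernel K k) :
    AntitoneOn (fun s => (-(ε : ℂ)) • shifted K s) (Ici 0) := by
  let _ : MeasurableSpace κ := ⊤
  exact h.antitoneOn_of_measure hK

lemma nonneg (h : IsCumulative a ℓ k ε w) (hK : HasKernel K k) {t : ℝ} (ht : 0 ≤ t) :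
    0 ≤ (-(ε : ℂ)) • shifted K t := by
  let _ : MeasurableSpace κ := ⊤
  exact h.nonneg_of_measure hK ht

lemma norm_smul_le (h : IsCumulative a ℓ k ε w) (hK : HasKernel K k) {t : ℝ}
    (ht : 0 ≤ t) : ‖(-(ε : ℂ)) • shifted K t‖ ≤ ∫ x in Ioi t, ‖k x x‖ := by
  let _ : MeasurableSpace κ := ⊤
  exact h.norm_smul_le_of_measure hK ht

lemma hasTrace (h : IsCumulative a ℓ k ε w) (hK : HasKernel K k) {t : ℝ} (ht : 0 ≤ t) :
    HasTrace (shifted K t) (∫ x in Ioi t, k x x) := by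
  let _ : MeasurableSpace κ := ⊤
  exact h.hasTrace_of_measure hK ht

lemma tendsto_norm (h : IsCumulative a ℓ k ε w) (hK : HasKernel K k) :
    Tendsto (fun t => ‖(-(ε : ℂ)) • shifted K t‖) atTop (𝓝 0) := by
  refine squeeze_zero' (Eventually.of_forall fun _ => norm_nonneg _) ?_
    (IsTame.tendsto_integral_tail h.integrable_diag.norm)
  filter_upwards [eventually_ge_atTop 0] with t ht
  exact h.norm_smul_le hK ht

lemma exists_le_one (h : IsCumulative a ℓ k ε w) (hK : HasKernel K k) :
    ∃ s₀ : ℝ, ∀ s ≥ 0, s₀ ≤ s → (-(ε : ℂ)) • shifted K s ≤ 1 := by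
  obtain ⟨s₀, hs₀⟩ := eventually_atTop.1 ((h.tendsto_norm hK).eventually (ge_mem_nhds one_pos))
  exact ⟨s₀, fun s hs0 hs => (CStarAlgebra.norm_le_one_iff_of_nonneg _ (h.nonneg hK hs0)).1
    (hs₀ s hs)⟩

lemma tendsto_apply (h : IsCumulative a ℓ k ε w) (hK : HasKernel K k) (f : L2) :
    Tendsto (fun s => shifted K s f) atTop (𝓝 0) := by
  have h1 : Tendsto (fun t => (-(ε : ℂ)) • shifted K t) atTop (𝓝 0) :=
    tendsto_zero_iff_norm_tendsto_zero.2 (h.tendsto_norm hK)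
  have h2 := h1.const_smul (-(ε : ℂ))
  simp only [h.smul_smul_self, smul_zero] at h2
  exact ((ContinuousLinearMap.apply ℂ L2 f).continuous.tendsto 0).comp h2

end IsCumulative

end HamKernel

namespace HamKernel

variable {m : ℕ} {E F : ℝ → Matrix (Fin m ⊕ Fin m) (Fin m ⊕ Fin m) ℝ} {lam ε : ℝ}
  {Ψ : ℝ → Fin m ⊕ Fin m → ℂ} {C : ℝ}

/-! ### The quadratic form of a positive matrix kernel -/

section Form

variable {ι : Type} [Fintype ι] {L : ℝ → ℝ → Matrix ι ι ℂ}
  {G : ℕ → ℝ → Matrix ι ι ℂ} {Φ : ℝ → ι → ℂ}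

/-- `⟨L(x,y) Φ(x), Φ(y)⟩` with the bilinear form. -/
def form (L : ℝ → ℝ → Matrix ι ι ℂ) (Φ : ℝ → ι → ℂ) (x y : ℝ) : ℂ := Φ y ⬝ᵥ (L x y *ᵥ Φ x)

/-- The components of `G_j Φ`. -/
def formFactor (G : ℕ → ℝ → Matrix ι ι ℂ) (Φ : ℝ → ι → ℂ) (p : ℕ × ι) (x : ℝ) : ℂ :=
  (G p.1 x *ᵥ Φ x) p.2

variable [DecidableEq ι]

omit [DecidableEq ι] in
-- Reality of v identifies the bilinear pairing with the Hermitian one; this is where real solutions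
-- are needed for positivity.
lemma dotProduct_conjTranspose_mulVec {u v : ι → ℂ} (A B : Matrix ι ι ℂ)
    (hv : ∀ i, (v i).im = 0) :
    v ⬝ᵥ ((Aᴴ * B) *ᵥ u) = ∑ i, (B *ᵥ u) i * conj ((A *ᵥ v) i) := by
  have hs : star v = v := by
    ext i
    exact Complex.conj_eq_iff_im.2 (hv i)
  have h1 : v ᵥ* Aᴴ = star (A *ᵥ v) := by rw [Matrix.star_mulVec, hs]
  rw [← Matrix.mulVec_mulVec, Matrix.dotProduct_mulVec, h1, dotProduct_comm]
  rfl

lemma IsDecomposition.hasSum_form_fiberwise (h : IsDecomposition L G)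
    (hΦ : ∀ x > 0, ∀ i, (Φ x i).im = 0) {x y : ℝ} (hx : 0 < x) (hy : 0 < y) :
    HasSum (fun j => ∑ i, formFactor G Φ (j, i) x * conj (formFactor G Φ (j, i) y))
      (form L Φ x y) := by
  let φ : Matrix ι ι ℂ →ₗ[ℂ] ℂ :=
    { toFun := fun A => Φ y ⬝ᵥ (A *ᵥ Φ x)
      map_add' := fun A B => by rw [Matrix.add_mulVec, dotProduct_add]
      map_smul' := fun c A => by rw [Matrix.smul_mulVec, dotProduct_smul, RingHom.id_apply] }
  have h1 := (h.hasSum x hx y hy).map φ φ.continuous_of_finiteDimensional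
  refine h1.congr_fun fun j => ?_
  exact (dotProduct_conjTranspose_mulVec _ _ (hΦ y hy)).symm

lemma IsDecomposition.summable_norm_sq (h : IsDecomposition L G)
    (hΦ : ∀ x > 0, ∀ i, (Φ x i).im = 0) {x : ℝ} (hx : 0 < x) :
    Summable fun p => ‖formFactor G Φ p x‖ ^ 2 := by
  have h1 := Complex.hasSum_re (h.hasSum_form_fiberwise hΦ hx hx)
  rw [summable_prod_of_nonneg fun p => by positivity]
  refine ⟨fun j => (hasSum_fintype _).summable, ?_⟩
  refine h1.summable.congr fun j => ?_
  rw [tsum_fintype, Complex.re_sum]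
  refine Finset.sum_congr rfl fun i _ => ?_
  rw [Complex.mul_conj, Complex.normSq_eq_norm_sq, Complex.ofReal_re]

/-- The decomposition only sums over j, with the components i grouped. Absolute convergence over
pairs (j,i) follows from the two diagonal sums by 2|ab| ≤ |a|² + |b|². -/
lemma IsDecomposition.hasSum_form (h : IsDecomposition L G)
    (hΦ : ∀ x > 0, ∀ i, (Φ x i).im = 0) {x y : ℝ} (hx : 0 < x) (hy : 0 < y) :
    HasSum (fun p => formFactor G Φ p x * conj (formFactor G Φ p y)) (form L Φ x y) := by
  have hs : Summable fun p => formFactor G Φ p x * conj (formFactor G Φ p y) := by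
    refine Summable.of_norm_bounded
      ((h.summable_norm_sq hΦ hx).add (h.summable_norm_sq hΦ hy)) fun p => ?_
    rw [norm_mul, RCLike.norm_conj]
    nlinarith [sq_nonneg (‖formFactor G Φ p x‖ - ‖formFactor G Φ p y‖),
      sq_nonneg ‖formFactor G Φ p x‖, sq_nonneg ‖formFactor G Φ p y‖]
  have h1 := hs.hasSum.prod_fiberwise fun j => hasSum_fintype _
  rw [(h.hasSum_form_fiberwise hΦ hx hy).unique h1]
  exact hs.hasSum

lemma IsDecomposition.exists_norm_form_le (h : IsDecomposition L G) :
    ∃ c : ℝ, 0 ≤ c ∧ ∀ x > 0, ‖form L Φ x x‖ ≤ c * ‖Φ x‖ ^ 2 := by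
  obtain ⟨C, hC⟩ := h.bounded
  have hC0 : 0 ≤ C := (norm_nonneg _).trans (hC 1 one_pos)
  refine ⟨Fintype.card ι * (Fintype.card ι * C), by positivity, fun x hx => ?_⟩
  have h1 : ∀ i j, ‖L x x i j‖ ≤ C := fun i j => by
    refine (norm_entry_le_l2_opNorm _ i j).trans ?_
    rw [← (h.hasSum x hx x hx).tsum_eq]
    exact hC x hx
  calc ‖form L Φ x x‖ ≤ Fintype.card ι * (‖Φ x‖ * ‖L x x *ᵥ Φ x‖) := norm_dotProduct_le _ _
    _ ≤ Fintype.card ι * (‖Φ x‖ * (Fintype.card ι * (C * ‖Φ x‖))) := by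
        gcongr
        exact norm_mulVec_le hC0 h1 _
    _ = _ := by ring

lemma IsDecomposition.continuousOn_formFactor (h : IsDecomposition L G)
    (hΦ : ContinuousOn Φ (Ioi 0)) (p : ℕ × ι) : ContinuousOn (formFactor G Φ p) (Ioi 0) := by
  unfold formFactor
  refine continuousOn_finsetSum _ fun j _ => ContinuousOn.mul ?_ (continuousOn_pi.1 hΦ j)
  exact (continuous_id.matrix_elem p.2 j).comp_continuousOn (h.continuousOn p.1)

omit [DecidableEq ι] in
lemma continuousOn_form (hL : ContinuousOn (Function.uncurry L) (Ioi 0 ×ˢ Ioi 0))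
    (hΦ : ContinuousOn Φ (Ioi 0)) :
    ContinuousOn (Function.uncurry (form L Φ)) (Ioi 0 ×ˢ Ioi 0) := by
  have h1 : ∀ i, ContinuousOn (fun z : ℝ × ℝ => Φ z.1 i) (Ioi 0 ×ˢ Ioi 0) := fun i =>
    (continuousOn_pi.1 hΦ i).comp continuousOn_fst fun z hz => hz.1
  have h2 : ∀ i, ContinuousOn (fun z : ℝ × ℝ => Φ z.2 i) (Ioi 0 ×ˢ Ioi 0) := fun i =>
    (continuousOn_pi.1 hΦ i).comp continuousOn_snd fun z hz => hz.2
  refine continuousOn_finsetSum _ fun i _ => (h2 i).mul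
    (continuousOn_finsetSum _ fun j _ => ContinuousOn.mul ?_ (h1 j))
  exact (continuous_id.matrix_elem i j).comp_continuousOn hL

end Form

/-! ### The derivative of the kernel along the diagonal direction -/

/-- In the product rule JΨ' is replaced by PΨ in the first term; in the second, skewness of J moves
J onto Ψ' with a minus sign. Symmetry of P then combines the two into a difference of potentials. -/
lemma hasDerivAt_wronskian (h : IsBoundedL2Solution E F lam Ψ) (hE : IsCoefficient E)
    (hF : IsCoefficient F) {x y t : ℝ} (hx : 0 < x + t) (hy : 0 < y + t) :
    HasDerivAt (fun s => wronskian Ψ (x + s) (y + s))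
      (Ψ (y + t) ⬝ᵥ ((potential E F lam (x + t) - potential E F lam (y + t)) *ᵥ Ψ (x + t))) t := by
  have h1 : HasDerivAt (fun s => Ψ (x + s)) (deriv Ψ (x + t)) t :=
    (h.differentiableAt _ hx).hasDerivAt.comp_const_add x t
  have h2 : HasDerivAt (fun s => Ψ (y + s)) (deriv Ψ (y + t)) t :=
    (h.differentiableAt _ hy).hasDerivAt.comp_const_add y t
  have h3 : ∀ i, HasDerivAt (fun s => (Matrix.J (Fin m) ℂ *ᵥ Ψ (x + s)) i)
      ((Matrix.J (Fin m) ℂ *ᵥ deriv Ψ (x + t)) i) t := fun i => by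
    simp only [Matrix.mulVec, dotProduct]
    exact HasDerivAt.fun_sum fun j _ => (hasDerivAt_pi.1 h1 j).const_mul _
  have h4 : HasDerivAt (fun s => wronskian Ψ (x + s) (y + s))
      (∑ i, ((Matrix.J (Fin m) ℂ *ᵥ deriv Ψ (x + t)) i * Ψ (y + t) i +
        (Matrix.J (Fin m) ℂ *ᵥ Ψ (x + t)) i * deriv Ψ (y + t) i)) t := by
    unfold wronskian dotProduct
    exact HasDerivAt.fun_sum fun i _ => (h3 i).fun_mul (hasDerivAt_pi.1 h2 i)
  refine h4.congr_deriv ?_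
  rw [Finset.sum_add_distrib]
  change (Matrix.J (Fin m) ℂ *ᵥ deriv Ψ (x + t)) ⬝ᵥ Ψ (y + t) +
    (Matrix.J (Fin m) ℂ *ᵥ Ψ (x + t)) ⬝ᵥ deriv Ψ (y + t) = _
  rw [J_mulVec_dotProduct (Ψ (x + t)), h.equation _ hx, h.equation _ hy, Matrix.sub_mulVec,
    dotProduct_sub, dotProduct_comm (Ψ (y + t)), ← sub_eq_add_neg]
  congr 1
  rw [Matrix.dotProduct_mulVec, ← Matrix.mulVec_transpose, potential_isSymm hE hF _ hy,
    dotProduct_comm]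

/-- `ε (P(x) - P(y)) / (x - y)` for the potential `P = λ E + F`. -/
def IsPotentialDifference (ε : ℝ) (E F : ℝ → Matrix (Fin m ⊕ Fin m) (Fin m ⊕ Fin m) ℝ) (lam : ℝ)
    (L : ℝ → ℝ → Matrix (Fin m ⊕ Fin m) (Fin m ⊕ Fin m) ℂ) : Prop :=
  ∀ x > 0, ∀ y > 0, x ≠ y →
    L x y = ((ε : ℂ) / (x - y)) • (potential E F lam x - potential E F lam y)

variable {L : ℝ → ℝ → Matrix (Fin m ⊕ Fin m) (Fin m ⊕ Fin m) ℂ}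

lemma hasDerivAt_kernel_of_ne (hE : IsCoefficient E) (hF : IsCoefficient F)
    (h : IsBoundedL2Solution E F lam Ψ) (hε : ε * ε = 1) (hL : IsPotentialDifference ε E F lam L)
    {x y t : ℝ} (hx : 0 < x + t) (hy : 0 < y + t) (hxy : x ≠ y) :
    HasDerivAt (fun s => kernel E F lam Ψ (x + s) (y + s)) (ε * form L Ψ (x + t) (y + t)) t := by
  have hne : ∀ s : ℝ, x + s ≠ y + s := fun s => by simpa using hxy
  have h1 := (hasDerivAt_wronskian h hE hF hx hy).div_const ((x : ℂ) - y)
  have hε' : (ε : ℂ) * ε = 1 := by exact_mod_cast hε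
  have e1 : ∀ s : ℝ, (((x + s : ℝ) : ℂ) - ((y + s : ℝ) : ℂ)) = x - y := fun s => by
    push_cast
    ring
  refine (h1.congr_deriv ?_).congr_of_eventuallyEq (Eventually.of_forall fun s => ?_)
  · rw [form, hL _ hx _ hy (hne t), Matrix.smul_mulVec, dotProduct_smul, e1, smul_eq_mul,
      ← mul_assoc, ← mul_div_assoc, hε', div_mul_eq_mul_div, one_mul]
  · simp only [kernel_of_ne (hne s), e1]

/-- As ⟨JΨ(x), Ψ(x)⟩ = 0, the kernel at (x+r, x) is a difference quotient with limit ⟨JΨ'(x), Ψ(x)⟩,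
and the equation turns this into the prescribed diagonal value. -/
lemma tendsto_kernel_diag (h : IsBoundedL2Solution E F lam Ψ) {x : ℝ} (hx : 0 < x) :
    Tendsto (fun r => kernel E F lam Ψ (x + r) x) (𝓝[>] 0) (𝓝 (kernel E F lam Ψ x x)) := by
  have h1 := (hasDerivAt_iff_tendsto_slope_zero.1 (h.differentiableAt x hx).hasDerivAt).mono_left
    (nhdsWithin_mono (0 : ℝ) (s := Ioi 0) (t := {0}ᶜ) fun x hx => ne_of_gt hx)
  have hc : Continuous fun v : Fin m ⊕ Fin m → ℂ => (Matrix.J (Fin m) ℂ *ᵥ v) ⬝ᵥ Ψ x :=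
    (continuous_const.matrix_mulVec continuous_id).dotProduct continuous_const
  have h2 := (hc.tendsto _).comp h1
  rw [h.equation x hx, dotProduct_comm] at h2
  rw [kernel_self]
  refine h2.congr' ?_
  filter_upwards [self_mem_nhdsWithin] with r hr
  rw [kernel_of_ne (by simpa using ne_of_gt hr), Function.comp_apply, wronskian,
    ← Complex.coe_smul, Matrix.mulVec_smul, smul_dotProduct, Matrix.mulVec_sub, sub_dotProduct,
    J_mulVec_dotProduct_self, sub_zero, smul_eq_mul]
  push_cast
  rw [add_sub_cancel_left, div_eq_inv_mul]

lemma continuousOn_form_shift {ℓ : ℝ → ℝ → ℂ}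
    (hℓ : ContinuousOn (Function.uncurry ℓ) (Ioi 0 ×ˢ Ioi 0)) {x y : ℝ} :
    ContinuousOn (fun s => ℓ (x + s) (y + s)) (Ioi (-min x y)) := by
  refine hℓ.comp (f := fun s : ℝ => (x + s, y + s)) (by fun_prop) fun s hs => ?_
  have hs' : -min x y < s := hs
  exact ⟨by simp only [mem_Ioi]; linarith [min_le_left x y],
    by simp only [mem_Ioi]; linarith [min_le_right x y]⟩

lemma intervalIntegrable_form_shift {ℓ : ℝ → ℝ → ℂ}
    (hℓ : ContinuousOn (Function.uncurry ℓ) (Ioi 0 ×ˢ Ioi 0)) {x y T : ℝ} (hx : 0 < x)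
    (hy : 0 < y) (hT : 0 ≤ T) :
    IntervalIntegrable (fun s => ℓ (x + s) (y + s)) volume 0 T := by
  refine ((continuousOn_form_shift (x := x) (y := y) hℓ).mono fun s hs => ?_).intervalIntegrable
  rw [uIcc_of_le hT] at hs
  have := lt_min hx hy
  simp only [mem_Ioi]
  linarith [hs.1]

/-- Off the diagonal this is the fundamental theorem of calculus. On it the coefficients are merely
continuous, so differentiating the diagonal value directly is not possible; the identity at (x+r, x)
passes to the limit r ↓ 0 instead. -/
lemma kernel_sub_eq (hE : IsCoefficient E) (hF : IsCoefficient F)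
    (h : IsBoundedL2Solution E F lam Ψ) (hε : ε * ε = 1) (hL : IsPotentialDifference ε E F lam L)
    (hℓ : ContinuousOn (Function.uncurry (form L Ψ)) (Ioi 0 ×ˢ Ioi 0)) {x y T : ℝ} (hx : 0 < x)
    (hy : 0 < y) (hT : 0 ≤ T) :
    kernel E F lam Ψ (x + T) (y + T) - kernel E F lam Ψ x y =
      ε * ∫ s in (0 : ℝ)..T, form L Ψ (x + s) (y + s) := by
  have key : ∀ {x y : ℝ}, 0 < x → 0 < y → x ≠ y →
      kernel E F lam Ψ (x + T) (y + T) - kernel E F lam Ψ x y =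
      ε * ∫ s in (0 : ℝ)..T, form L Ψ (x + s) (y + s) := by
    intro x y hx hy hxy
    have h1 := intervalIntegral.integral_eq_sub_of_hasDerivAt
      (f := fun s => kernel E F lam Ψ (x + s) (y + s)) (a := 0) (b := T) (fun s hs => by
        rw [uIcc_of_le hT] at hs
        exact hasDerivAt_kernel_of_ne hE hF h hε hL (add_pos_of_pos_of_nonneg hx hs.1)
          (add_pos_of_pos_of_nonneg hy hs.1) hxy)
      ((intervalIntegrable_form_shift hℓ hx hy hT).const_mul _)
    rw [intervalIntegral.integral_const_mul, add_zero, add_zero] at h1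
    exact h1.symm
  by_cases hxy : x = y
  · subst hxy
    have hxT : 0 < x + T := add_pos_of_pos_of_nonneg hx hT
    have hl : Tendsto (fun r => kernel E F lam Ψ (x + r + T) (x + T) -
        kernel E F lam Ψ (x + r) x) (𝓝[>] 0)
        (𝓝 (kernel E F lam Ψ (x + T) (x + T) - kernel E F lam Ψ x x)) := by
      have := (tendsto_kernel_diag h hxT).sub (tendsto_kernel_diag h hx)
      simpa only [add_right_comm] using this
    -- A bound for the integrand on a compact square containing all points (x+r+s, x+s) with 0 < r <
    -- 1 and 0 ≤ s ≤ T, as the dominating constant.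
    obtain ⟨M, hM⟩ := ((isCompact_Icc (a := x) (b := x + 1 + T)).prod
      (isCompact_Icc (a := x) (b := x + 1 + T))).exists_bound_of_continuousOn
      (hℓ.mono (prod_mono (Icc_subset_Ioi_iff (by linarith) |>.2 hx)
        (Icc_subset_Ioi_iff (by linarith) |>.2 hx)))
    have hr : Tendsto (fun r => (ε : ℂ) * ∫ s in (0 : ℝ)..T, form L Ψ (x + r + s) (x + s))
        (𝓝[>] 0) (𝓝 (ε * ∫ s in (0 : ℝ)..T, form L Ψ (x + s) (x + s))) := by
      refine Tendsto.const_mul _ (intervalIntegral.tendsto_integral_filter_of_dominated_convergence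
        (fun _ => M) ?_ ?_ intervalIntegrable_const ?_)
      · filter_upwards [self_mem_nhdsWithin] with r hr
        exact (intervalIntegrable_form_shift hℓ (add_pos hx hr) hx hT).def'.aestronglyMeasurable
      · filter_upwards [self_mem_nhdsWithin, mem_nhdsWithin_of_mem_nhds (gt_mem_nhds one_pos)]
          with r hr hr1
        refine Eventually.of_forall fun s hs => ?_
        rw [uIoc_of_le hT] at hs
        have hr' : 0 < r := hr
        exact hM (x + r + s, x + s) ⟨⟨by linarith [hs.1], by linarith [hs.2]⟩,
          ⟨by linarith [hs.1], by linarith [hs.2]⟩⟩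
      · refine Eventually.of_forall fun s hs => ?_
        rw [uIoc_of_le hT] at hs
        have hxs : 0 < x + s := add_pos hx hs.1
        have h1 := hℓ.continuousAt ((isOpen_Ioi.prod isOpen_Ioi).mem_nhds
          (show (x + s, x + s) ∈ Ioi (0 : ℝ) ×ˢ Ioi (0 : ℝ) from ⟨hxs, hxs⟩))
        have h2 : Tendsto (fun r : ℝ => (x + r + s, x + s)) (𝓝[>] 0) (𝓝 (x + s, x + s)) := by
          have : Continuous fun r : ℝ => (x + r + s, x + s) := by fun_prop
          have h3 := this.tendsto 0
          rw [add_zero] at h3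
          exact h3.mono_left nhdsWithin_le_nhds
        exact h1.tendsto.comp h2
    refine tendsto_nhds_unique hl (hr.congr' ?_)
    filter_upwards [self_mem_nhdsWithin] with r hr
    have hr' : 0 < r := hr
    exact (key (add_pos hx hr') hx (by simpa using ne_of_gt hr')).symm
  · exact key hx hy hxy

/-- Differentiating the integrated identity covers the case x = y as well. -/
lemma hasDerivAt_kernel (hE : IsCoefficient E) (hF : IsCoefficient F)
    (h : IsBoundedL2Solution E F lam Ψ) (hε : ε * ε = 1) (hL : IsPotentialDifference ε E F lam L)
    (hℓ : ContinuousOn (Function.uncurry (form L Ψ)) (Ioi 0 ×ˢ Ioi 0)) {x y t : ℝ} (hx : 0 < x)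
    (hy : 0 < y) (ht : 0 < t) :
    HasDerivAt (fun s => kernel E F lam Ψ (x + s) (y + s)) (ε * form L Ψ (x + t) (y + t)) t := by
  have hc := continuousOn_form_shift (x := x) (y := y) hℓ
  have hmem : t ∈ Ioi (-min x y) := by
    have := lt_min hx hy
    simp only [mem_Ioi]
    linarith
  have h1 := ((intervalIntegral.integral_hasDerivAt_right
    (intervalIntegrable_form_shift hℓ hx hy ht.le)
    (hc.stronglyMeasurableAtFilter isOpen_Ioi t hmem)
    (hc.continuousAt (isOpen_Ioi.mem_nhds hmem))).const_mul (ε : ℂ)).const_add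
      (kernel E F lam Ψ x y)
  refine h1.congr_of_eventuallyEq ?_
  filter_upwards [lt_mem_nhds ht] with s hs
  rw [← kernel_sub_eq hE hF h hε hL hℓ hx hy hs.le]
  ring

end HamKernel

namespace HamKernel

variable {m : ℕ} {E F : ℝ → Matrix (Fin m ⊕ Fin m) (Fin m ⊕ Fin m) ℝ} {lam ε : ℝ}
  {Ψ : ℝ → Fin m ⊕ Fin m → ℂ}

/-! ### The diagonal of the kernel -/

lemma exists_norm_diagonal_le (hE : IsCoefficient E) (hF : IsCoefficient F) (lam : ℂ)
    (Ψ : ℝ → Fin m ⊕ Fin m → ℂ) :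
    ∃ c : ℝ, ∀ x > 0, ‖diagonal E F lam Ψ x‖ ≤ c * ‖Ψ x‖ ^ 2 := by
  obtain ⟨c, hc, hP⟩ := exists_norm_potential_le hE hF
  refine ⟨Fintype.card (Fin m ⊕ Fin m) * (Fintype.card (Fin m ⊕ Fin m) * (c * (1 + ‖lam‖))),
    fun x hx => ?_⟩
  calc ‖diagonal E F lam Ψ x‖
      ≤ Fintype.card (Fin m ⊕ Fin m) * (‖Ψ x‖ * ‖potential E F lam x *ᵥ Ψ x‖) :=
        norm_dotProduct_le _ _
    _ ≤ Fintype.card (Fin m ⊕ Fin m) * (‖Ψ x‖ *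
          (Fintype.card (Fin m ⊕ Fin m) * (c * (1 + ‖lam‖) * ‖Ψ x‖))) := by
        gcongr
        exact norm_mulVec_le (by positivity) (hP lam x hx) _
    _ = _ := by ring

lemma continuousOn_diagonal (hE : IsCoefficient E) (hF : IsCoefficient F) (lam : ℂ)
    (hΨ : ContinuousOn Ψ (Ioi 0)) : ContinuousOn (diagonal E F lam Ψ) (Ioi 0) := by
  unfold diagonal Matrix.mulVec dotProduct
  refine continuousOn_finsetSum _ fun i _ => ContinuousOn.mul (continuousOn_pi.1 hΨ i)
    (continuousOn_finsetSum _ fun j _ => ContinuousOn.mul ?_ (continuousOn_pi.1 hΨ j))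
  exact continuousOn_potential_entry hE hF lam i j

lemma integrable_diagonal (hE : IsCoefficient E) (hF : IsCoefficient F) {C : ℝ} {lam : ℂ}
    (h : IsTame C Ψ) : Integrable (diagonal E F lam Ψ) halfLine := by
  obtain ⟨c, hc⟩ := exists_norm_diagonal_le hE hF lam Ψ
  refine Integrable.mono' (h.integrable_norm_sq.const_mul c)
    ((continuousOn_diagonal hE hF lam h.continuousOn).aestronglyMeasurable measurableSet_Ioi) ?_
  filter_upwards [ae_restrict_mem measurableSet_Ioi] with x hx
  exact hc x hx

lemma tendsto_kernel_zero (hE : IsCoefficient E) (hF : IsCoefficient F) {C : ℝ} {lam : ℂ}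
    (h : IsTame C Ψ) (x y : ℝ) :
    Tendsto (fun T => kernel E F lam Ψ (x + T) (y + T)) atTop (𝓝 0) := by
  have hx := h.tendsto_zero.comp (tendsto_atTop_add_const_left atTop x tendsto_id)
  have hy := h.tendsto_zero.comp (tendsto_atTop_add_const_left atTop y tendsto_id)
  by_cases hxy : x = y
  · subst hxy
    simp only [kernel_self]
    obtain ⟨c, hc⟩ := exists_norm_diagonal_le hE hF lam Ψ
    have h1 : Tendsto (fun T => c * ‖Ψ (x + T)‖ ^ 2) atTop (𝓝 0) := by
      simpa using (hx.norm.pow 2).const_mul c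
    refine squeeze_zero_norm' ?_ h1
    filter_upwards [eventually_gt_atTop (-x)] with T hT
    exact hc _ (by linarith)
  · have hc : Continuous fun v : (Fin m ⊕ Fin m → ℂ) × (Fin m ⊕ Fin m → ℂ) =>
        ((Matrix.J (Fin m) ℂ *ᵥ v.1) ⬝ᵥ v.2) / ((x : ℂ) - y) :=
      ((continuous_const.matrix_mulVec continuous_fst).dotProduct continuous_snd).div_const _
    have h1 := (hc.tendsto (0, 0)).comp (hx.prodMk_nhds hy)
    simp only [Matrix.mulVec_zero, zero_dotProduct, zero_div] at h1
    refine h1.congr fun T => ?_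
    rw [kernel_of_ne (by simpa using hxy), Function.comp_apply, wronskian]
    push_cast
    rw [add_sub_add_right_eq_sub]
    rfl

/-! ### The factorization for a solution of the Hamiltonian system -/

section Factorization

variable {LE LF : ℝ → ℝ → Matrix (Fin m ⊕ Fin m) (Fin m ⊕ Fin m) ℂ}
  {GE GF : ℕ → ℝ → Matrix (Fin m ⊕ Fin m) (Fin m ⊕ Fin m) ℂ}

/-- The divided difference of `λ E + F`. -/
abbrev potentialDifference (lam : ℝ) (LE LF : ℝ → ℝ → Matrix (Fin m ⊕ Fin m) (Fin m ⊕ Fin m) ℂ)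
    (x y : ℝ) : Matrix (Fin m ⊕ Fin m) (Fin m ⊕ Fin m) ℂ :=
  (lam : ℂ) • LE x y + LF x y

/-- The factors of the form of `λ E + F`. -/
def potentialFactor (lam : ℝ) (GE GF : ℕ → ℝ → Matrix (Fin m ⊕ Fin m) (Fin m ⊕ Fin m) ℂ)
    (Ψ : ℝ → Fin m ⊕ Fin m → ℂ) :
    (ℕ × (Fin m ⊕ Fin m)) ⊕ (ℕ × (Fin m ⊕ Fin m)) → ℝ → ℂ :=
  Sum.elim (fun p x => ((√lam : ℝ) : ℂ) * formFactor GE Ψ p x) (formFactor GF Ψ)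

lemma isPotentialDifference (hLE : IsDividedDifference ε E LE)
    (hLF : IsDividedDifference ε F LF) :
    IsPotentialDifference ε E F lam (potentialDifference lam LE LF) := by
  intro x hx y hy hxy
  rw [potentialDifference, hLE x hx y hy hxy, hLF x hx y hy hxy]
  ext i j
  simp only [potential, Matrix.add_apply, Matrix.sub_apply, Matrix.smul_apply, Matrix.map_apply,
    smul_eq_mul]
  push_cast
  ring

lemma form_potentialDifference (x y : ℝ) :
    form (potentialDifference lam LE LF) Ψ x y = lam * form LE Ψ x y + form LF Ψ x y := by
  rw [form, potentialDifference, Matrix.add_mulVec, Matrix.smul_mulVec, dotProduct_add,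
    dotProduct_smul, smul_eq_mul]
  rfl

lemma continuousOn_form_potentialDifference
    (hLE : ContinuousOn (Function.uncurry LE) (Ioi 0 ×ˢ Ioi 0))
    (hLF : ContinuousOn (Function.uncurry LF) (Ioi 0 ×ˢ Ioi 0)) (hΨ : ContinuousOn Ψ (Ioi 0)) :
    ContinuousOn (Function.uncurry (form (potentialDifference lam LE LF) Ψ))
      (Ioi 0 ×ˢ Ioi 0) := by
  refine ((continuousOn_const (c := (lam : ℂ))).mul (continuousOn_form hLE hΨ) |>.add
    (continuousOn_form hLF hΨ)).congr fun z _ => ?_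
  exact form_potentialDifference z.1 z.2

/-- Positivity of λ enters here: the factors of E are scaled by √λ and put side by side with those
of F. -/
lemma hasSum_potentialFactor (hlam : 0 < lam) (hGE : IsDecomposition LE GE)
    (hGF : IsDecomposition LF GF) (hΨ : IsRealValued Ψ) {x y : ℝ} (hx : 0 < x) (hy : 0 < y) :
    HasSum (fun p => potentialFactor lam GE GF Ψ p x * conj (potentialFactor lam GE GF Ψ p y))
      (form (potentialDifference lam LE LF) Ψ x y) := by
  rw [form_potentialDifference]
  refine HasSum.sum ?_ (hGF.hasSum_form hΨ hx hy)
  refine ((hGE.hasSum_form hΨ hx hy).mul_left (lam : ℂ)).congr_fun fun p => ?_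
  have h1 : ((√lam : ℝ) : ℂ) * ((√lam : ℝ) : ℂ) = lam := by
    rw [← Complex.ofReal_mul, Real.mul_self_sqrt hlam.le]
  simp only [Function.comp_apply, potentialFactor, Sum.elim_inl, map_mul, Complex.conj_ofReal]
  rw [← h1]
  ring

lemma continuousOn_potentialFactor (hGE : IsDecomposition LE GE) (hGF : IsDecomposition LF GF)
    (hΨ : ContinuousOn Ψ (Ioi 0)) (p) : ContinuousOn (potentialFactor lam GE GF Ψ p) (Ioi 0) := by
  rcases p with p | p
  · exact continuousOn_const.mul (hGE.continuousOn_formFactor hΨ p)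
  · exact hGF.continuousOn_formFactor hΨ p

lemma exists_isCumulative (hE : IsCoefficient E) (hF : IsCoefficient F) (hε : ε * ε = 1)
    (hlam : 0 < lam) (h : IsBoundedL2Solution E F lam Ψ) (hΨ : IsRealValued Ψ)
    (hLE : IsDividedDifference ε E LE) (hLF : IsDividedDifference ε F LF)
    (hLEc : ContinuousOn (Function.uncurry LE) (Ioi 0 ×ˢ Ioi 0))
    (hLFc : ContinuousOn (Function.uncurry LF) (Ioi 0 ×ˢ Ioi 0))
    (hGE : IsDecomposition LE GE) (hGF : IsDecomposition LF GF) :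
    ∃ w, IsCumulative (potentialFactor lam GE GF Ψ) (form (potentialDifference lam LE LF) Ψ)
      (kernel E F lam Ψ) ε w := by
  obtain ⟨c, hc, htame⟩ := exists_isTame hE hF
  have ht := htame _ _ h
  obtain ⟨a, ha, hae⟩ := hGE.exists_norm_form_le (Φ := Ψ)
  obtain ⟨b, hb, hbf⟩ := hGF.exists_norm_form_le (Φ := Ψ)
  -- The majorant combines the uniform bounds on ∑ G_j†G_j for E and F with the square integrability
  -- of Ψ.
  refine ⟨fun x => (lam * a + b) * ‖Ψ x‖ ^ 2, hε,
    continuousOn_potentialFactor hGE hGF ht.continuousOn,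
    fun x hx y hy => hasSum_potentialFactor hlam hGE hGF hΨ hx hy,
    ht.integrable_norm_sq.const_mul _, fun x hx => ?_, fun x hx y hy T hT => ?_,
    fun x _ y _ => tendsto_kernel_zero hE hF ht x y, ?_⟩
  · rw [form_potentialDifference]
    refine (norm_add_le _ _).trans ?_
    rw [norm_mul, Complex.norm_real, Real.norm_of_nonneg hlam.le, add_mul, mul_assoc]
    gcongr
    · exact hae x hx
    · exact hbf x hx
  · exact kernel_sub_eq hE hF h hε (isPotentialDifference hLE hLF)
      (continuousOn_form_potentialDifference hLEc hLFc ht.continuousOn) hx hy hT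
  · simpa only [kernel_self] using integrable_diagonal hE hF ht

end Factorization

/-! ### Finite rank -/

section FiniteRank

/-- The rank one operator `f ↦ ⟨A, f⟩ A`. -/
lemma isIntegralOperator_rankOne (A : L2) {u : ℝ → ℂ} (hu : A =ᵐ[halfLine] u) :
    IsIntegralOperator ((innerSL ℂ A).smulRight A) fun x y => u x * conj (u y) := by
  intro f
  have e : ∀ x, (fun y => u x * conj (u y) * f y) =ᵐ[halfLine]
      fun y => u x * inner ℂ (A y) (f y) := by
    intro x
    filter_upwards [hu] with y hy
    rw [RCLike.inner_apply', hy, mul_assoc]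
  filter_upwards [hu, Lp.coeFn_smul (inner ℂ A f) A] with x hx h1
  refine ⟨((L2.integrable_inner A f).const_mul (u x)).congr (e x).symm, ?_⟩
  rw [integral_congr_ae (e x), integral_const_mul, ContinuousLinearMap.smulRight_apply,
    innerSL_apply_apply, h1, Pi.smul_apply, hx, smul_eq_mul, L2.inner_def, mul_comm]

/-- The kernel is a finite sum of rank one kernels, and the range lies in the span of the functions
aᵢ(· + t). These are square integrable because |aᵢ(x)|² is one term of the diagonal sum, which is at
most w(x). -/
lemma IsCumulative.exists_finiteRank {κ : Type} [Countable κ] {a : κ → ℝ → ℂ}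
    {ℓ k : ℝ → ℝ → ℂ} {w : ℝ → ℝ} (h : IsCumulative a ℓ k ε w) (s : Finset κ)
    (hs : ∀ i ∉ s, ∀ x, a i x = 0) {t : ℝ} (ht : 0 ≤ t) (c : ℂ) :
    ∃ R : L2 →L[ℂ] L2, IsIntegralOperator R (fun x y => c * ℓ (x + t) (y + t)) ∧
      FiniteDimensional ℂ (LinearMap.range (R : L2 →ₗ[ℂ] L2)) := by
  have hpos : ∀ x ∈ Ioi (0 : ℝ), x + t ∈ Ioi (0 : ℝ) := fun x hx => by
    simp only [mem_Ioi] at hx ⊢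
    linarith
  have hw : Integrable (fun x => w (x + t)) halfLine := by
    have h1 : IntegrableOn w (Ioi t) := IntegrableOn.mono_set h.integrable_weight (Ioi_subset_Ioi ht)
    have h2 := ((measurePreserving_add_right volume t).integrableOn_comp_preimage
      (MeasurableEquiv.addRight t).measurableEmbedding (s := Ioi t)).2 h1
    rwa [preimage_add_const_Ioi, sub_self] at h2
  have hmem : ∀ i, MemLp (fun x => a i (x + t)) 2 halfLine := by
    intro i
    have hm : AEStronglyMeasurable (fun x => a i (x + t)) halfLine :=
      ((h.continuousOn i).comp (continuous_add_const t).continuousOn hpos).aestronglyMeasurable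
        measurableSet_Ioi
    rw [memLp_two_iff_integrable_sq_norm hm]
    refine hw.mono' (hm.norm.pow 2) ?_
    filter_upwards [ae_restrict_mem measurableSet_Ioi] with x hx
    have hx' := hpos x hx
    rw [Real.norm_of_nonneg (by positivity)]
    exact (le_hasSum (hasSum_norm_sq (h.hasSum _ hx' _ hx')) i fun j _ => by positivity).trans
      (h.norm_le _ hx')
  let A : κ → L2 := fun i => (hmem i).toLp _
  have hA : ∀ i, A i =ᵐ[halfLine] fun x => a i (x + t) := fun i => (hmem i).coeFn_toLp
  refine ⟨c • ∑ i ∈ s, (innerSL ℂ (A i)).smulRight (A i), ?_, ?_⟩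
  · refine ((IsIntegralOperator.sum s fun i =>
      isIntegralOperator_rankOne (A i) (hA i)).const_smul c).congr ?_
    filter_upwards [ae_restrict_mem measurableSet_Ioi] with x hx
    filter_upwards [ae_restrict_mem measurableSet_Ioi] with y hy
    rw [← (h.hasSum _ (hpos x hx) _ (hpos y hy)).unique (hasSum_sum_of_ne_finset_zero fun i hi => by
      rw [hs i hi, zero_mul])]
  · have hfin : FiniteDimensional ℂ (Submodule.span ℂ (A '' s)) :=
      FiniteDimensional.span_of_finite ℂ (s.finite_toSet.image A)
    refine Submodule.finiteDimensional_of_le (S₂ := Submodule.span ℂ (A '' s)) ?_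
    rintro _ ⟨f, rfl⟩
    change (c • ∑ i ∈ s, (innerSL ℂ (A i)).smulRight (A i)) f ∈ _
    rw [smul_apply, _root_.sum_apply]
    refine Submodule.smul_mem _ _ (Submodule.sum_mem _ fun i hi => ?_)
    exact Submodule.smul_mem _ _ (Submodule.subset_span ⟨i, hi, rfl⟩)

lemma exists_finset_potentialFactor_eq_zero (lam : ℝ) (Ψ : ℝ → Fin m ⊕ Fin m → ℂ)
    {GE GF : ℕ → ℝ → Matrix (Fin m ⊕ Fin m) (Fin m ⊕ Fin m) ℂ} {NE NF : ℕ}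
    (hE : ∀ j ≥ NE, GE j = 0) (hF : ∀ j ≥ NF, GF j = 0) :
    ∃ s : Finset ((ℕ × (Fin m ⊕ Fin m)) ⊕ (ℕ × (Fin m ⊕ Fin m))), ∀ i ∉ s, ∀ x,
      potentialFactor lam GE GF Ψ i x = 0 := by
  refine ⟨(Finset.range NE ×ˢ Finset.univ).disjSum (Finset.range NF ×ˢ Finset.univ),
    fun i hi x => ?_⟩
  rcases i with ⟨j, i⟩ | ⟨j, i⟩
  · have hj : NE ≤ j := by simpa using hi
    simp [potentialFactor, formFactor, hE j hj]
  · have hj : NF ≤ j := by simpa using hi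
    simp [potentialFactor, formFactor, hF j hj]

end FiniteRank

/-- The finite decompositions may differ from those giving positivity, so the cumulative structure
is set up anew from them. -/
lemma exists_finiteRank_deriv (hE : IsCoefficient E) (hF : IsCoefficient F) (hε : ε * ε = 1)
    (hlam : 0 < lam) (h : IsBoundedL2Solution E F lam Ψ) (hΨ : IsRealValued Ψ)
    (hEfin : DividedDifferenceFinitePos ε E) (hFfin : DividedDifferenceFinitePos ε F) {t : ℝ}
    (ht : 0 < t) :
    (∀ x > 0, ∀ y > 0, DifferentiableAt ℝ
      (fun s : ℝ => kernel E F lam Ψ (x + s) (y + s)) t) ∧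
    ∃ R : L2 →L[ℂ] L2,
      HasKernel R (fun x y => deriv (fun s : ℝ => kernel E F lam Ψ (x + s) (y + s)) t) ∧
      FiniteDimensional ℂ (LinearMap.range (R : L2 →ₗ[ℂ] L2)) := by
  obtain ⟨LE, hLE, hLEc, GE, hGE, NE, hNE⟩ := hEfin
  obtain ⟨LF, hLF, hLFc, GF, hGF, NF, hNF⟩ := hFfin
  have hΨc : ContinuousOn Ψ (Ioi 0) := fun x hx =>
    (h.differentiableAt x hx).continuousAt.continuousWithinAt
  have hd : ∀ x > 0, ∀ y > 0, HasDerivAt (fun s : ℝ => kernel E F lam Ψ (x + s) (y + s))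
      (ε * form (potentialDifference lam LE LF) Ψ (x + t) (y + t)) t := fun x hx y hy =>
    hasDerivAt_kernel hE hF h hε (isPotentialDifference hLE hLF)
      (continuousOn_form_potentialDifference hLEc hLFc hΨc) hx hy ht
  refine ⟨fun x hx y hy => (hd x hx y hy).differentiableAt, ?_⟩
  obtain ⟨w, hw⟩ := exists_isCumulative hE hF hε hlam h hΨ hLE hLF hLEc hLFc hGE hGF
  obtain ⟨s, hs⟩ := exists_finset_potentialFactor_eq_zero lam Ψ hNE hNF
  obtain ⟨R, hR, hfin⟩ := hw.exists_finiteRank s hs ht.le ε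
  refine ⟨R, hR.congr ?_, hfin⟩
  filter_upwards [ae_restrict_mem measurableSet_Ioi] with x hx
  filter_upwards [ae_restrict_mem measurableSet_Ioi] with y hy
  exact (hd x hx y hy).deriv.symm

end HamKernel

end

/-! ### The main theorem. -/

theorem proposition3p3 (m : ℕ) (hm : 1 ≤ m)
    (E F : ℝ → Matrix (Fin m ⊕ Fin m) (Fin m ⊕ Fin m) ℝ)
    (hE : HamKernel.IsCoefficient E) (hF : HamKernel.IsCoefficient F)
    (ε : ℝ) (hε : ε = 1 ∨ ε = -1)
    (hEpos : HamKernel.DividedDifferencePos ε E) (hFpos : HamKernel.DividedDifferencePos ε F) :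
    -- One real parameter and one real solution.
    (∀ lam : ℝ, 0 < lam → ∀ Ψ : ℝ → Fin m ⊕ Fin m → ℂ,
      HamKernel.IsBoundedL2Solution E F lam Ψ → HamKernel.IsRealValued Ψ →
      ∃ K : HamKernel.L2 →L[ℂ] HamKernel.L2,
        -- `K` is the bounded operator with kernel `K_λ(x,y)`, and
        -- `K_{t,λ} = S_t† K S_t` has kernel `K_λ(x+t,y+t)`
        HamKernel.HasKernel K (HamKernel.kernel E F lam Ψ) ∧
        (∀ t ≥ 0, HamKernel.HasKernel (HamKernel.shifted K t)
          fun x y => HamKernel.kernel E F lam Ψ (x + t) (y + t)) ∧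
        -- the Lyapunov equation, where `e^{-sA} = S_s†` is a bounded `C₀` semigroup
        HamKernel.IsBoundedC0Semigroup (fun s => ContinuousLinearMap.adjoint (HamKernel.shift s)) ∧
        HamKernel.SatisfiesLyapunov HamKernel.opA (HamKernel.shifted K) ∧
        -- positivity, and contractivity from some point on
        (∀ t ≥ 0, 0 ≤ (-(ε : ℂ)) • HamKernel.shifted K t) ∧
        (∃ s₀ : ℝ, ∀ s ≥ 0, s₀ ≤ s → (-(ε : ℂ)) • HamKernel.shifted K s ≤ 1) ∧
        -- decrease, strongly to zero
        AntitoneOn (fun s => (-(ε : ℂ)) • HamKernel.shifted K s) (Ici 0) ∧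
        (∀ f, Tendsto (fun s => HamKernel.shifted K s f) atTop (𝓝 0)) ∧
        -- self-adjoint, Hilbert-Schmidt, integrable
        (∀ t ≥ 0, IsSelfAdjoint (HamKernel.shifted K t)) ∧
        (∀ t ≥ 0, HamKernel.IsHilbertSchmidt (HamKernel.shifted K t)) ∧
        (∀ t ≥ 0, HamKernel.IsIntegrableKernel
          fun x y => HamKernel.kernel E F lam Ψ (x + t) (y + t)) ∧
        -- trace class, and the trace formula
        (∀ t ≥ 0, IntegrableOn (HamKernel.diagonal E F lam Ψ) (Ioi t) ∧
          HamKernel.HasTrace (HamKernel.shifted K t)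
            (∫ x in Ioi t, HamKernel.diagonal E F lam Ψ x)) ∧
        -- for finite sums, the operator with kernel `∂K_{t,λ}/∂t` has finite rank
        (HamKernel.DividedDifferenceFinitePos ε E → HamKernel.DividedDifferenceFinitePos ε F →
          ∀ t > 0,
            (∀ x > 0, ∀ y > 0, DifferentiableAt ℝ
              (fun s : ℝ => HamKernel.kernel E F lam Ψ (x + s) (y + s)) t) ∧
            ∃ R : HamKernel.L2 →L[ℂ] HamKernel.L2,
              HamKernel.HasKernel R
                (fun x y => deriv (fun s : ℝ => HamKernel.kernel E F lam Ψ (x + s) (y + s)) t) ∧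
              FiniteDimensional ℂ (LinearMap.range (R : HamKernel.L2 →ₗ[ℂ] HamKernel.L2)))) ∧
    -- A family of solutions with parameter in a domain that is symmetric about the real axis.
    (∀ D : Set ℂ, IsOpen D → IsConnected D → (∀ lam ∈ D, conj lam ∈ D) →
      (∀ lam : ℝ, 0 < lam → (lam : ℂ) ∈ D) →
      ∀ Ψ : ℂ → ℝ → Fin m ⊕ Fin m → ℂ,
      (∀ lam ∈ D, HamKernel.IsBoundedL2Solution E F lam (Ψ lam)) →
      (∀ lam : ℝ, 0 < lam → HamKernel.IsRealValued (Ψ lam)) →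
      HamKernel.IsAnalyticFamily D Ψ →
      ∃ K : ℂ → HamKernel.L2 →L[ℂ] HamKernel.L2,
        (∀ lam ∈ D, HamKernel.HasKernel (K lam) (HamKernel.kernel E F lam (Ψ lam))) ∧
        ∀ t ≥ 0,
          (∀ lam ∈ D, HamKernel.HasKernel (HamKernel.shifted (K lam) t)
            fun x y => HamKernel.kernel E F lam (Ψ lam) (x + t) (y + t)) ∧
          AnalyticOnNhd ℂ (fun lam => HamKernel.shifted (K lam) t) D ∧
          (∀ lam ∈ D, HamKernel.shifted (K (conj lam)) t =
            ContinuousLinearMap.adjoint (HamKernel.shifted (K lam) t)) ∧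
          (∀ lam ∈ D, HamKernel.IsHilbertSchmidt (HamKernel.shifted (K lam) t)) ∧
          (∀ lam ∈ D, HamKernel.IsIntegrableKernel
            fun x y => HamKernel.kernel E F lam (Ψ lam) (x + t) (y + t))) := by
  -- The alternative ε = ±1 is needed only in this form, which treats both signs at once.
  have hsq : ε * ε = 1 := by rcases hε with rfl | rfl <;> norm_num
  obtain ⟨c, hc, htame⟩ := HamKernel.exists_isTame hE hF
  refine ⟨fun lam hlam Ψ h hΨ => ?_, fun D hD hDc hDs hDp Ψ hΨ hreal hA =>
    HamKernel.analytic_family hE hF hD hDc hDs hDp hΨ hreal hA⟩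
  have ht := htame _ _ h
  obtain ⟨K, hK⟩ := ht.exists_hasKernel (E := E) (F := F) (lam := lam)
  obtain ⟨LE, hLE, hLEc, GE, hGE⟩ := hEpos
  obtain ⟨LF, hLF, hLFc, GF, hGF⟩ := hFpos
  obtain ⟨w, hw⟩ := HamKernel.exists_isCumulative hE hF hsq hlam h hΨ hLE hLF hLEc hLFc hGE hGF
  refine ⟨K, hK, fun t h0 => hK.shifted h0, HamKernel.isBoundedC0Semigroup_adjoint_shift,
    HamKernel.satisfiesLyapunov_shifted K, fun t h0 => hw.nonneg hK h0, hw.exists_le_one hK,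
    hw.antitoneOn hK, hw.tendsto_apply hK, fun t h0 => ?_,
    fun t h0 => ht.isHilbertSchmidt_shifted hK h0, fun t h0 => ht.isIntegrableKernel h0,
    fun t h0 => ⟨?_, ?_⟩,
    fun hEfin hFfin t h0 =>
      HamKernel.exists_finiteRank_deriv hE hF hsq hlam h hΨ hEfin hFfin h0⟩
  · rw [ContinuousLinearMap.isSelfAdjoint_iff', HamKernel.shifted_adjoint,
      (ContinuousLinearMap.isSelfAdjoint_iff').1 (ht.isSelfAdjoint hΨ hK)]
  · exact IntegrableOn.mono_set (HamKernel.integrable_diagonal hE hF ht) (Ioi_subset_Ioi h0)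
  · simpa only [HamKernel.kernel_self] using hw.hasTrace hK h0
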